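/- All algebras are over $\mathbb{C}$. Let $r\geq 1$. **Sergeev superalgebra.** $\mathcal{H}_c(r)$ is the unital associative superalgebra generated by even elements $s_1,\dots,s_{r-1}$ and odd elements $c_1,\dots,c_r$ subject to $$c_i^2=1,\quad c_ic_j=-c_jc_i\ (i\neq j),\qquad s_i^2=1,\quad s_is_{i+1}s_i=s_{i+1}s_is_{i+1},\quad s_is_j=s_js_i\ (i\neq j\pm1),$$ $$c_is_i=s_ic_{i+1},\quad c_{i+1}s_i=s_ic_i,\quad c_js_i=s_ic_j\ (j\neq i,i+1).$$ **Web superalgebra.** Let $\mathsf{A}(r)$ be the set of finite sequences of positive integers of sum $r$. The superalgebra $W=W(r)$ is generated by the following webs, read from bottom to top, for sequences $x,y$ of positive integers and $k,l>0$ such that the boundary sequences lie in $\mathsf{A}(r)$: the identity $\mathsf{a}$ with bottom and top $\mathsf{a}\in\mathsf{A}(r)$; the merge $m^{k,l}_{x,y}$ with bottom $(x,k,l,y)$ and top $(x,k+l,y)$; the split $\sigma^{k,l}_{x,y}$ with bottom $(x,k+l,y)$ and top $(x,k,l,y)$; and the dot $d^{k}_{x,y}$ with bottom and top $(x,k,y)$.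 Dots are odd and all other generators are even. In a product $w_1w_2$ the web $w_1$ is drawn on top of $w_2$. The product of two generators is $0$ if the bottom of the first differs from the top of the second, $\mathsf{b}\,w=w=w\,\mathsf{a}$ for every generator $w$ with bottom $\mathsf{a}$ and top $\mathsf{b}$, and $\sum_{\mathsf{a}\in\mathsf{A}(r)}\mathsf{a}=1$. Two generators acting on disjoint sets of strands at adjacent heights may exchange heights, with a sign $-1$ exactly when both are dots. In addition the following local relations hold, with arbitrary identity strands $x$ to the left and $y$ to the right and all $h,k,l>0$; here strands labeled $0$ are erased and merges and splits involving a $0$-strand are read as identities. Write $d_1,d_2$ for a dot on the first or second of two adjacent strands, $m^{k,l}$, $\sigma^{k,l}$, $d$ for a local merge, split, or dot on a single strand, and $1_{k}$, $1_{k,l}$ for local identities. 1. Associativity: $m^{h+k,l}(m^{h,k}\otimes 1_l)=m^{h,k+l}(1_h\otimes m^{k,l})$ and $(\sigma^{h,k}\otimes 1_l)\sigma^{h+k,l}=(1_h\otimes\sigma^{k,l})\sigma^{h,k+l}$. 2. $m^{k,l}\sigma^{k,l}=\binom{k+l}{l}1_{k+l}$, and $d\,d=k\,1_k$ on a $k$-strand.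 3. $d\,m^{k,l}=m^{k,l}d_1+m^{k,l}d_2$ and $\sigma^{k,l}d=d_1\sigma^{k,l}+d_2\sigma^{k,l}$ whenever $k=1$ or $l=1$. 4. $\sigma^{1,1}m^{1,1}-d_1d_2\,\sigma^{1,1}m^{1,1}\,d_1d_2=2\cdot 1_{1,1}$. 5. Let $e$ (respectively $f$) be the ladder on two adjacent strands moving a $1$-strand (the rung) from the right strand to the left one (respectively from left to right): on strands labeled $k,l$, $e=(m^{k,1}\otimes 1_{l-1})(1_k\otimes\sigma^{1,l-1})$ and $f=(1_{k-1}\otimes m^{1,l})(\sigma^{k-1,1}\otimes 1_l)$. Let $\bar e,\bar f$ be the same ladders with a dot on the rung. On strands labeled $k,l$: $$ef-fe=(k-l)1_{k,l},\qquad \bar e f-f\bar e=d_1-d_2=e\bar f-\bar f e.$$ 6. On three adjacent strands labeled $h,k,l$, let index $1$ (respectively $2$) mean that a ladder is on the first two (respectively last two) strands: $$e_1e_2-e_2e_1=\bar e_1\bar e_2+\bar e_2\bar e_1,\qquad e_1\bar e_2-\bar e_2e_1=\bar e_1e_2-e_2\bar e_1,$$ $$f_2f_1-f_1f_2=\bar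 f_2\bar f_1+\bar f_1\bar f_2,\qquad f_2\bar f_1-\bar f_1f_2=\bar f_2f_1-f_1\bar f_2.$$ **Statement.** Let $\mathsf{a}_\omega=(1,\dots,1)\in\mathsf{A}(r)$, an idempotent of $W$, and regard $\mathsf{a}_\omega W\mathsf{a}_\omega$ as a superalgebra with unit $\mathsf{a}_\omega$. There is an isomorphism of superalgebras $$\xi\colon\mathcal{H}_c(r)\xrightarrow{\ \sim\ }\mathsf{a}_\omega W\mathsf{a}_\omega$$ such that, for $1\leq i\leq r-1$ and $1\leq j\leq r$, $\xi(s_i)$ is the crossing of the $i$-th and $(i+1)$-st strands, i.e. the split $\sigma^{1,1}$ on top of the merge $m^{1,1}$ on these two $1$-strands minus $\mathsf{a}_\omega$, and $\xi(c_j)$ is the dot on the $j$-th strand. -/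

import Mathlib

namespace QWeb

noncomputable section

/-! ### Superalgebras presented by homogeneous generators and relations -/

/-- In the algebra generated by `X` subject to `rel`, where the generator `g` is declared to have
parity `par g`: the part of parity `p`, spanned by the words in the generators whose letters have
total parity `p`. -/
def parityPart {X : Type} (par : X → ZMod 2)
    (rel : FreeAlgebra ℂ X → FreeAlgebra ℂ X → Prop) (p : ZMod 2) :
    Submodule ℂ (RingQuot rel) :=
  Submodule.span ℂ {w | ∃ l : List X, (l.map par).sum = p ∧
    w = RingQuot.mkAlgHom ℂ rel (l.map (FreeAlgebra.ι ℂ)).prod}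

/-! ### The Sergeev superalgebra -/

/-- Generators of the Sergeev superalgebra of rank `r`. Indices start at `0`: `s i` and `c j` are
the generators usually written `s_{i+1}` and `c_{j+1}`. -/
inductive SergeevGen (r : ℕ) : Type
  | s (i : ℕ) (hi : i + 1 < r) : SergeevGen r
  | c (j : ℕ) (hj : j < r) : SergeevGen r

/-- The `s_i` are even and the `c_j` are odd. -/
def SergeevGen.parity {r : ℕ} : SergeevGen r → ZMod 2
  | .s _ _ => 0
  | .c _ _ => 1

/-- The generator `s` in the free algebra. -/
def fs {r : ℕ} (i : ℕ) (hi : i + 1 < r) : FreeAlgebra ℂ (SergeevGen r) :=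
  FreeAlgebra.ι ℂ (SergeevGen.s i hi)

/-- The generator `c` in the free algebra. -/
def fc {r : ℕ} (j : ℕ) (hj : j < r) : FreeAlgebra ℂ (SergeevGen r) :=
  FreeAlgebra.ι ℂ (SergeevGen.c j hj)

/-- Defining relations of the Sergeev superalgebra: the Clifford relations, the Coxeter relations of
the symmetric group, and the permutation of the Clifford generators by the symmetric group. -/
inductive SergeevRel (r : ℕ) :
    FreeAlgebra ℂ (SergeevGen r) → FreeAlgebra ℂ (SergeevGen r) → Prop
  | c_sq (i : ℕ) (hi : i < r) : SergeevRel r (fc i hi * fc i hi) 1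
  | c_anti (i j : ℕ) (hi : i < r) (hj : j < r) (hij : i ≠ j) :
      SergeevRel r (fc i hi * fc j hj) (-(fc j hj * fc i hi))
  | s_sq (i : ℕ) (hi : i + 1 < r) : SergeevRel r (fs i hi * fs i hi) 1
  | braid (i : ℕ) (hi : i + 1 < r) (hi' : i + 1 + 1 < r) :
      SergeevRel r (fs i hi * fs (i + 1) hi' * fs i hi)
        (fs (i + 1) hi' * fs i hi * fs (i + 1) hi')
  | s_comm (i j : ℕ) (hi : i + 1 < r) (hj : j + 1 < r) (h₁ : i ≠ j + 1) (h₂ : j ≠ i + 1) :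
      SergeevRel r (fs i hi * fs j hj) (fs j hj * fs i hi)
  | c_s (i : ℕ) (hi : i + 1 < r) (hi' : i < r) :
      SergeevRel r (fc i hi' * fs i hi) (fs i hi * fc (i + 1) hi)
  | c_succ_s (i : ℕ) (hi : i + 1 < r) (hi' : i < r) :
      SergeevRel r (fc (i + 1) hi * fs i hi) (fs i hi * fc i hi')
  | c_s_far (i j : ℕ) (hi : i + 1 < r) (hj : j < r) (h₁ : j ≠ i) (h₂ : j ≠ i + 1) :
      SergeevRel r (fc j hj * fs i hi) (fs i hi * fc j hj)

/-- The Sergeev superalgebra of rank `r`. -/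
abbrev Sergeev (r : ℕ) : Type := RingQuot (SergeevRel r)

/-- The element `s` of the Sergeev superalgebra. -/
def Sergeev.s {r : ℕ} (i : ℕ) (hi : i + 1 < r) : Sergeev r :=
  RingQuot.mkAlgHom ℂ (SergeevRel r) (fs i hi)

/-- The element `c` of the Sergeev superalgebra. -/
def Sergeev.c {r : ℕ} (j : ℕ) (hj : j < r) : Sergeev r :=
  RingQuot.mkAlgHom ℂ (SergeevRel r) (fc j hj)

/-- The part of parity `p` of the Sergeev superalgebra. -/
def Sergeev.part (r : ℕ) (p : ZMod 2) : Submodule ℂ (Sergeev r) :=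
  parityPart SergeevGen.parity (SergeevRel r) p

/-! ### Webs of type Q of total thickness `r` -/

/-- Boundary labels of webs: sequences of positive integers of sum `r`. -/
def IsObj (r : ℕ) (a : List ℕ) : Prop := (∀ k ∈ a, 0 < k) ∧ a.sum = r

/-- The elementary local webs. -/
inductive Piece : Type
  /-- Two strands `k`, `l` (below) merge into a strand `k + l` (above). -/
  | merge (k l : ℕ) : Piece
  /-- A strand `k + l` (below) splits into two strands `k`, `l` (above). -/
  | split (k l : ℕ) : Piece
  /-- A dot on a `k`-strand. -/
  | dot (k : ℕ) : Piece

/-- Labels along the bottom. -/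
def Piece.bot : Piece → List ℕ
  | .merge k l => [k, l]
  | .split k l => [k + l]
  | .dot k => [k]

/-- Labels along the top. -/
def Piece.top : Piece → List ℕ
  | .merge k l => [k + l]
  | .split k l => [k, l]
  | .dot k => [k]

/-- Number of dots. -/
def Piece.dots : Piece → ℕ
  | .merge _ _ => 0
  | .split _ _ => 0
  | .dot _ => 1

/-- Generating webs: identities, and merges, splits and dots with identity strands
labeled by `x` to the left and by `y` to the right. -/
inductive WebGen (r : ℕ) : Type
  | ident (a : List ℕ) (ha : IsObj r a) : WebGen r
  | layer (x : List ℕ) (p : Piece) (y : List ℕ)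
      (hb : IsObj r (x ++ p.bot ++ y)) (ht : IsObj r (x ++ p.top ++ y)) : WebGen r

/-- Labels along the bottom. -/
def WebGen.bot {r : ℕ} : WebGen r → List ℕ
  | .ident a _ => a
  | .layer x p y _ _ => x ++ p.bot ++ y

/-- Labels along the top. -/
def WebGen.top {r : ℕ} : WebGen r → List ℕ
  | .ident a _ => a
  | .layer x p y _ _ => x ++ p.top ++ y

theorem WebGen.bot_isObj {r : ℕ} : ∀ g : WebGen r, IsObj r g.bot
  | .ident _ ha => ha
  | .layer _ _ _ hb _ => hb

theorem WebGen.top_isObj {r : ℕ} : ∀ g : WebGen r, IsObj r g.top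
  | .ident _ ha => ha
  | .layer _ _ _ _ ht => ht

/-- The parity of a generating web is its number of dots modulo 2. -/
def WebGen.parity {r : ℕ} : WebGen r → ZMod 2
  | .ident _ _ => 0
  | .layer _ p _ _ _ => (p.dots : ZMod 2)

/-- The free algebra on the generating webs. The product `w₁ * w₂` stands for `w₁` on top
of `w₂`. -/
abbrev FreeWeb (r : ℕ) : Type := FreeAlgebra ℂ (WebGen r)

/-- Erase the strands labeled `0`. -/
def erase (a : List ℕ) : List ℕ := a.filter (fun k => 0 < k)

open Classical in
/-- The identity web with boundary `a`, after erasing `0`-strands (`0` unless the total thickness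
is `r`). -/
def ident (r : ℕ) (a : List ℕ) : FreeWeb r :=
  if h : IsObj r (erase a) then FreeAlgebra.ι ℂ (WebGen.ident (erase a) h) else 0

open Classical in
/-- The elementary web `p` with identity strands `x` to the left and `y` to the right, whose
`0`-strands are erased (`0` unless the total thickness is `r` and the labels of `p` are positive). -/
def layer (r : ℕ) (x : List ℕ) (p : Piece) (y : List ℕ) : FreeWeb r :=
  if h : IsObj r (erase x ++ p.bot ++ erase y) ∧ IsObj r (erase x ++ p.top ++ erase y) then
    FreeAlgebra.ι ℂ (WebGen.layer (erase x) p (erase y) h.1 h.2) else 0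

/-- Merge of strands `k`, `l` between the strands `x` and `y`. A merge with an erased `0`-strand is
an identity. -/
def merge (r : ℕ) (x : List ℕ) (k l : ℕ) (y : List ℕ) : FreeWeb r :=
  if k = 0 ∨ l = 0 then ident r (x ++ (k + l) :: y) else layer r x (.merge k l) y

/-- Split of a strand `k + l` into `k`, `l` between the strands `x` and `y`. A split with an erased
`0`-strand is an identity. -/
def split (r : ℕ) (x : List ℕ) (k l : ℕ) (y : List ℕ) : FreeWeb r :=
  if k = 0 ∨ l = 0 then ident r (x ++ (k + l) :: y) else layer r x (.split k l) y

/-- A dot on a strand `k` between the strands `x` and `y`; zero if `k = 0`. -/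
def dot (r : ℕ) (x : List ℕ) (k : ℕ) (y : List ℕ) : FreeWeb r :=
  layer r x (.dot k) y

/-- Ladder with one rung labeled `1` directed from right to left, with bottom labels `k`, `l` and
top labels `k + 1`, `l - 1`, for `0 < l`. -/
def rungL (r : ℕ) (x : List ℕ) (k l : ℕ) (y : List ℕ) : FreeWeb r :=
  merge r x k 1 ((l - 1) :: y) * split r (x ++ [k]) 1 (l - 1) y

/-- The same ladder with a dot on its rung. -/
def rungLDot (r : ℕ) (x : List ℕ) (k l : ℕ) (y : List ℕ) : FreeWeb r :=
  merge r x k 1 ((l - 1) :: y) * dot r (x ++ [k]) 1 ((l - 1) :: y) *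
    split r (x ++ [k]) 1 (l - 1) y

/-- Ladder with one rung labeled `1` directed from left to right, with bottom labels `k`, `l` and
top labels `k - 1`, `l + 1`, for `0 < k`. -/
def rungR (r : ℕ) (x : List ℕ) (k l : ℕ) (y : List ℕ) : FreeWeb r :=
  merge r (x ++ [k - 1]) 1 l y * split r x (k - 1) 1 (l :: y)

/-- The same ladder with a dot on its rung. -/
def rungRDot (r : ℕ) (x : List ℕ) (k l : ℕ) (y : List ℕ) : FreeWeb r :=
  merge r (x ++ [k - 1]) 1 l y * dot r (x ++ [k - 1]) 1 (l :: y) *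
    split r x (k - 1) 1 (l :: y)

/-- Two dots on neighbouring 1-strands drawn at the same height: the left one is the upper one. -/
def twoDots (r : ℕ) (x y : List ℕ) : FreeWeb r :=
  dot r x 1 (1 :: y) * dot r (x ++ [1]) 1 y

/-- Defining relations of the web superalgebra. The first four constructors say that products are
compatible with boundary labels and that the identity webs are orthogonal idempotents of sum `1`.
The others are local relations, with arbitrary identity strands `x`, `y` at both sides. -/
inductive WebRel (r : ℕ) : FreeWeb r → FreeWeb r → Prop
  | compat (g₁ g₂ : WebGen r) (h : g₁.bot ≠ g₂.top) :
      WebRel r (FreeAlgebra.ι ℂ g₁ * FreeAlgebra.ι ℂ g₂) 0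
  | ident_mul (g : WebGen r) :
      WebRel r (FreeAlgebra.ι ℂ (WebGen.ident g.top g.top_isObj) * FreeAlgebra.ι ℂ g)
        (FreeAlgebra.ι ℂ g)
  | mul_ident (g : WebGen r) :
      WebRel r (FreeAlgebra.ι ℂ g * FreeAlgebra.ι ℂ (WebGen.ident g.bot g.bot_isObj))
        (FreeAlgebra.ι ℂ g)
  | sum_ident : WebRel r (∑ a : Composition r, ident r a.blocks) 1
  /-- Superinterchange law. -/
  | interchange (x y z : List ℕ) (p q : Piece) :
      WebRel r
        (layer r x p (y ++ q.top ++ z) * layer r (x ++ p.bot ++ y) q z)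
        ((-1 : ℂ) ^ (p.dots * q.dots) •
          (layer r (x ++ p.top ++ y) q z * layer r x p (y ++ q.bot ++ z)))
  /-- Associativity of merges. -/
  | merge_assoc (x y : List ℕ) (h k l : ℕ) (hh : 0 < h) (hk : 0 < k) (hl : 0 < l) :
      WebRel r (merge r x (h + k) l y * merge r x h k (l :: y))
        (merge r x h (k + l) y * merge r (x ++ [h]) k l y)
  /-- Associativity of splits. -/
  | split_assoc (x y : List ℕ) (h k l : ℕ) (hh : 0 < h) (hk : 0 < k) (hl : 0 < l) :
      WebRel r (split r (x ++ [h]) k l y * split r x h (k + l) y)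
        (split r x h k (l :: y) * split r x (h + k) l y)
  /-- Digon removal. -/
  | digon (x y : List ℕ) (k l : ℕ) (hk : 0 < k) (hl : 0 < l) :
      WebRel r (merge r x k l y * split r x k l y)
        (((k + l).choose l : ℂ) • ident r (x ++ (k + l) :: y))
  /-- Dot collision. -/
  | dot_dot (x y : List ℕ) (k : ℕ) (hk : 0 < k) :
      WebRel r (dot r x k y * dot r x k y) ((k : ℂ) • ident r (x ++ k :: y))
  /-- Dots past merges and splits having a 1-strand as left leg. -/
  | dot_merge_left (x y : List ℕ) (k : ℕ) (hk : 0 < k) :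
      WebRel r (dot r x (1 + k) y * merge r x 1 k y)
        (merge r x 1 k y * dot r x 1 (k :: y) + merge r x 1 k y * dot r (x ++ [1]) k y)
  | split_dot_left (x y : List ℕ) (k : ℕ) (hk : 0 < k) :
      WebRel r (split r x 1 k y * dot r x (1 + k) y)
        (dot r x 1 (k :: y) * split r x 1 k y + dot r (x ++ [1]) k y * split r x 1 k y)
  /-- Dots past merges and splits having a 1-strand as right leg. -/
  | dot_merge_right (x y : List ℕ) (k : ℕ) (hk : 0 < k) :
      WebRel r (dot r x (k + 1) y * merge r x k 1 y)
        (merge r x k 1 y * dot r (x ++ [k]) 1 y + merge r x k 1 y * dot r x k (1 :: y))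
  | split_dot_right (x y : List ℕ) (k : ℕ) (hk : 0 < k) :
      WebRel r (split r x k 1 y * dot r x (k + 1) y)
        (dot r (x ++ [k]) 1 y * split r x k 1 y + dot r x k (1 :: y) * split r x k 1 y)
  /-- Dumbbell relation. -/
  | dumbbell (x y : List ℕ) :
      WebRel r
        (split r x 1 1 y * merge r x 1 1 y -
          twoDots r x y * split r x 1 1 y * merge r x 1 1 y * twoDots r x y)
        ((2 : ℂ) • ident r (x ++ 1 :: 1 :: y))
  /-- Square switch. -/
  | square (x y : List ℕ) (k l : ℕ) (hk : 0 < k) (hl : 0 < l) :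
      WebRel r
        (rungL r x (k - 1) (l + 1) y * rungR r x k l y -
          rungR r x (k + 1) (l - 1) y * rungL r x k l y)
        (((k : ℂ) - (l : ℂ)) • ident r (x ++ k :: l :: y))
  /-- Square switch with one dot. -/
  | square_dot (x y : List ℕ) (k l : ℕ) (hk : 0 < k) (hl : 0 < l) :
      WebRel r
        (rungLDot r x (k - 1) (l + 1) y * rungR r x k l y -
          rungR r x (k + 1) (l - 1) y * rungLDot r x k l y)
        (dot r x k (l :: y) - dot r (x ++ [k]) l y)
  | square_dot' (x y : List ℕ) (k l : ℕ) (hk : 0 < k) (hl : 0 < l) :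
      WebRel r
        (rungL r x (k - 1) (l + 1) y * rungRDot r x k l y -
          rungRDot r x (k + 1) (l - 1) y * rungL r x k l y)
        (dot r x k (l :: y) - dot r (x ++ [k]) l y)
  /-- Double rungs directed to the left. -/
  | rungs_left (x y : List ℕ) (h k l : ℕ) (hh : 0 < h) (hk : 0 < k) (hl : 0 < l) :
      WebRel r
        (rungL r x h (k + 1) ((l - 1) :: y) * rungL r (x ++ [h]) k l y -
          rungL r (x ++ [h + 1]) (k - 1) l y * rungL r x h k (l :: y))
        (rungLDot r x h (k + 1) ((l - 1) :: y) * rungLDot r (x ++ [h]) k l y +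
          rungLDot r (x ++ [h + 1]) (k - 1) l y * rungLDot r x h k (l :: y))
  | rungs_left_dot (x y : List ℕ) (h k l : ℕ) (hh : 0 < h) (hk : 0 < k) (hl : 0 < l) :
      WebRel r
        (rungL r x h (k + 1) ((l - 1) :: y) * rungLDot r (x ++ [h]) k l y -
          rungLDot r (x ++ [h + 1]) (k - 1) l y * rungL r x h k (l :: y))
        (rungLDot r x h (k + 1) ((l - 1) :: y) * rungL r (x ++ [h]) k l y -
          rungL r (x ++ [h + 1]) (k - 1) l y * rungLDot r x h k (l :: y))
  /-- Double rungs directed to the right: the mirror images of the previous two. -/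
  | rungs_right (x y : List ℕ) (h k l : ℕ) (hh : 0 < h) (hk : 0 < k) (hl : 0 < l) :
      WebRel r
        (rungR r (x ++ [h - 1]) (k + 1) l y * rungR r x h k (l :: y) -
          rungR r x h (k - 1) ((l + 1) :: y) * rungR r (x ++ [h]) k l y)
        (rungRDot r (x ++ [h - 1]) (k + 1) l y * rungRDot r x h k (l :: y) +
          rungRDot r x h (k - 1) ((l + 1) :: y) * rungRDot r (x ++ [h]) k l y)
  | rungs_right_dot (x y : List ℕ) (h k l : ℕ) (hh : 0 < h) (hk : 0 < k) (hl : 0 < l) :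
      WebRel r
        (rungR r (x ++ [h - 1]) (k + 1) l y * rungRDot r x h k (l :: y) -
          rungRDot r x h (k - 1) ((l + 1) :: y) * rungR r (x ++ [h]) k l y)
        (rungRDot r (x ++ [h - 1]) (k + 1) l y * rungR r x h k (l :: y) -
          rungR r x h (k - 1) ((l + 1) :: y) * rungRDot r (x ++ [h]) k l y)

/-- The web superalgebra `W(r)`. -/
abbrev Web (r : ℕ) : Type := RingQuot (WebRel r)

/-- The class of a formal combination of webs. -/
def Web.mk (r : ℕ) : FreeWeb r →ₐ[ℂ] Web r := RingQuot.mkAlgHom ℂ (WebRel r)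

/-- The part of parity `p` of the web superalgebra. -/
def Web.part (r : ℕ) (p : ZMod 2) : Submodule ℂ (Web r) :=
  parityPart WebGen.parity (WebRel r) p

/-- `n` parallel 1-strands. -/
def ones (n : ℕ) : List ℕ := List.replicate n 1

theorem ones_isObj (r : ℕ) : IsObj r (ones r) := by
  refine ⟨fun k hk => ?_, by simp [ones]⟩
  rw [List.eq_of_mem_replicate hk]
  exact one_pos

/-- The idempotent `a_ω`: the identity web on `r` 1-strands. -/
def omega (r : ℕ) : Web r := Web.mk r (FreeAlgebra.ι ℂ (WebGen.ident (ones r) (ones_isObj r)))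

theorem omega_idem (r : ℕ) : IsIdempotentElem (omega r) := by
  have h := RingQuot.mkAlgHom_rel ℂ (WebRel.ident_mul (WebGen.ident (ones r) (ones_isObj r)))
  rw [map_mul] at h
  exact h

/-- The crossing of the 1-strands in positions `i` and `i + 1` (counted from `0`): split after
merge, minus the identity. -/
def crossing (r i : ℕ) : Web r :=
  Web.mk r (split r (ones i) 1 1 (ones (r - (i + 2))) * merge r (ones i) 1 1 (ones (r - (i + 2))))
    - omega r

/-- The dot on the 1-strand in position `j` (counted from `0`). -/
def strandDot (r j : ℕ) : Web r := Web.mk r (dot r (ones j) 1 (ones (r - (j + 1))))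

/-! ### The corner `a_ω W a_ω` -/

/-- The corner `e A e` of an idempotent `e` in an algebra is an algebra, with unit `e`. -/
instance cornerAlgebra {A : Type} [Ring A] [Algebra ℂ A] {e : A} (he : IsIdempotentElem e) :
    Algebra ℂ he.Corner where
  smul z w := ⟨z • w.1, (Subsemigroup.mem_corner_iff he).2 (by
    have h := (Subsemigroup.mem_corner_iff he).1 w.2
    exact ⟨by rw [mul_smul_comm, h.1], by rw [smul_mul_assoc, h.2]⟩)⟩
  algebraMap :=
    { toFun := fun z => ⟨z • e, (Subsemigroup.mem_corner_iff he).2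
        ⟨by rw [mul_smul_comm, he.eq], by rw [smul_mul_assoc, he.eq]⟩⟩
      map_one' := Subtype.ext (one_smul ℂ e)
      map_mul' := fun a b => Subtype.ext (by
        change (a * b) • e = (a • e) * (b • e)
        rw [smul_mul_smul_comm, he.eq])
      map_zero' := Subtype.ext (zero_smul ℂ e)
      map_add' := fun a b => Subtype.ext (add_smul a b e) }
  commutes' z w := Subtype.ext (by
    have h := (Subsemigroup.mem_corner_iff he).1 w.2
    change (z • e) * w.1 = w.1 * (z • e)
    rw [mul_smul_comm, smul_mul_assoc, h.1, h.2])
  smul_def' z w := Subtype.ext (by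
    have h := (Subsemigroup.mem_corner_iff he).1 w.2
    change z • w.1 = (z • e) * w.1
    rw [smul_mul_assoc, h.1])

/-- The algebra `a_ω W a_ω`. -/
abbrev OmegaWeb (r : ℕ) : Type := (omega_idem r).Corner

end

end QWeb

/-! The homomorphism `sergeevHom` exists because crossings and dots already satisfy the Sergeev
relations. Write X = S + ω for the split after the merge of two adjacent 1-strands. Digon removal
gives X² = 2X, hence S² = ω. Two instances of the square switch identify X₁X₂X₁ − X₁ and X₂X₁X₂ − X₂
with the same web, which merges three strands into one and splits it again; this is the braid
relation. By the dumbbell relation S anticommutes with the product of the two dots; as it commutes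
with their sum, it must exchange them (`crossing_mul_of_dumbbell`).

Surjectivity: every web with bottom (1,…,1) is a combination of webs that merge 1-strands into thick
strands, placed on top of elements of the image. The span `explodeSpan` of such products is stable
under left multiplication by every generator. A merge is absorbed by associativity. A dot slides
down to the thin strands. Splitting off a 1-strand is pushed down by the square switch
(`webSplit_one_mul_explode`), and digon removal reduces every split to this case after division by
an integer. The span contains ω, so it contains Wω; multiplying by ω on the left kills all summands
whose top is not (1,…,1) and leaves only the image.

Injectivity: W acts by matrices over the Sergeev superalgebra. With e_a the Young symmetrizer of a,
a web from a to b acts as a matrix unit with entry in e_b H e_a: a split gives the symmetrizer of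
its bottom, a merge gives a binomial coefficient times the symmetrizer of its top, a dot gives the
sum of the c_j on its strand times the symmetrizer. The web relations (`SergeevFamily.rep_rel`) come
down to two facts: an explicit value of z e w when z and w are invariant under a subgroup that
separates one strand from a block (`SergeevFamily.smul_mid_right`, `SergeevFamily.smul_cycle_right`
and mirror images), and e c_{i+1} e = e c_i e when s_i preserves the blocks of e. At (1,…,1) the
symmetrizer is 1 and crossings and dots have entries s_i and c_j, so an element of the Sergeev
superalgebra can be read off from the operator of its image. The entries have the parity of the
webs, so parity is both preserved and reflected. -/

namespace QWeb

noncomputable section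

/-! ### Symmetrizers in algebras with a braid family of involutions -/

section Symmetrizer

variable {A : Type} [Ring A] [Algebra ℂ A]

/-- The element `f` is the symmetrizing idempotent of the subalgebra generated by the `s i` with
`i ∈ I`. -/
structure IsSymmetrizer (s : ℕ → A) (I : Set ℕ) (f : A) : Prop where
  mem : f ∈ Algebra.adjoin ℂ (s '' I)
  left : ∀ i ∈ I, s i * f = f
  right : ∀ i ∈ I, f * s i = f
  fix_left : ∀ v, (∀ i ∈ I, s i * v = v) → f * v = v
  fix_right : ∀ v, (∀ i ∈ I, v * s i = v) → v * f = v

/-- The product `f * g` equals both factors, since each of them fixes whatever is invariant.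
Left-handed and right-handed constructions of a symmetrizer are compared in this way. -/
theorem IsSymmetrizer.unique {s : ℕ → A} {I : Set ℕ} {f g : A} (hf : IsSymmetrizer s I f)
    (hg : IsSymmetrizer s I g) : f = g := by
  rw [← hf.fix_left g hg.left, hg.fix_right f hf.right]

theorem IsSymmetrizer.commute {s : ℕ → A} {I : Set ℕ} {f v : A} (hf : IsSymmetrizer s I f)
    (hv : ∀ i ∈ I, Commute (s i) v) : Commute f v := by
  have h : f ∈ Subalgebra.centralizer ℂ {v} := by
    refine Algebra.adjoin_le ?_ hf.mem
    rintro _ ⟨i, hi, rfl⟩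
    simp only [Subalgebra.coe_centralizer, Set.mem_centralizer_iff, Set.mem_singleton_iff,
      forall_eq]
    exact (hv i hi).eq.symm
  rw [Subalgebra.mem_centralizer_iff] at h
  exact (h v rfl).symm

theorem isSymmetrizer_one (s : ℕ → A) : IsSymmetrizer s ∅ 1 :=
  ⟨one_mem _, by simp, by simp, by simp, by simp⟩

theorem IsSymmetrizer.mul {s : ℕ → A} {I J : Set ℕ} {f g : A} (hf : IsSymmetrizer s I f)
    (hg : IsSymmetrizer s J g) (h : ∀ i ∈ I, ∀ j ∈ J, Commute (s i) (s j)) :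
    IsSymmetrizer s (I ∪ J) (f * g) where
  mem := mul_mem (Algebra.adjoin_mono (Set.image_mono Set.subset_union_left) hf.mem)
    (Algebra.adjoin_mono (Set.image_mono Set.subset_union_right) hg.mem)
  left := by
    rintro i (hi | hi)
    · rw [← mul_assoc, hf.left i hi]
    · rw [← mul_assoc, ← (hf.commute fun k hk => h k hk i hi).eq, mul_assoc, hg.left i hi]
  right := by
    rintro i (hi | hi)
    · rw [mul_assoc, (hg.commute fun k hk => (h i hi k hk).symm).eq, ← mul_assoc, hf.right i hi]
    · rw [mul_assoc, hg.right i hi]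
  fix_left v hv := by
    rw [mul_assoc, hg.fix_left v fun i hi => hv i (Or.inr hi),
      hf.fix_left v fun i hi => hv i (Or.inl hi)]
  fix_right v hv := by
    rw [← mul_assoc, hf.fix_right v fun i hi => hv i (Or.inl hi),
      hg.fix_right v fun i hi => hv i (Or.inr hi)]

theorem IsSymmetrizer.of_comp {s : ℕ → A} {g : ℕ → ℕ} {I : Set ℕ} {f : A}
    (hf : IsSymmetrizer (fun i => s (g i)) I f) : IsSymmetrizer s (g '' I) f where
  mem := by
    have h := hf.mem
    rwa [← Function.comp_def, Set.image_comp] at h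
  left := by
    rintro _ ⟨i, hi, rfl⟩
    exact hf.left i hi
  right := by
    rintro _ ⟨i, hi, rfl⟩
    exact hf.right i hi
  fix_left v hv := hf.fix_left v fun i hi => hv _ ⟨i, hi, rfl⟩
  fix_right v hv := hf.fix_right v fun i hi => hv _ ⟨i, hi, rfl⟩

/-- The elements `s 0, …, s (n - 1)` are involutions satisfying the braid relations. -/
structure BraidFamily (s : ℕ → A) (n : ℕ) : Prop where
  sq : ∀ i < n, s i * s i = 1
  braid : ∀ i, i + 1 < n → s i * s (i + 1) * s i = s (i + 1) * s i * s (i + 1)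
  comm : ∀ i j, i + 1 < j → j < n → Commute (s i) (s j)

omit [Algebra ℂ A] in
theorem BraidFamily.mono {s : ℕ → A} {m n : ℕ} (hs : BraidFamily s n) (h : m ≤ n) :
    BraidFamily s m :=
  ⟨fun i hi => hs.sq i (by omega), fun i hi => hs.braid i (by omega),
    fun i j hij hj => hs.comm i j hij (by omega)⟩

omit [Algebra ℂ A] in
theorem BraidFamily.shift {s : ℕ → A} {n m p : ℕ} (hs : BraidFamily s n) (h : p + m ≤ n) :
    BraidFamily (fun i => s (p + i)) m :=
  ⟨fun i hi => hs.sq _ (by omega), fun i hi => hs.braid (p + i) (by omega),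
    fun i j hij hj => hs.comm _ _ (by omega) (by omega)⟩

omit [Algebra ℂ A] in
-- Reading the strands from right to left: statements that single out the last strand become
-- statements that single out the first one.
theorem BraidFamily.reflect {s : ℕ → A} {n : ℕ} (hs : BraidFamily s n) :
    BraidFamily (fun i => s (n - 1 - i)) n := by
  refine ⟨fun i hi => hs.sq _ (by omega), fun i hi => ?_,
    fun i j hij hj => (hs.comm _ _ (by omega) (by omega)).symm⟩
  have h := hs.braid (n - 1 - (i + 1)) (by omega)
  rw [show n - 1 - (i + 1) + 1 = n - 1 - i by omega] at h
  exact h.symm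

open MulOpposite in
omit [Algebra ℂ A] in
theorem BraidFamily.op {s : ℕ → A} {n : ℕ} (hs : BraidFamily s n) :
    BraidFamily (fun i => op (s i)) n := by
  refine ⟨fun i hi => ?_, fun i hi => ?_, fun i j hij hj => ?_⟩
  · rw [← op_mul, hs.sq i hi, op_one]
  · simp only [← op_mul, ← mul_assoc]
    rw [hs.braid i hi]
  · exact (hs.comm i j hij hj).op

/-- The sum of the minimal representatives `s j * ⋯ * s (n - 1)`, for `0 ≤ j ≤ n`, of the left
cosets of `S_n` in `S_{n+1}`. -/
def cosetSum (s : ℕ → A) : ℕ → A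
  | 0 => 1
  | n + 1 => 1 + cosetSum s n * s n

/-- The product `s 0 * ⋯ * s (n - 1)`. -/
def cycleElt (s : ℕ → A) : ℕ → A
  | 0 => 1
  | n + 1 => cycleElt s n * s n

/-- The symmetrizer of `s 0, …, s (n - 1)`. -/
def symmetrizer (s : ℕ → A) : ℕ → A
  | 0 => 1
  | n + 1 => ((n : ℂ) + 2)⁻¹ • (cosetSum s (n + 1) * symmetrizer s n)

theorem mul_cosetSum (s : ℕ → A) (n : ℕ) (v : A) (hv : ∀ i < n, v * s i = v) :
    v * cosetSum s n = ((n : ℂ) + 1) • v := by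
  induction n with
  | zero => simp [cosetSum]
  | succ n ih =>
    rw [cosetSum, mul_add, ← mul_assoc, ih fun i hi => hv i (by omega), smul_mul_assoc,
      hv n (by omega), mul_one]
    push_cast
    module

theorem cosetSum_mul (s : ℕ → A) (n : ℕ) (v : A) (hv : ∀ i < n, s i * v = v) :
    cosetSum s n * v = ((n : ℂ) + 1) • v := by
  induction n with
  | zero => simp [cosetSum]
  | succ n ih =>
    rw [cosetSum, add_mul, mul_assoc, hv n (by omega), ih fun i hi => hv i (by omega), one_mul]
    push_cast
    module

/-- There are two double cosets of S_{n+1} in S_{n+2}: all summands except `1` end in `s n`, after a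
word that `v` absorbs. -/
theorem mul_cosetSum_succ (s : ℕ → A) (n : ℕ) (v : A) (hv : ∀ i < n, v * s i = v) :
    v * cosetSum s (n + 1) = v + ((n : ℂ) + 1) • (v * s n) := by
  rw [cosetSum, mul_add, ← mul_assoc, mul_cosetSum s n v hv, mul_one, smul_mul_assoc]

/-- Only the longest summand, the full cycle, contains `s 0`; the other `n` summands are absorbed by
`v`. -/
theorem mul_cosetSum_cycle (s : ℕ → A) (n : ℕ) (v : A)
    (hv : ∀ i < n, 0 < i → v * s i = v) :
    v * cosetSum s n = (n : ℂ) • v + v * cycleElt s n := by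
  induction n with
  | zero => simp [cosetSum, cycleElt]
  | succ n ih =>
    rw [cosetSum, mul_add, ← mul_assoc, ih fun i hi => hv i (by omega), cycleElt, add_mul,
      smul_mul_assoc, mul_one, mul_assoc]
    rcases Nat.eq_zero_or_pos n with rfl | hn
    · simp
    · rw [hv n (by omega) hn]
      push_cast
      module

omit [Algebra ℂ A] in
theorem commute_cosetSum {s : ℕ → A} {n : ℕ} {v : A} (hv : ∀ i < n, Commute (s i) v) :
    Commute (cosetSum s n) v := by
  induction n with
  | zero => exact Commute.one_left v
  | succ n ih =>
    exact (Commute.one_left v).add_left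
      ((ih fun i hi => hv i (by omega)).mul_left (hv n (by omega)))

omit [Algebra ℂ A] in
-- Left multiplication by a simple transposition permutes the cosets. The induction peels off the
-- last generator: `s n * v` is again invariant under the generators far from `s n`, so only the
-- case `j = n` needs the braid relation.
theorem BraidFamily.mul_cosetSum_mul {s : ℕ → A} {n : ℕ} (hs : BraidFamily s n) (v : A)
    (hv : ∀ i, i + 1 < n → s i * v = v) (j : ℕ) (hj : j < n) :
    s j * (cosetSum s n * v) = cosetSum s n * v := by
  induction n generalizing v j with
  | zero => omega
  | succ n ih =>
    have hw : ∀ i, i + 1 < n → s i * (s n * v) = s n * v := fun i hi => by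
      rw [← mul_assoc, (hs.comm i n hi (by omega)).eq, mul_assoc, hv i (by omega)]
    rw [cosetSum, add_mul, one_mul, mul_assoc, mul_add]
    rcases Nat.lt_succ_iff_lt_or_eq.1 hj with h | rfl
    · rw [hv j (by omega), ih (hs.mono (by omega)) _ hw j h]
    · have hsq := hs.sq j (by omega)
      cases j with
      | zero =>
        simp only [cosetSum, one_mul]
        rw [← mul_assoc, hsq, one_mul, add_comm]
      | succ m =>
        have hc : Commute (cosetSum s m) (s (m + 1)) :=
          commute_cosetSum fun i hi => hs.comm i (m + 1) (by omega) (by omega)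
        have hb := hs.braid m (by omega)
        -- The vector splits as v + s_{m+1} v + C s_m s_{m+1} v. Here s_{m+1} exchanges the first
        -- two terms and fixes the third, by the braid relation and s_m v = v.
        have h1 : s (m + 1) * (cosetSum s m * (s m * (s (m + 1) * v)))
            = cosetSum s m * (s m * (s (m + 1) * v)) := by
          rw [← mul_assoc, ← hc.eq, mul_assoc, ← mul_assoc (s m), ← mul_assoc (s (m + 1)),
            ← mul_assoc (s (m + 1)), ← hb, mul_assoc _ (s m) v, hv m (by omega), mul_assoc]
        have h2 : s (m + 1) * (s (m + 1) * v) = v := by rw [← mul_assoc, hsq, one_mul]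
        rw [cosetSum, add_mul, one_mul, mul_assoc, mul_add, h1, h2]
        abel

theorem symmetrizer_mem (s : ℕ → A) (n : ℕ) :
    symmetrizer s n ∈ Algebra.adjoin ℂ (s '' Set.Iio n) := by
  have hC : ∀ n, cosetSum s n ∈ Algebra.adjoin ℂ (s '' Set.Iio n) := fun n => by
    induction n with
    | zero => exact one_mem _
    | succ n ih =>
      refine add_mem (one_mem _) (mul_mem ?_ (Algebra.subset_adjoin ⟨n, by simp, rfl⟩))
      exact Algebra.adjoin_mono (Set.image_mono (Set.Iio_subset_Iio (by omega))) ih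
  induction n with
  | zero => exact one_mem _
  | succ n ih =>
    refine Subalgebra.smul_mem _ (mul_mem (hC _) ?_) _
    exact Algebra.adjoin_mono (Set.image_mono (Set.Iio_subset_Iio (by omega))) ih

theorem natCast_add_two_ne_zero (n : ℕ) : (n : ℂ) + 2 ≠ 0 := by
  exact_mod_cast Nat.succ_ne_zero (n + 1)

theorem mul_symmetrizer (s : ℕ → A) (n : ℕ) (v : A) (hv : ∀ i < n, v * s i = v) :
    v * symmetrizer s n = v := by
  induction n with
  | zero => simp [symmetrizer]
  | succ n ih =>
    rw [symmetrizer, mul_smul_comm, ← mul_assoc, mul_cosetSum s _ v hv, smul_mul_assoc,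
      ih fun i hi => hv i (by omega), smul_smul]
    have h := natCast_add_two_ne_zero n
    rw [show ((n : ℂ) + 2)⁻¹ * (((n + 1 : ℕ) : ℂ) + 1) = 1 by push_cast; field_simp; ring,
      one_smul]

theorem symmetrizer_mul (s : ℕ → A) (n : ℕ) (v : A) (hv : ∀ i < n, s i * v = v) :
    symmetrizer s n * v = v := by
  induction n with
  | zero => simp [symmetrizer]
  | succ n ih =>
    rw [symmetrizer, smul_mul_assoc, mul_assoc, ih fun i hi => hv i (by omega),
      cosetSum_mul s _ v hv, smul_smul]
    have h := natCast_add_two_ne_zero n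
    rw [show ((n : ℂ) + 2)⁻¹ * (((n + 1 : ℕ) : ℂ) + 1) = 1 by push_cast; field_simp; ring,
      one_smul]

theorem BraidFamily.mul_symmetrizer_left {s : ℕ → A} {n : ℕ} (hs : BraidFamily s n) (j : ℕ)
    (hj : j < n) : s j * symmetrizer s n = symmetrizer s n := by
  induction n generalizing j with
  | zero => omega
  | succ n ih =>
    rw [symmetrizer, mul_smul_comm, hs.mul_cosetSum_mul _
      (fun i hi => ih (hs.mono (by omega)) i (by omega)) j hj]

open MulOpposite in
-- The recursion makes left invariance visible but hides right invariance. The same construction in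
-- the opposite algebra gives a right invariant element, and the two coincide.
theorem BraidFamily.isSymmetrizer {s : ℕ → A} {n : ℕ} (hs : BraidFamily s n) :
    IsSymmetrizer s (Set.Iio n) (symmetrizer s n) := by
  have hR : ∀ j < n, unop (symmetrizer (fun i => MulOpposite.op (s i)) n) * s j
      = unop (symmetrizer (fun i => MulOpposite.op (s i)) n) := fun j hj => by
    have h := hs.op.mul_symmetrizer_left j hj
    exact congrArg unop h
  -- With g the element from the opposite algebra and f the symmetrizer, the product g f is g
  -- because g is right invariant, and f because f is left invariant.
  have heq : symmetrizer s n = unop (symmetrizer (fun i => MulOpposite.op (s i)) n) := by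
    have h1 := mul_symmetrizer s n _ hR
    have h2 := mul_symmetrizer (fun i => MulOpposite.op (s i)) n
      (MulOpposite.op (symmetrizer s n)) (fun i hi => by
        rw [← op_mul, hs.mul_symmetrizer_left i hi])
    have h3 := congrArg unop h2
    rw [unop_mul, unop_op] at h3
    exact h3.symm.trans h1
  refine ⟨symmetrizer_mem s n, fun i hi => hs.mul_symmetrizer_left i hi, fun i hi => ?_,
    fun v hv => symmetrizer_mul s n v hv, fun v hv => mul_symmetrizer s n v hv⟩
  rw [heq]
  exact hR i hi

theorem BraidFamily.symmetrizer_reflect {s : ℕ → A} {n : ℕ} (hs : BraidFamily s n) :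
    symmetrizer (fun i => s (n - 1 - i)) n = symmetrizer s n := by
  refine IsSymmetrizer.unique (I := Set.Iio n) ?_ hs.isSymmetrizer
  have h := IsSymmetrizer.of_comp (g := fun i => n - 1 - i) hs.reflect.isSymmetrizer
  convert h using 1
  ext i
  simp only [Set.mem_Iio, Set.mem_image]
  exact ⟨fun hi => ⟨n - 1 - i, by omega, by omega⟩, by rintro ⟨j, hj, rfl⟩; omega⟩

theorem smul_symmetrizer_succ (s : ℕ → A) (n : ℕ) :
    ((n : ℂ) + 2) • symmetrizer s (n + 1) = cosetSum s (n + 1) * symmetrizer s n := by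
  rw [symmetrizer, smul_smul, mul_inv_cancel₀ (natCast_add_two_ne_zero n), one_smul]

end Symmetrizer

/-! ### Block symmetrizers in Sergeev superalgebras -/

section Family

variable {A : Type} [Ring A] [Algebra ℂ A]

omit [Algebra ℂ A] in
theorem cosetSum_congr {s t : ℕ → A} {n : ℕ} (h : ∀ i < n, s i = t i) :
    cosetSum s n = cosetSum t n := by
  induction n with
  | zero => rfl
  | succ n ih => rw [cosetSum, cosetSum, ih fun i hi => h i (by omega), h n (by omega)]

theorem symmetrizer_congr {s t : ℕ → A} {n : ℕ} (h : ∀ i < n, s i = t i) :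
    symmetrizer s n = symmetrizer t n := by
  induction n with
  | zero => rfl
  | succ n ih =>
    rw [symmetrizer, symmetrizer, ih fun i hi => h i (by omega), cosetSum_congr h]

omit [Algebra ℂ A] in
theorem mul_cycleElt {s c : ℕ → A} {n : ℕ} (h : ∀ i < n, c i * s i = s i * c (i + 1)) :
    c 0 * cycleElt s n = cycleElt s n * c n := by
  induction n with
  | zero => simp [cycleElt]
  | succ n ih =>
    rw [cycleElt, ← mul_assoc, ih fun i hi => h i (by omega), mul_assoc, h n (by omega), mul_assoc]

/-- Elements satisfying the defining relations of the Sergeev superalgebra of rank `r`. -/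
structure SergeevFamily (r : ℕ) (s c : ℕ → A) : Prop where
  c_sq : ∀ i < r, c i * c i = 1
  c_anti : ∀ i < r, ∀ j < r, i ≠ j → c i * c j = -(c j * c i)
  s_sq : ∀ i, i + 1 < r → s i * s i = 1
  braid : ∀ i, i + 1 + 1 < r → s i * s (i + 1) * s i = s (i + 1) * s i * s (i + 1)
  s_comm : ∀ i j, i + 1 < r → j + 1 < r → i ≠ j + 1 → j ≠ i + 1 → Commute (s i) (s j)
  c_s : ∀ i, i + 1 < r → c i * s i = s i * c (i + 1)
  c_succ_s : ∀ i, i + 1 < r → c (i + 1) * s i = s i * c i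
  c_s_far : ∀ i j, i + 1 < r → j < r → j ≠ i → j ≠ i + 1 → Commute (c j) (s i)

omit [Algebra ℂ A] in
theorem SergeevFamily.braidFamily {r : ℕ} {s c : ℕ → A} (H : SergeevFamily r s c) :
    BraidFamily s (r - 1) :=
  ⟨fun i hi => H.s_sq i (by omega), fun i hi => H.braid i (by omega),
    fun i j hij hj => H.s_comm i j (by omega) (by omega) (by omega) (by omega)⟩

/-- The symmetrizer of the `k` strands from position `p` on. -/
def blockSymm (s : ℕ → A) (p k : ℕ) : A := symmetrizer (fun i => s (p + i)) (k - 1)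

/-- The positions of the simple transpositions preserving the `k` strands from position `p` on. -/
def blockIdx (p k : ℕ) : Set ℕ := {i | p ≤ i ∧ i + 1 < p + k}

/-- The product of the symmetrizers of consecutive blocks of strands of sizes `a`, from position
`p` on. -/
def youngSymm (s : ℕ → A) : ℕ → List ℕ → A
  | _, [] => 1
  | p, k :: a => blockSymm s p k * youngSymm s (p + k) a

/-- The simple transpositions preserving consecutive blocks of sizes `a`, from position `p` on. -/
def youngIdx : ℕ → List ℕ → Set ℕ
  | _, [] => ∅
  | p, k :: a => blockIdx p k ∪ youngIdx (p + k) a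

@[simp] theorem mem_youngIdx_nil {p i : ℕ} : i ∈ youngIdx p [] ↔ False := Iff.rfl

@[simp] theorem mem_youngIdx_cons {p k i : ℕ} {a : List ℕ} :
    i ∈ youngIdx p (k :: a) ↔ (p ≤ i ∧ i + 1 < p + k) ∨ i ∈ youngIdx (p + k) a := Iff.rfl

@[simp] theorem mem_youngIdx_append {p i : ℕ} {a b : List ℕ} :
    i ∈ youngIdx p (a ++ b) ↔ i ∈ youngIdx p a ∨ i ∈ youngIdx (p + a.sum) b := by
  induction a generalizing p with
  | nil => simp
  | cons k a ih => simp [ih, or_assoc, add_assoc]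

theorem lt_of_mem_youngIdx {p i : ℕ} {a : List ℕ} (h : i ∈ youngIdx p a) :
    p ≤ i ∧ i + 1 < p + a.sum := by
  induction a generalizing p with
  | nil => exact h.elim
  | cons k a ih =>
    rw [List.sum_cons]
    rcases h with h | h
    · exact ⟨h.1, by have := h.2; omega⟩
    · have := ih h
      omega

theorem youngSymm_append (s : ℕ → A) (p : ℕ) (a b : List ℕ) :
    youngSymm s p (a ++ b) = youngSymm s p a * youngSymm s (p + a.sum) b := by
  induction a generalizing p with
  | nil => simp [youngSymm]
  | cons k a ih => simp [youngSymm, ih, mul_assoc, add_assoc]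

@[simp] theorem blockSymm_zero (s : ℕ → A) (p : ℕ) : blockSymm s p 0 = 1 := rfl

@[simp] theorem blockSymm_one (s : ℕ → A) (p : ℕ) : blockSymm s p 1 = 1 := rfl

/-- Blocks of size `0` or `1` contribute the factor `1`, so strands labeled `0` can be kept in all
formulas and erased only at the end. -/
theorem youngSymm_erase (s : ℕ → A) (p : ℕ) (a : List ℕ) :
    youngSymm s p (erase a) = youngSymm s p a := by
  induction a generalizing p with
  | nil => rfl
  | cons k a ih =>
    rcases Nat.eq_zero_or_pos k with rfl | hk
    · simpa [erase, youngSymm] using ih p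
    · have := ih (p + k)
      simp only [erase] at this
      simp [erase, hk, youngSymm, this]

theorem youngSymm_ones (s : ℕ → A) (p n : ℕ) : youngSymm s p (ones n) = 1 := by
  induction n generalizing p with
  | zero => rfl
  | succ n ih =>
    have := ih (p + 1)
    simp only [ones] at this
    simp [ones, List.replicate_succ, youngSymm, this]

/-- Decomposition of the symmetrizer of k + 1 strands along the cosets of the permutations fixing
the last strand. -/
theorem smul_blockSymm_right (s : ℕ → A) (p k : ℕ) :
    ((k : ℂ) + 1) • blockSymm s p (k + 1) =
      cosetSum (fun i => s (p + i)) k * blockSymm s p k := by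
  cases k with
  | zero => simp [blockSymm, symmetrizer, cosetSum]
  | succ n =>
    have h := smul_symmetrizer_succ (fun i => s (p + i)) n
    simp only [blockSymm, Nat.add_sub_cancel]
    rw [← h]
    push_cast
    module

theorem smul_blockSymm_left {s : ℕ → A} {p k : ℕ} (hs : BraidFamily (fun i => s (p + i)) k) :
    ((k : ℂ) + 1) • blockSymm s p (k + 1) =
      cosetSum (fun i => s (p + (k - 1 - i))) k * blockSymm s (p + 1) k := by
  cases k with
  | zero => simp [blockSymm, symmetrizer, cosetSum]
  | succ n =>
    have h := smul_symmetrizer_succ (fun i => s (p + (n + 1 - 1 - i))) n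
    have h2 := hs.symmetrizer_reflect
    have hs' : BraidFamily (fun i => s (p + 1 + i)) n := by
      have := hs.shift (p := 1) (m := n) (by omega)
      simpa only [add_assoc] using this
    have h3 := hs'.symmetrizer_reflect
    simp only [blockSymm, Nat.add_sub_cancel] at h h2 ⊢
    rw [h2] at h
    -- The reflected family omits its last generator `s p`, so it must be identified with the
    -- symmetrizer of the block starting at `p + 1`; invariance under reflection does this.
    have h4 : symmetrizer (fun i => s (p + 1 + i)) n = symmetrizer (fun i => s (p + (n - i))) n :=
      h3.symm.trans (symmetrizer_congr fun i hi => congrArg s (by omega))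
    rw [h4, ← h]
    push_cast
    module

variable {r : ℕ} {s c : ℕ → A} (H : SergeevFamily r s c)

include H

theorem SergeevFamily.isSymmetrizer_block {p k : ℕ} (h : p + k ≤ r) :
    IsSymmetrizer s (blockIdx p k) (blockSymm s p k) := by
  cases k with
  | zero =>
    have hI : blockIdx p 0 = ∅ := by
      ext i
      simp [blockIdx]
      omega
    rw [hI]
    exact isSymmetrizer_one s
  | succ n =>
    have hb : BraidFamily (fun i => s (p + i)) n := H.braidFamily.shift (by omega)
    have hI : blockIdx p (n + 1) = (fun i => p + i) '' Set.Iio n := by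
      ext i
      simp only [blockIdx, Set.mem_ofPred_eq, Set.mem_image, Set.mem_Iio]
      exact ⟨fun hi => ⟨i - p, by omega, by omega⟩, by rintro ⟨j, hj, rfl⟩; omega⟩
    rw [hI]
    exact IsSymmetrizer.of_comp hb.isSymmetrizer

theorem SergeevFamily.isSymmetrizer {p : ℕ} {a : List ℕ} (h : p + a.sum ≤ r) :
    IsSymmetrizer s (youngIdx p a) (youngSymm s p a) := by
  induction a generalizing p with
  | nil => exact isSymmetrizer_one s
  | cons k a ih =>
    rw [List.sum_cons] at h
    refine (H.isSymmetrizer_block (by omega)).mul (ih (by omega)) fun i hi j hj => ?_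
    have h1 := lt_of_mem_youngIdx hj
    have h2 : p ≤ i ∧ i + 1 < p + k := hi
    exact H.s_comm i j (by omega) (by omega) (by omega) (by omega)

theorem SergeevFamily.mul_youngSymm {p : ℕ} {a : List ℕ} (h : p + a.sum ≤ r) {z : A}
    (hz : ∀ i ∈ youngIdx p a, z * s i = z) : z * youngSymm s p a = z :=
  (H.isSymmetrizer h).fix_right z hz

theorem SergeevFamily.youngSymm_mul {p : ℕ} {a : List ℕ} (h : p + a.sum ≤ r) {w : A}
    (hw : ∀ i ∈ youngIdx p a, s i * w = w) : youngSymm s p a * w = w :=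
  (H.isSymmetrizer h).fix_left w hw

theorem SergeevFamily.youngSymm_mul_youngSymm {a b : List ℕ} (ha : a.sum ≤ r) (hb : b.sum ≤ r)
    (hab : youngIdx 0 a ⊆ youngIdx 0 b) :
    youngSymm s 0 a * youngSymm s 0 b = youngSymm s 0 b :=
  H.youngSymm_mul (by omega) fun i hi => (H.isSymmetrizer (by omega)).left i (hab hi)

theorem SergeevFamily.youngSymm_mul_youngSymm' {a b : List ℕ} (ha : a.sum ≤ r) (hb : b.sum ≤ r)
    (hab : youngIdx 0 a ⊆ youngIdx 0 b) :
    youngSymm s 0 b * youngSymm s 0 a = youngSymm s 0 b :=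
  H.mul_youngSymm (by omega) fun i hi => (H.isSymmetrizer (by omega)).right i (hab hi)

theorem SergeevFamily.youngSymm_idem {a : List ℕ} (ha : a.sum ≤ r) :
    youngSymm s 0 a * youngSymm s 0 a = youngSymm s 0 a :=
  H.youngSymm_mul_youngSymm ha ha subset_rfl

/-- The symmetrizer in the middle disappears when each of its blocks is absorbed by one of the
neighbours. This is used where two webs act far apart. -/
theorem SergeevFamily.mul_youngSymm_append_mul {u v : List ℕ} (h : (u ++ v).sum ≤ r) {z w : A}
    (hz : ∀ i ∈ youngIdx 0 u, z * s i = z) (hw : ∀ i ∈ youngIdx u.sum v, s i * w = w) :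
    z * youngSymm s 0 (u ++ v) * w = z * w := by
  rw [List.sum_append] at h
  rw [youngSymm_append, ← mul_assoc, H.mul_youngSymm (by omega) hz, mul_assoc,
    H.youngSymm_mul (by omega) (by simpa using hw)]

theorem SergeevFamily.mul_youngSymm_append_mul' {u v : List ℕ} (h : (u ++ v).sum ≤ r) {z w : A}
    (hz : ∀ i ∈ youngIdx u.sum v, z * s i = z) (hw : ∀ i ∈ youngIdx 0 u, s i * w = w) :
    z * youngSymm s 0 (u ++ v) * w = z * w := by
  rw [List.sum_append] at h
  have hc : Commute (youngSymm s 0 u) (youngSymm s (0 + u.sum) v) :=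
    (H.isSymmetrizer (by omega)).commute fun i hi =>
      ((H.isSymmetrizer (by omega)).commute fun j hj => by
        have h1 := lt_of_mem_youngIdx hi
        have h2 := lt_of_mem_youngIdx hj
        exact H.s_comm j i (by omega) (by omega) (by omega) (by omega)).symm
  rw [youngSymm_append, hc.eq, ← mul_assoc, zero_add, H.mul_youngSymm (z := z) (by omega) hz,
    mul_assoc, H.youngSymm_mul (by omega) hw]

/-- All blocks of the middle symmetrizer are absorbed except the thick one, of which only the coset
sum remains. -/
theorem SergeevFamily.smul_mul_youngSymm_mul_right {x y : List ℕ} {k : ℕ}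
    (h : (x ++ (k + 1) :: y).sum ≤ r) {z w : A} (hz : ∀ i ∈ youngIdx 0 x, z * s i = z)
    (hw : ∀ i ∈ youngIdx x.sum (k :: 1 :: y), s i * w = w) :
    ((k : ℂ) + 1) • (z * youngSymm s 0 (x ++ (k + 1) :: y) * w) =
      z * cosetSum (fun i => s (x.sum + i)) k * w := by
  rw [List.sum_append, List.sum_cons] at h
  have h1 : youngSymm s (x.sum + (k + 1)) y * w = w :=
    H.youngSymm_mul (by omega) fun i hi => hw i (Or.inr (Or.inr (by rwa [add_assoc])))
  have h2 : blockSymm s x.sum k * w = w :=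
    (H.isSymmetrizer_block (by omega)).fix_left w fun i hi => hw i (Or.inl hi)
  rw [youngSymm_append, ← mul_assoc, H.mul_youngSymm (by omega) hz, youngSymm, zero_add,
    mul_assoc, mul_assoc, h1, ← mul_smul_comm, ← smul_mul_assoc, smul_blockSymm_right, mul_assoc,
    h2, mul_assoc]

theorem SergeevFamily.smul_mul_youngSymm_mul_left {x y : List ℕ} {k : ℕ}
    (h : (x ++ (k + 1) :: y).sum ≤ r) {z w : A} (hz : ∀ i ∈ youngIdx 0 x, z * s i = z)
    (hw : ∀ i ∈ youngIdx x.sum (1 :: k :: y), s i * w = w) :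
    ((k : ℂ) + 1) • (z * youngSymm s 0 (x ++ (k + 1) :: y) * w) =
      z * cosetSum (fun i => s (x.sum + (k - 1 - i))) k * w := by
  rw [List.sum_append, List.sum_cons] at h
  have h1 : youngSymm s (x.sum + (k + 1)) y * w = w :=
    H.youngSymm_mul (by omega) fun i hi => hw i (Or.inr (Or.inr (by
      rwa [add_assoc, add_comm 1 k])))
  have h2 : blockSymm s (x.sum + 1) k * w = w :=
    (H.isSymmetrizer_block (by omega)).fix_left w fun i hi => hw i (Or.inr (Or.inl hi))
  rw [youngSymm_append, ← mul_assoc, H.mul_youngSymm (by omega) hz, youngSymm, zero_add,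
    mul_assoc, mul_assoc, h1, ← mul_smul_comm, ← smul_mul_assoc,
    smul_blockSymm_left (H.braidFamily.shift (by omega)), mul_assoc, h2, mul_assoc]

end Family

/-! ### Sandwiched symmetrizers and sums of odd generators -/

section Identities

variable {A : Type} [Ring A] [Algebra ℂ A]

/-- Right multiplication by simple transpositions preserving the blocks `a` fixes `z`. -/
def RightFixed (s : ℕ → A) (a : List ℕ) (z : A) : Prop := ∀ i ∈ youngIdx 0 a, z * s i = z

/-- Left multiplication by simple transpositions preserving the blocks `a` fixes `w`. -/
def LeftFixed (s : ℕ → A) (a : List ℕ) (w : A) : Prop := ∀ i ∈ youngIdx 0 a, s i * w = w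

/-- The sum of the odd generators on the `k` strands from position `p` on. -/
def dotSum (c : ℕ → A) (p k : ℕ) : A := ∑ j ∈ Finset.range k, c (p + j)

omit [Algebra ℂ A] in
@[simp] theorem dotSum_zero (c : ℕ → A) (p : ℕ) : dotSum c p 0 = 0 := rfl

omit [Algebra ℂ A] in
@[simp] theorem dotSum_one (c : ℕ → A) (p : ℕ) : dotSum c p 1 = c p := by simp [dotSum]

omit [Algebra ℂ A] in
theorem dotSum_add (c : ℕ → A) (p k l : ℕ) :
    dotSum c p (k + l) = dotSum c p k + dotSum c (p + k) l := by
  simp [dotSum, Finset.sum_range_add, add_assoc]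

variable {r : ℕ} {s c : ℕ → A} (H : SergeevFamily r s c)

include H

theorem SergeevFamily.rightFixed {a b : List ℕ} (hb : b.sum ≤ r)
    (hab : youngIdx 0 a ⊆ youngIdx 0 b) : RightFixed s a (youngSymm s 0 b) :=
  fun i hi => (H.isSymmetrizer (by omega)).right i (hab hi)

theorem SergeevFamily.leftFixed {a b : List ℕ} (hb : b.sum ≤ r)
    (hab : youngIdx 0 a ⊆ youngIdx 0 b) : LeftFixed s a (youngSymm s 0 b) :=
  fun i hi => (H.isSymmetrizer (by omega)).left i (hab hi)

omit [Algebra ℂ A] in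
-- A block of size 1 meets no transposition that preserves the blocks. Hence a dot on such a strand
-- does not destroy invariance.
theorem SergeevFamily.commute_c_of_mem {a u v : List ℕ} {j i : ℕ} (ha : a.sum ≤ r)
    (hj : j = u.sum) (hu : a = u ++ 1 :: v) (hi : i ∈ youngIdx 0 a) : Commute (c j) (s i) := by
  subst hj hu
  have h0 := lt_of_mem_youngIdx hi
  rw [List.sum_append, List.sum_cons] at ha h0
  refine H.c_s_far i _ (by omega) (by omega) ?_ ?_ <;>
  · rcases mem_youngIdx_append.1 hi with h | h | h
    · have := lt_of_mem_youngIdx h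
      omega
    · obtain ⟨h1, h2⟩ := h
      omega
    · have := lt_of_mem_youngIdx h
      omega

omit [Algebra ℂ A] in
theorem SergeevFamily.rightFixed_mul_c {a : List ℕ} {z : A} {j : ℕ} (hz : RightFixed s a z)
    (u v : List ℕ) (ha : a.sum ≤ r) (hj : j = u.sum) (hu : a = u ++ 1 :: v) :
    RightFixed s a (z * c j) := fun i hi => by
  rw [mul_assoc, (H.commute_c_of_mem ha hj hu hi).eq, ← mul_assoc, hz i hi]

omit [Algebra ℂ A] in
theorem SergeevFamily.leftFixed_c_mul {a : List ℕ} {w : A} {j : ℕ} (hw : LeftFixed s a w)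
    (u v : List ℕ) (ha : a.sum ≤ r) (hj : j = u.sum) (hu : a = u ++ 1 :: v) :
    LeftFixed s a (c j * w) := fun i hi => by
  rw [← mul_assoc, ← (H.commute_c_of_mem ha hj hu hi).eq, mul_assoc, hw i hi]

/-- The double coset formula behind the square switch: what survives is the identity and the
transposition across the boundary of the two blocks. -/
theorem SergeevFamily.smul_mid_right {x y : List ℕ} {k : ℕ} {z w : A}
    (h : (x ++ (k + 2) :: y).sum ≤ r) (hz : RightFixed s (x ++ (k + 1) :: 1 :: y) z)
    (hw : LeftFixed s (x ++ (k + 1) :: 1 :: y) w) :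
    ((k : ℂ) + 2) • (z * youngSymm s 0 (x ++ (k + 2) :: y) * w) =
      z * w + ((k : ℂ) + 1) • (z * s (x.sum + k) * w) := by
  have h1 := H.smul_mul_youngSymm_mul_right (k := k + 1) h
    (fun i hi => hz i (by simp [hi])) (fun i hi => hw i (by simp only [mem_youngIdx_append]; simp_all))
  rw [mul_cosetSum_succ _ _ _ fun i hi => hz _ (by
    simp only [mem_youngIdx_append, mem_youngIdx_cons]; omega)] at h1
  rw [add_mul, smul_mul_assoc] at h1
  rw [← h1]
  push_cast
  module

theorem SergeevFamily.smul_mid_left {x y : List ℕ} {k : ℕ} {z w : A}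
    (h : (x ++ (k + 2) :: y).sum ≤ r) (hz : RightFixed s (x ++ 1 :: (k + 1) :: y) z)
    (hw : LeftFixed s (x ++ 1 :: (k + 1) :: y) w) :
    ((k : ℂ) + 2) • (z * youngSymm s 0 (x ++ (k + 2) :: y) * w) =
      z * w + ((k : ℂ) + 1) • (z * s x.sum * w) := by
  have h1 := H.smul_mul_youngSymm_mul_left (k := k + 1) h
    (fun i hi => hz i (by simp [hi])) (fun i hi => hw i (by simp only [mem_youngIdx_append]; simp_all))
  rw [mul_cosetSum_succ _ _ _ fun i hi => hz _ (by
    simp only [mem_youngIdx_append, mem_youngIdx_cons]; omega)] at h1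
  rw [add_mul, smul_mul_assoc, Nat.add_sub_cancel, Nat.sub_self, add_zero] at h1
  rw [← h1]
  push_cast
  module

/-- Here `z` sees the single strand on the left of the block and `w` sees it on the right, so the
nontrivial double coset is represented by the full cycle. This governs double rungs. -/
theorem SergeevFamily.smul_cycle_right {x y : List ℕ} {k : ℕ} {z w : A}
    (h : (x ++ (k + 1) :: y).sum ≤ r) (hz : RightFixed s (x ++ 1 :: k :: y) z)
    (hw : LeftFixed s (x ++ k :: 1 :: y) w) :
    ((k : ℂ) + 1) • (z * youngSymm s 0 (x ++ (k + 1) :: y) * w) =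
      (k : ℂ) • (z * w) + z * cycleElt (fun i => s (x.sum + i)) k * w := by
  rw [H.smul_mul_youngSymm_mul_right h (fun i hi => hz i (by simp [hi]))
    (fun i hi => hw i (by simp only [mem_youngIdx_append]; simp_all)),
    mul_cosetSum_cycle _ _ _ fun i hi h0 => hz _ (by
    simp only [mem_youngIdx_append, mem_youngIdx_cons]; omega), add_mul, smul_mul_assoc]

theorem SergeevFamily.smul_cycle_left {x y : List ℕ} {k : ℕ} {z w : A}
    (h : (x ++ (k + 1) :: y).sum ≤ r) (hz : RightFixed s (x ++ k :: 1 :: y) z)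
    (hw : LeftFixed s (x ++ 1 :: k :: y) w) :
    ((k : ℂ) + 1) • (z * youngSymm s 0 (x ++ (k + 1) :: y) * w) =
      (k : ℂ) • (z * w) + z * cycleElt (fun i => s (x.sum + (k - 1 - i))) k * w := by
  rw [H.smul_mul_youngSymm_mul_left h (fun i hi => hz i (by simp [hi]))
    (fun i hi => hw i (by simp only [mem_youngIdx_append]; simp_all)),
    mul_cosetSum_cycle _ _ _ fun i hi h0 => hz _ (by
    simp only [mem_youngIdx_append, mem_youngIdx_cons]; omega), add_mul, smul_mul_assoc]

omit [Algebra ℂ A] in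
theorem SergeevFamily.c_mul_cycle_right {q k : ℕ} (h : q + k < r) :
    c q * cycleElt (fun i => s (q + i)) k = cycleElt (fun i => s (q + i)) k * c (q + k) :=
  mul_cycleElt (c := fun i => c (q + i)) fun i hi => H.c_s (q + i) (by omega)

omit [Algebra ℂ A] in
theorem SergeevFamily.c_mul_cycle_left {q k : ℕ} (h : q + k < r) :
    c (q + k) * cycleElt (fun i => s (q + (k - 1 - i))) k =
      cycleElt (fun i => s (q + (k - 1 - i))) k * c q := by
  have h1 := mul_cycleElt (s := fun i => s (q + (k - 1 - i))) (c := fun i => c (q + (k - i)))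
    (n := k) fun i hi => by
      have := H.c_succ_s (q + (k - 1 - i)) (by omega)
      rw [show q + (k - 1 - i) + 1 = q + (k - i) by omega,
        show q + (k - 1 - i) = q + (k - (i + 1)) by omega] at this
      rw [show k - 1 - i = k - (i + 1) by omega]
      exact this
  simpa using h1

/-- Insert s_i next to the left symmetrizer, move it past the odd generator, and let the right
symmetrizer absorb it. -/
theorem SergeevFamily.mul_c_succ_mul {a : List ℕ} (ha : a.sum ≤ r) {i : ℕ}
    (hi : i ∈ youngIdx 0 a) :
    youngSymm s 0 a * c (i + 1) * youngSymm s 0 a = youngSymm s 0 a * c i * youngSymm s 0 a := by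
  have h := lt_of_mem_youngIdx hi
  have h1 := (H.isSymmetrizer (p := 0) (a := a) (by omega)).left i hi
  have h2 := (H.isSymmetrizer (p := 0) (a := a) (by omega)).right i hi
  calc youngSymm s 0 a * c (i + 1) * youngSymm s 0 a
      = youngSymm s 0 a * s i * c (i + 1) * youngSymm s 0 a := by rw [h2]
    _ = youngSymm s 0 a * c i * (s i * youngSymm s 0 a) := by
      rw [mul_assoc (youngSymm s 0 a) (s i), ← H.c_s i (by omega)]
      simp only [mul_assoc]
    _ = _ := by rw [h1]

/-- A transposition preserving the blocks either misses all summands or exchanges two neighbouring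
ones. -/
theorem SergeevFamily.commute_dotSum {p k : ℕ} {a : List ℕ} {x y : List ℕ}
    (h : a.sum ≤ r) (hp : p = x.sum) (ha : a = x ++ k :: y) :
    Commute (dotSum c p k) (youngSymm s 0 a) := by
  subst hp ha
  refine ((H.isSymmetrizer (by omega)).commute fun i hi => ?_).symm
  have h0 := lt_of_mem_youngIdx hi
  simp only [List.sum_append, List.sum_cons] at h h0
  have hfar : ∀ j < k, x.sum + j ≠ i → x.sum + j ≠ i + 1 → Commute (s i) (c (x.sum + j)) :=
    fun j hj h1 h2 => (H.c_s_far i _ (by omega) (by omega) h1 h2).symm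
  rcases mem_youngIdx_append.1 hi with h1 | h1 | h1
  · have := lt_of_mem_youngIdx h1
    exact Commute.sum_right _ _ _ fun j hj =>
      hfar j (Finset.mem_range.1 hj) (by omega) (by omega)
  · obtain ⟨h1, h2⟩ := h1
    obtain ⟨m, rfl⟩ : ∃ m, i = x.sum + m := ⟨i - x.sum, by omega⟩
    -- The sum is cut into the part before the exchanged pair, the pair, and the part after it.
    obtain ⟨n, rfl⟩ : ∃ n, k = m + (2 + n) := ⟨k - m - 2, by omega⟩
    rw [dotSum_add, dotSum_add]
    refine Commute.add_right ?_ (Commute.add_right ?_ ?_)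
    · exact Commute.sum_right _ _ _ fun j hj => by
        rw [Finset.mem_range] at hj
        exact hfar j (by omega) (by omega) (by omega)
    · have h3 := H.c_s (x.sum + m) (by omega)
      have h4 := H.c_succ_s (x.sum + m) (by omega)
      simp only [dotSum, Finset.sum_range_succ, Finset.sum_range_zero, zero_add, add_zero]
      rw [Commute, SemiconjBy, mul_add, add_mul, h3, h4, add_comm]
    · exact Commute.sum_right _ _ _ fun j hj => by
        rw [Finset.mem_range] at hj
        rw [add_assoc, add_assoc]
        exact hfar (m + (2 + j)) (by omega) (by omega) (by omega)
  · have := lt_of_mem_youngIdx h1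
    exact Commute.sum_right _ _ _ fun j hj => by
      rw [Finset.mem_range] at hj
      exact hfar j hj (by omega) (by omega)

/-- Between symmetrizers all odd generators of a block become equal, so a dot on a thick strand may
be replaced by `k` times a dot at any chosen position. -/
theorem SergeevFamily.mul_dotSum_mul {x y : List ℕ} {k : ℕ} (h : (x ++ k :: y).sum ≤ r) (j : ℕ)
    (hj : j < k) :
    dotSum c x.sum k * youngSymm s 0 (x ++ k :: y) =
      (k : ℂ) • (youngSymm s 0 (x ++ k :: y) * c (x.sum + j) * youngSymm s 0 (x ++ k :: y)) := by
  have h1 : ∀ i < k, youngSymm s 0 (x ++ k :: y) * c (x.sum + i) * youngSymm s 0 (x ++ k :: y) =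
      youngSymm s 0 (x ++ k :: y) * c x.sum * youngSymm s 0 (x ++ k :: y) := fun i hi => by
    induction i with
    | zero => rfl
    | succ i ih =>
      rw [← ih (by omega), ← add_assoc, H.mul_c_succ_mul h]
      simp only [mem_youngIdx_append, mem_youngIdx_cons]
      omega
  rw [h1 j hj, ← H.youngSymm_idem h, ← mul_assoc, (H.commute_dotSum h rfl rfl).eq,
    H.youngSymm_idem h, dotSum, Finset.mul_sum, Finset.sum_mul,
    Finset.sum_congr rfl fun i hi => h1 i (Finset.mem_range.1 hi), Finset.sum_const,
    Finset.card_range, Nat.cast_smul_eq_nsmul]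

omit [Algebra ℂ A] in
theorem SergeevFamily.dotSum_anti {p k q l : ℕ} (h : p + k ≤ q) (h' : q + l ≤ r) :
    dotSum c p k * dotSum c q l = -(dotSum c q l * dotSum c p k) := by
  simp only [dotSum, Finset.sum_mul, Finset.mul_sum]
  rw [Finset.sum_comm, ← Finset.sum_neg_distrib]
  refine Finset.sum_congr rfl fun i hi => ?_
  rw [← Finset.sum_neg_distrib]
  refine Finset.sum_congr rfl fun j hj => ?_
  rw [Finset.mem_range] at hi hj
  exact H.c_anti _ (by omega) _ (by omega) (by omega)

theorem SergeevFamily.dotSum_sq {p k : ℕ} (h : p + k ≤ r) :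
    dotSum c p k * dotSum c p k = (k : ℂ) • (1 : A) := by
  induction k with
  | zero => simp
  | succ k ih =>
    have h1 := H.dotSum_anti (p := p) (k := k) (q := p + k) (l := 1) le_rfl (by omega)
    rw [dotSum_add, add_mul, mul_add, mul_add, ih (by omega), h1, dotSum_one,
      H.c_sq _ (by omega)]
    push_cast
    module

end Identities

/-! ### Ladder identities for symmetrizers -/

section Ladders

variable {A : Type} [Ring A] [Algebra ℂ A]
variable {r : ℕ} {s c : ℕ → A} (H : SergeevFamily r s c)

theorem smul_mul_idem_mul_smul {B : A} (hB : B * B = B) (a b : ℂ) (z w : A) :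
    (a • (z * B)) * (b • (B * w)) = a • b • (z * B * w) := by
  rw [smul_mul_smul_comm, mul_assoc z B, ← mul_assoc B B, hB, mul_smul, mul_assoc]

include H

/-- With e the outer symmetrizer and s the transposition across the boundary, the two composites are
(k+1) e + (k+1)(l+1) e s e and (l+1) e + (k+1)(l+1) e s e; the terms with s cancel. -/
theorem SergeevFamily.square_value {x y : List ℕ} {k l : ℕ}
    (h : (x ++ (k + 1) :: (l + 1) :: y).sum ≤ r) :
    (((k : ℂ) + 1) • (youngSymm s 0 (x ++ (k + 1) :: (l + 1) :: y) *
        youngSymm s 0 (x ++ k :: (l + 2) :: y))) *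
      ((((l + 1 : ℕ) : ℂ) + 1) • (youngSymm s 0 (x ++ k :: (l + 2) :: y) *
        youngSymm s 0 (x ++ (k + 1) :: (l + 1) :: y))) -
    (((l : ℂ) + 1) • (youngSymm s 0 (x ++ (k + 1) :: (l + 1) :: y) *
        youngSymm s 0 (x ++ (k + 2) :: l :: y))) *
      ((((k + 1 : ℕ) : ℂ) + 1) • (youngSymm s 0 (x ++ (k + 2) :: l :: y) *
        youngSymm s 0 (x ++ (k + 1) :: (l + 1) :: y))) =
    (((k + 1 : ℕ) : ℂ) - ((l + 1 : ℕ) : ℂ)) • youngSymm s 0 (x ++ (k + 1) :: (l + 1) :: y) := by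
  have hs := h
  simp only [List.sum_append, List.sum_cons] at hs
  have hB : (x ++ k :: (l + 2) :: y).sum ≤ r := by simp; omega
  have hC : (x ++ (k + 2) :: l :: y).sum ≤ r := by simp; omega
  have hA' := H.youngSymm_idem h
  have h1 := H.smul_mid_left (x := x ++ [k]) (y := y) (k := l) (by simpa using hB)
    (H.rightFixed h fun i hi => by grind [mem_youngIdx_append, mem_youngIdx_cons, mem_youngIdx_nil])
    (H.leftFixed h fun i hi => by grind [mem_youngIdx_append, mem_youngIdx_cons, mem_youngIdx_nil])
  have h2 := H.smul_mid_right (x := x) (y := l :: y) (k := k) (by simpa using hC)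
    (H.rightFixed h fun i hi => by grind [mem_youngIdx_append, mem_youngIdx_cons, mem_youngIdx_nil])
    (H.leftFixed h fun i hi => by grind [mem_youngIdx_append, mem_youngIdx_cons, mem_youngIdx_nil])
  rw [hA'] at h1 h2
  simp only [List.append_assoc, List.cons_append, List.nil_append, List.sum_append, List.sum_cons,
    List.sum_nil, add_zero] at h1 h2
  rw [smul_mul_idem_mul_smul (H.youngSymm_idem hB), smul_mul_idem_mul_smul (H.youngSymm_idem hC)]
  push_cast
  linear_combination (norm := module) ((k : ℂ) + 1) • h1 - ((l : ℂ) + 1) • h2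

/-- As without dots, except that the two terms containing the transposition now agree because c_i
s_i = s_i c_{i+1}. -/
theorem SergeevFamily.square_dot_value {x y : List ℕ} {k l : ℕ}
    (h : (x ++ (k + 1) :: (l + 1) :: y).sum ≤ r) :
    (((k : ℂ) + 1) • (youngSymm s 0 (x ++ (k + 1) :: (l + 1) :: y) * c (x.sum + k) *
        youngSymm s 0 (x ++ k :: (l + 2) :: y))) *
      ((((l + 1 : ℕ) : ℂ) + 1) • (youngSymm s 0 (x ++ k :: (l + 2) :: y) *
        youngSymm s 0 (x ++ (k + 1) :: (l + 1) :: y))) -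
    (((l : ℂ) + 1) • (youngSymm s 0 (x ++ (k + 1) :: (l + 1) :: y) *
        youngSymm s 0 (x ++ (k + 2) :: l :: y))) *
      ((((k + 1 : ℕ) : ℂ) + 1) • (youngSymm s 0 (x ++ (k + 2) :: l :: y) * c (x.sum + (k + 1)) *
        youngSymm s 0 (x ++ (k + 1) :: (l + 1) :: y))) =
    dotSum c x.sum (k + 1) * youngSymm s 0 (x ++ (k + 1) :: (l + 1) :: y) -
      dotSum c (x.sum + (k + 1)) (l + 1) * youngSymm s 0 (x ++ (k + 1) :: (l + 1) :: y) := by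
  have hs := h
  simp only [List.sum_append, List.sum_cons] at hs
  have hB : (x ++ k :: (l + 2) :: y).sum ≤ r := by simp; omega
  have hC : (x ++ (k + 2) :: l :: y).sum ≤ r := by simp; omega
  have h1 := H.smul_mid_left (x := x ++ [k]) (y := y) (k := l) (by simpa using hB)
    (H.rightFixed_mul_c (j := x.sum + k)
      (H.rightFixed h fun i hi => by grind [mem_youngIdx_append, mem_youngIdx_cons, mem_youngIdx_nil])
      (x ++ [k]) ((l + 1) :: y) (by simp; omega) (by simp) (by simp))
    (H.leftFixed h fun i hi => by grind [mem_youngIdx_append, mem_youngIdx_cons, mem_youngIdx_nil])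
  have h2 := H.smul_mid_right (x := x) (y := l :: y) (k := k) (by simpa using hC)
    (H.rightFixed h fun i hi => by grind [mem_youngIdx_append, mem_youngIdx_cons, mem_youngIdx_nil])
    (H.leftFixed_c_mul (j := x.sum + (k + 1))
      (H.leftFixed h fun i hi => by grind [mem_youngIdx_append, mem_youngIdx_cons, mem_youngIdx_nil])
      (x ++ [k + 1]) (l :: y) (by simp; omega) (by simp) (by simp))
  -- The dots on the two thick strands are represented at the positions adjacent to their common
  -- boundary, where the dots of the rungs sit: last in the left block, first in the right one.
  have h3 := H.mul_dotSum_mul h k (by omega)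
  have h4 := H.mul_dotSum_mul (x := x ++ [k + 1]) (k := l + 1) (y := y) (by simpa using h) 0
    (by omega)
  have h5 := H.c_s (x.sum + k) (by omega)
  simp only [List.append_assoc, List.cons_append, List.nil_append, List.sum_append, List.sum_cons,
    List.sum_nil, add_zero] at h1 h2 h3 h4
  rw [mul_assoc _ (c (x.sum + k)) (s (x.sum + k)), h5] at h1
  rw [h3, h4, smul_mul_idem_mul_smul (H.youngSymm_idem hB),
    mul_assoc (youngSymm s 0 (x ++ (k + 2) :: l :: y)),
    smul_mul_idem_mul_smul (H.youngSymm_idem hC)]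
  simp only [← mul_assoc, ← add_assoc] at h1 h2 ⊢
  push_cast
  linear_combination (norm := module) ((k : ℂ) + 1) • h1 - ((l : ℂ) + 1) • h2

theorem SergeevFamily.square_dot_value' {x y : List ℕ} {k l : ℕ}
    (h : (x ++ (k + 1) :: (l + 1) :: y).sum ≤ r) :
    (((k : ℂ) + 1) • (youngSymm s 0 (x ++ (k + 1) :: (l + 1) :: y) *
        youngSymm s 0 (x ++ k :: (l + 2) :: y))) *
      ((((l + 1 : ℕ) : ℂ) + 1) • (youngSymm s 0 (x ++ k :: (l + 2) :: y) * c (x.sum + k) *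
        youngSymm s 0 (x ++ (k + 1) :: (l + 1) :: y))) -
    (((l : ℂ) + 1) • (youngSymm s 0 (x ++ (k + 1) :: (l + 1) :: y) * c (x.sum + (k + 1)) *
        youngSymm s 0 (x ++ (k + 2) :: l :: y))) *
      ((((k + 1 : ℕ) : ℂ) + 1) • (youngSymm s 0 (x ++ (k + 2) :: l :: y) *
        youngSymm s 0 (x ++ (k + 1) :: (l + 1) :: y))) =
    dotSum c x.sum (k + 1) * youngSymm s 0 (x ++ (k + 1) :: (l + 1) :: y) -
      dotSum c (x.sum + (k + 1)) (l + 1) * youngSymm s 0 (x ++ (k + 1) :: (l + 1) :: y) := by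
  have hs := h
  simp only [List.sum_append, List.sum_cons] at hs
  have hB : (x ++ k :: (l + 2) :: y).sum ≤ r := by simp; omega
  have hC : (x ++ (k + 2) :: l :: y).sum ≤ r := by simp; omega
  have h1 := H.smul_mid_left (x := x ++ [k]) (y := y) (k := l) (by simpa using hB)
    (H.rightFixed h fun i hi => by grind [mem_youngIdx_append, mem_youngIdx_cons, mem_youngIdx_nil])
    (H.leftFixed_c_mul (j := x.sum + k)
      (H.leftFixed h fun i hi => by grind [mem_youngIdx_append, mem_youngIdx_cons, mem_youngIdx_nil])
      (x ++ [k]) ((l + 1) :: y) (by simp; omega) (by simp) (by simp))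
  have h2 := H.smul_mid_right (x := x) (y := l :: y) (k := k) (by simpa using hC)
    (H.rightFixed_mul_c (j := x.sum + (k + 1))
      (H.rightFixed h fun i hi => by grind [mem_youngIdx_append, mem_youngIdx_cons, mem_youngIdx_nil])
      (x ++ [k + 1]) (l :: y) (by simp; omega) (by simp) (by simp))
    (H.leftFixed h fun i hi => by grind [mem_youngIdx_append, mem_youngIdx_cons, mem_youngIdx_nil])
  have h3 := H.mul_dotSum_mul h k (by omega)
  have h4 := H.mul_dotSum_mul (x := x ++ [k + 1]) (k := l + 1) (y := y) (by simpa using h) 0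
    (by omega)
  have h5 := H.c_succ_s (x.sum + k) (by omega)
  simp only [List.append_assoc, List.cons_append, List.nil_append, List.sum_append, List.sum_cons,
    List.sum_nil, add_zero] at h1 h2 h3 h4
  rw [mul_assoc _ (c (x.sum + (k + 1))) (s (x.sum + k)), ← add_assoc, h5] at h2
  rw [h3, h4, smul_mul_idem_mul_smul (H.youngSymm_idem hC),
    mul_assoc (youngSymm s 0 (x ++ k :: (l + 2) :: y)),
    smul_mul_idem_mul_smul (H.youngSymm_idem hB)]
  simp only [← mul_assoc, ← add_assoc] at h1 h2 ⊢
  push_cast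
  linear_combination (norm := module) ((k : ℂ) + 1) • h1 - ((l : ℂ) + 1) • h2

omit H in
-- Both sides equal `a • (E * T * F)`. Without dots the terms `E * F` cancel. With dots the term
-- containing `T` loses both dots since `ca * T = T * cb` and `ca * ca = 1`, and the remaining terms
-- cancel because the dots anticommute. Here `B` and `G` are the symmetrizers between the two rungs,
-- in either order of the rungs, and `T` is the cycle carrying a strand across the middle block.
theorem double_rung {E F B G T ca cb : A} {a k : ℂ} (hBB : B * B = B) (hGG : G * G = G)
    (hB : ∀ z w, (z = E ∨ z = E * ca) → (w = F ∨ w = cb * F) →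
      (k + 1) • (z * B * w) = k • (z * w) + z * T * w)
    (hG : ∀ z w, (z = E ∨ z = E * cb) → (w = F ∨ w = ca * F) → z * G * w = z * w)
    (hT : ca * T = T * cb) (hca : ca * ca = 1) (hac : ca * cb = -(cb * ca)) :
    (a • (E * B)) * ((k + 1) • (B * F)) - (k • (E * G)) * (a • (G * F)) =
      (a • (E * ca * B)) * ((k + 1) • (B * cb * F)) +
        (k • (E * cb * G)) * (a • (G * ca * F)) := by
  rw [mul_assoc B, mul_assoc G]
  simp only [smul_mul_idem_mul_smul hBB, smul_mul_idem_mul_smul hGG]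
  rw [hB _ _ (Or.inl rfl) (Or.inl rfl), hB _ _ (Or.inr rfl) (Or.inr rfl),
    hG _ _ (Or.inl rfl) (Or.inl rfl), hG _ _ (Or.inr rfl) (Or.inr rfl)]
  have h1 : E * ca * T * (cb * F) = E * T * F := by
    rw [mul_assoc (E * ca), ← mul_assoc T, ← hT, mul_assoc E, ← mul_assoc ca, ← mul_assoc ca, hca,
      one_mul, mul_assoc]
  have h2 : E * ca * (cb * F) = -(E * cb * (ca * F)) := by
    rw [mul_assoc E, ← mul_assoc ca, hac, neg_mul, mul_neg, mul_assoc cb, mul_assoc E]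
  rw [h1, h2]
  module

omit H in
-- The two sides reduce to `a • (E * T * cb * F)` and `a • (E * ca * T * F)`, and `ca * T = T * cb`.
theorem double_rung_dot {E F B G T ca cb : A} {a k : ℂ} (hBB : B * B = B) (hGG : G * G = G)
    (hB : ∀ z w, (z = E ∨ z = E * ca) → (w = F ∨ w = cb * F) →
      (k + 1) • (z * B * w) = k • (z * w) + z * T * w)
    (hG : ∀ z w, (z = E ∨ z = E * cb) → (w = F ∨ w = ca * F) → z * G * w = z * w)
    (hT : ca * T = T * cb) :
    (a • (E * B)) * ((k + 1) • (B * cb * F)) - (k • (E * cb * G)) * (a • (G * F)) =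
      (a • (E * ca * B)) * ((k + 1) • (B * F)) - (k • (E * G)) * (a • (G * ca * F)) := by
  rw [mul_assoc B, mul_assoc G]
  simp only [smul_mul_idem_mul_smul hBB, smul_mul_idem_mul_smul hGG]
  rw [hB _ _ (Or.inl rfl) (Or.inr rfl), hB _ _ (Or.inr rfl) (Or.inl rfl),
    hG _ _ (Or.inr rfl) (Or.inl rfl), hG _ _ (Or.inl rfl) (Or.inr rfl)]
  have h1 : E * ca * T * F = E * T * (cb * F) := by
    rw [mul_assoc E, hT, mul_assoc E, mul_assoc E, mul_assoc T]
  rw [h1, mul_assoc E ca, mul_assoc E cb]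
  module

/-- The strand from the right rung must cross the whole thick middle strand to leave by the left
rung: this produces the cycle. -/
theorem SergeevFamily.rungs_left_mid {x y : List ℕ} {h k l : ℕ}
    (hr : (x ++ h :: (k + 1) :: (l + 1) :: y).sum ≤ r) (z w : A)
    (hz : z = youngSymm s 0 (x ++ (h + 1) :: (k + 1) :: l :: y) ∨
      z = youngSymm s 0 (x ++ (h + 1) :: (k + 1) :: l :: y) * c (x.sum + h))
    (hw : w = youngSymm s 0 (x ++ h :: (k + 1) :: (l + 1) :: y) ∨
      w = c (x.sum + h + (k + 1)) * youngSymm s 0 (x ++ h :: (k + 1) :: (l + 1) :: y)) :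
    (((k + 1 : ℕ) : ℂ) + 1) • (z * youngSymm s 0 (x ++ h :: (k + 2) :: l :: y) * w) =
      ((k + 1 : ℕ) : ℂ) • (z * w) + z * cycleElt (fun i => s (x.sum + h + i)) (k + 1) * w := by
  have hs := hr
  simp only [List.sum_append, List.sum_cons] at hs
  have hE : (x ++ (h + 1) :: (k + 1) :: l :: y).sum ≤ r := by simp; omega
  have hE1 : RightFixed s (x ++ h :: 1 :: (k + 1) :: l :: y)
      (youngSymm s 0 (x ++ (h + 1) :: (k + 1) :: l :: y)) :=
    H.rightFixed hE fun i hi => by grind [mem_youngIdx_append, mem_youngIdx_cons, mem_youngIdx_nil]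
  have hF1 : LeftFixed s (x ++ h :: (k + 1) :: 1 :: l :: y)
      (youngSymm s 0 (x ++ h :: (k + 1) :: (l + 1) :: y)) :=
    H.leftFixed hr fun i hi => by grind [mem_youngIdx_append, mem_youngIdx_cons, mem_youngIdx_nil]
  have hz' : RightFixed s (x ++ h :: 1 :: (k + 1) :: l :: y) z := by
    rcases hz with rfl | rfl
    · exact hE1
    · exact H.rightFixed_mul_c hE1 (x ++ [h]) ((k + 1) :: l :: y) (by simp; omega) (by simp)
        (by simp)
  have hw' : LeftFixed s (x ++ h :: (k + 1) :: 1 :: l :: y) w := by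
    rcases hw with rfl | rfl
    · exact hF1
    · exact H.leftFixed_c_mul hF1 (x ++ [h, k + 1]) (l :: y) (by simp; omega)
        (by simp; omega) (by simp)
  have h1 := H.smul_cycle_right (x := x ++ [h]) (y := l :: y) (k := k + 1) (z := z) (w := w)
    (by simp; omega) (by simpa using hz') (by simpa using hw')
  simpa using h1

/-- In the other order the rungs use disjoint strands, and the symmetrizer between them is absorbed
on both sides. -/
theorem SergeevFamily.rungs_left_erase {x y : List ℕ} {h k l : ℕ}
    (hr : (x ++ h :: (k + 1) :: (l + 1) :: y).sum ≤ r) (z w : A)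
    (hz : z = youngSymm s 0 (x ++ (h + 1) :: (k + 1) :: l :: y) ∨
      z = youngSymm s 0 (x ++ (h + 1) :: (k + 1) :: l :: y) * c (x.sum + h + (k + 1)))
    (hw : w = youngSymm s 0 (x ++ h :: (k + 1) :: (l + 1) :: y) ∨
      w = c (x.sum + h) * youngSymm s 0 (x ++ h :: (k + 1) :: (l + 1) :: y)) :
    z * youngSymm s 0 (x ++ (h + 1) :: k :: (l + 1) :: y) * w = z * w := by
  have hs := hr
  simp only [List.sum_append, List.sum_cons] at hs
  have hE : (x ++ (h + 1) :: (k + 1) :: l :: y).sum ≤ r := by simp; omega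
  have hE1 : RightFixed s (x ++ (h + 1) :: k :: 1 :: l :: y)
      (youngSymm s 0 (x ++ (h + 1) :: (k + 1) :: l :: y)) :=
    H.rightFixed hE fun i hi => by grind [mem_youngIdx_append, mem_youngIdx_cons, mem_youngIdx_nil]
  have hF1 : LeftFixed s (x ++ h :: 1 :: k :: (l + 1) :: y)
      (youngSymm s 0 (x ++ h :: (k + 1) :: (l + 1) :: y)) :=
    H.leftFixed hr fun i hi => by grind [mem_youngIdx_append, mem_youngIdx_cons, mem_youngIdx_nil]
  have hz' : RightFixed s (x ++ (h + 1) :: k :: 1 :: l :: y) z := by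
    rcases hz with rfl | rfl
    · exact hE1
    · exact H.rightFixed_mul_c hE1 (x ++ [h + 1, k]) (l :: y) (by simp; omega)
        (by simp; omega) (by simp)
  have hw' : LeftFixed s (x ++ h :: 1 :: k :: (l + 1) :: y) w := by
    rcases hw with rfl | rfl
    · exact hF1
    · exact H.leftFixed_c_mul hF1 (x ++ [h]) (k :: (l + 1) :: y) (by simp; omega)
        (by simp) (by simp)
  have h1 := H.mul_youngSymm_append_mul (u := x ++ [h + 1, k]) (v := (l + 1) :: y) (z := z)
    (w := w) (by simp; omega) (fun i hi => hz' i (by grind [mem_youngIdx_append, mem_youngIdx_cons, mem_youngIdx_nil]))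
    (fun i hi => hw' i (by
      simp only [List.sum_append, List.sum_cons, List.sum_nil] at hi
      grind [mem_youngIdx_append, mem_youngIdx_cons, mem_youngIdx_nil]))
  simpa using h1

theorem SergeevFamily.rungs_right_mid {x y : List ℕ} {h k l : ℕ}
    (hr : (x ++ (h + 1) :: (k + 1) :: l :: y).sum ≤ r) (z w : A)
    (hz : z = youngSymm s 0 (x ++ h :: (k + 1) :: (l + 1) :: y) ∨
      z = youngSymm s 0 (x ++ h :: (k + 1) :: (l + 1) :: y) * c (x.sum + h + (k + 1)))
    (hw : w = youngSymm s 0 (x ++ (h + 1) :: (k + 1) :: l :: y) ∨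
      w = c (x.sum + h) * youngSymm s 0 (x ++ (h + 1) :: (k + 1) :: l :: y)) :
    (((k + 1 : ℕ) : ℂ) + 1) • (z * youngSymm s 0 (x ++ h :: (k + 2) :: l :: y) * w) =
      ((k + 1 : ℕ) : ℂ) • (z * w) +
        z * cycleElt (fun i => s (x.sum + h + (k + 1 - 1 - i))) (k + 1) * w := by
  have hs := hr
  simp only [List.sum_append, List.sum_cons] at hs
  have hE : (x ++ h :: (k + 1) :: (l + 1) :: y).sum ≤ r := by simp; omega
  have hE1 : RightFixed s (x ++ h :: (k + 1) :: 1 :: l :: y)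
      (youngSymm s 0 (x ++ h :: (k + 1) :: (l + 1) :: y)) :=
    H.rightFixed hE fun i hi => by grind [mem_youngIdx_append, mem_youngIdx_cons, mem_youngIdx_nil]
  have hF1 : LeftFixed s (x ++ h :: 1 :: (k + 1) :: l :: y)
      (youngSymm s 0 (x ++ (h + 1) :: (k + 1) :: l :: y)) :=
    H.leftFixed hr fun i hi => by grind [mem_youngIdx_append, mem_youngIdx_cons, mem_youngIdx_nil]
  have hz' : RightFixed s (x ++ h :: (k + 1) :: 1 :: l :: y) z := by
    rcases hz with rfl | rfl
    · exact hE1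
    · exact H.rightFixed_mul_c hE1 (x ++ [h, k + 1]) (l :: y) (by simp; omega) (by simp; omega)
        (by simp)
  have hw' : LeftFixed s (x ++ h :: 1 :: (k + 1) :: l :: y) w := by
    rcases hw with rfl | rfl
    · exact hF1
    · exact H.leftFixed_c_mul hF1 (x ++ [h]) ((k + 1) :: l :: y) (by simp; omega)
        (by simp) (by simp)
  have h1 := H.smul_cycle_left (x := x ++ [h]) (y := l :: y) (k := k + 1) (z := z) (w := w)
    (by simp; omega) (by simpa using hz') (by simpa using hw')
  simpa using h1

theorem SergeevFamily.rungs_right_erase {x y : List ℕ} {h k l : ℕ}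
    (hr : (x ++ (h + 1) :: (k + 1) :: l :: y).sum ≤ r) (z w : A)
    (hz : z = youngSymm s 0 (x ++ h :: (k + 1) :: (l + 1) :: y) ∨
      z = youngSymm s 0 (x ++ h :: (k + 1) :: (l + 1) :: y) * c (x.sum + h))
    (hw : w = youngSymm s 0 (x ++ (h + 1) :: (k + 1) :: l :: y) ∨
      w = c (x.sum + h + (k + 1)) * youngSymm s 0 (x ++ (h + 1) :: (k + 1) :: l :: y)) :
    z * youngSymm s 0 (x ++ (h + 1) :: k :: (l + 1) :: y) * w = z * w := by
  have hs := hr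
  simp only [List.sum_append, List.sum_cons] at hs
  have hE : (x ++ h :: (k + 1) :: (l + 1) :: y).sum ≤ r := by simp; omega
  have hE1 : RightFixed s (x ++ h :: 1 :: k :: (l + 1) :: y)
      (youngSymm s 0 (x ++ h :: (k + 1) :: (l + 1) :: y)) :=
    H.rightFixed hE fun i hi => by grind [mem_youngIdx_append, mem_youngIdx_cons, mem_youngIdx_nil]
  have hF1 : LeftFixed s (x ++ (h + 1) :: k :: 1 :: l :: y)
      (youngSymm s 0 (x ++ (h + 1) :: (k + 1) :: l :: y)) :=
    H.leftFixed hr fun i hi => by grind [mem_youngIdx_append, mem_youngIdx_cons, mem_youngIdx_nil]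
  have hz' : RightFixed s (x ++ h :: 1 :: k :: (l + 1) :: y) z := by
    rcases hz with rfl | rfl
    · exact hE1
    · exact H.rightFixed_mul_c hE1 (x ++ [h]) (k :: (l + 1) :: y) (by simp; omega)
        (by simp) (by simp)
  have hw' : LeftFixed s (x ++ (h + 1) :: k :: 1 :: l :: y) w := by
    rcases hw with rfl | rfl
    · exact hF1
    · exact H.leftFixed_c_mul hF1 (x ++ [h + 1, k]) (l :: y) (by simp; omega)
        (by simp; omega) (by simp)
  have h1 := H.mul_youngSymm_append_mul' (u := x ++ [h + 1]) (v := k :: (l + 1) :: y) (z := z)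
    (w := w) (by simp; omega) (fun i hi => hz' i (by
      simp only [List.sum_append, List.sum_cons, List.sum_nil] at hi
      grind [mem_youngIdx_append, mem_youngIdx_cons, mem_youngIdx_nil]))
    (fun i hi => hw' i (by grind [mem_youngIdx_append, mem_youngIdx_cons, mem_youngIdx_nil]))
  simpa using h1

theorem SergeevFamily.rungs_left_value {x y : List ℕ} {h k l : ℕ}
    (hr : (x ++ h :: (k + 1) :: (l + 1) :: y).sum ≤ r) :
    (((h : ℂ) + 1) • (youngSymm s 0 (x ++ (h + 1) :: (k + 1) :: l :: y) *
        youngSymm s 0 (x ++ h :: (k + 2) :: l :: y))) *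
      ((((k + 1 : ℕ) : ℂ) + 1) • (youngSymm s 0 (x ++ h :: (k + 2) :: l :: y) *
        youngSymm s 0 (x ++ h :: (k + 1) :: (l + 1) :: y))) -
    (((k : ℂ) + 1) • (youngSymm s 0 (x ++ (h + 1) :: (k + 1) :: l :: y) *
        youngSymm s 0 (x ++ (h + 1) :: k :: (l + 1) :: y))) *
      (((h : ℂ) + 1) • (youngSymm s 0 (x ++ (h + 1) :: k :: (l + 1) :: y) *
        youngSymm s 0 (x ++ h :: (k + 1) :: (l + 1) :: y))) =
    (((h : ℂ) + 1) • (youngSymm s 0 (x ++ (h + 1) :: (k + 1) :: l :: y) * c (x.sum + h) *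
        youngSymm s 0 (x ++ h :: (k + 2) :: l :: y))) *
      ((((k + 1 : ℕ) : ℂ) + 1) • (youngSymm s 0 (x ++ h :: (k + 2) :: l :: y) *
        c (x.sum + h + (k + 1)) * youngSymm s 0 (x ++ h :: (k + 1) :: (l + 1) :: y))) +
    (((k : ℂ) + 1) • (youngSymm s 0 (x ++ (h + 1) :: (k + 1) :: l :: y) *
        c (x.sum + h + (k + 1)) * youngSymm s 0 (x ++ (h + 1) :: k :: (l + 1) :: y))) *
      (((h : ℂ) + 1) • (youngSymm s 0 (x ++ (h + 1) :: k :: (l + 1) :: y) * c (x.sum + h) *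
        youngSymm s 0 (x ++ h :: (k + 1) :: (l + 1) :: y))) := by
  have hs := hr
  simp only [List.sum_append, List.sum_cons] at hs
  -- The middle label is `k + 1`, and this number is the scalar called `k` in `double_rung`.
  have hk : ((k : ℂ) + 1) = ((k + 1 : ℕ) : ℂ) := by push_cast; rfl
  rw [hk]
  exact double_rung (H.youngSymm_idem (by simp; omega)) (H.youngSymm_idem (by simp; omega))
    (H.rungs_left_mid hr) (H.rungs_left_erase hr) (H.c_mul_cycle_right (by omega))
    (H.c_sq _ (by omega)) (H.c_anti _ (by omega) _ (by omega) (by omega))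

theorem SergeevFamily.rungs_left_dot_value {x y : List ℕ} {h k l : ℕ}
    (hr : (x ++ h :: (k + 1) :: (l + 1) :: y).sum ≤ r) :
    (((h : ℂ) + 1) • (youngSymm s 0 (x ++ (h + 1) :: (k + 1) :: l :: y) *
        youngSymm s 0 (x ++ h :: (k + 2) :: l :: y))) *
      ((((k + 1 : ℕ) : ℂ) + 1) • (youngSymm s 0 (x ++ h :: (k + 2) :: l :: y) *
        c (x.sum + h + (k + 1)) * youngSymm s 0 (x ++ h :: (k + 1) :: (l + 1) :: y))) -
    (((k : ℂ) + 1) • (youngSymm s 0 (x ++ (h + 1) :: (k + 1) :: l :: y) *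
        c (x.sum + h + (k + 1)) * youngSymm s 0 (x ++ (h + 1) :: k :: (l + 1) :: y))) *
      (((h : ℂ) + 1) • (youngSymm s 0 (x ++ (h + 1) :: k :: (l + 1) :: y) *
        youngSymm s 0 (x ++ h :: (k + 1) :: (l + 1) :: y))) =
    (((h : ℂ) + 1) • (youngSymm s 0 (x ++ (h + 1) :: (k + 1) :: l :: y) * c (x.sum + h) *
        youngSymm s 0 (x ++ h :: (k + 2) :: l :: y))) *
      ((((k + 1 : ℕ) : ℂ) + 1) • (youngSymm s 0 (x ++ h :: (k + 2) :: l :: y) *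
        youngSymm s 0 (x ++ h :: (k + 1) :: (l + 1) :: y))) -
    (((k : ℂ) + 1) • (youngSymm s 0 (x ++ (h + 1) :: (k + 1) :: l :: y) *
        youngSymm s 0 (x ++ (h + 1) :: k :: (l + 1) :: y))) *
      (((h : ℂ) + 1) • (youngSymm s 0 (x ++ (h + 1) :: k :: (l + 1) :: y) * c (x.sum + h) *
        youngSymm s 0 (x ++ h :: (k + 1) :: (l + 1) :: y))) := by
  have hs := hr
  simp only [List.sum_append, List.sum_cons] at hs
  have hk : ((k : ℂ) + 1) = ((k + 1 : ℕ) : ℂ) := by push_cast; rfl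
  rw [hk]
  exact double_rung_dot (H.youngSymm_idem (by simp; omega)) (H.youngSymm_idem (by simp; omega))
    (H.rungs_left_mid hr) (H.rungs_left_erase hr) (H.c_mul_cycle_right (by omega))

theorem SergeevFamily.rungs_right_value {x y : List ℕ} {h k l : ℕ}
    (hr : (x ++ (h + 1) :: (k + 1) :: l :: y).sum ≤ r) :
    (((l : ℂ) + 1) • (youngSymm s 0 (x ++ h :: (k + 1) :: (l + 1) :: y) *
        youngSymm s 0 (x ++ h :: (k + 2) :: l :: y))) *
      ((((k + 1 : ℕ) : ℂ) + 1) • (youngSymm s 0 (x ++ h :: (k + 2) :: l :: y) *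
        youngSymm s 0 (x ++ (h + 1) :: (k + 1) :: l :: y))) -
    (((k : ℂ) + 1) • (youngSymm s 0 (x ++ h :: (k + 1) :: (l + 1) :: y) *
        youngSymm s 0 (x ++ (h + 1) :: k :: (l + 1) :: y))) *
      (((l : ℂ) + 1) • (youngSymm s 0 (x ++ (h + 1) :: k :: (l + 1) :: y) *
        youngSymm s 0 (x ++ (h + 1) :: (k + 1) :: l :: y))) =
    (((l : ℂ) + 1) • (youngSymm s 0 (x ++ h :: (k + 1) :: (l + 1) :: y) *
        c (x.sum + h + (k + 1)) * youngSymm s 0 (x ++ h :: (k + 2) :: l :: y))) *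
      ((((k + 1 : ℕ) : ℂ) + 1) • (youngSymm s 0 (x ++ h :: (k + 2) :: l :: y) *
        c (x.sum + h) * youngSymm s 0 (x ++ (h + 1) :: (k + 1) :: l :: y))) +
    (((k : ℂ) + 1) • (youngSymm s 0 (x ++ h :: (k + 1) :: (l + 1) :: y) *
        c (x.sum + h) * youngSymm s 0 (x ++ (h + 1) :: k :: (l + 1) :: y))) *
      (((l : ℂ) + 1) • (youngSymm s 0 (x ++ (h + 1) :: k :: (l + 1) :: y) *
        c (x.sum + h + (k + 1)) * youngSymm s 0 (x ++ (h + 1) :: (k + 1) :: l :: y))) := by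
  have hs := hr
  simp only [List.sum_append, List.sum_cons] at hs
  have hk : ((k : ℂ) + 1) = ((k + 1 : ℕ) : ℂ) := by push_cast; rfl
  rw [hk]
  exact double_rung (H.youngSymm_idem (by simp; omega)) (H.youngSymm_idem (by simp; omega))
    (H.rungs_right_mid hr) (H.rungs_right_erase hr) (H.c_mul_cycle_left (by omega))
    (H.c_sq _ (by omega)) (H.c_anti _ (by omega) _ (by omega) (by omega))

theorem SergeevFamily.rungs_right_dot_value {x y : List ℕ} {h k l : ℕ}
    (hr : (x ++ (h + 1) :: (k + 1) :: l :: y).sum ≤ r) :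
    (((l : ℂ) + 1) • (youngSymm s 0 (x ++ h :: (k + 1) :: (l + 1) :: y) *
        youngSymm s 0 (x ++ h :: (k + 2) :: l :: y))) *
      ((((k + 1 : ℕ) : ℂ) + 1) • (youngSymm s 0 (x ++ h :: (k + 2) :: l :: y) *
        c (x.sum + h) * youngSymm s 0 (x ++ (h + 1) :: (k + 1) :: l :: y))) -
    (((k : ℂ) + 1) • (youngSymm s 0 (x ++ h :: (k + 1) :: (l + 1) :: y) *
        c (x.sum + h) * youngSymm s 0 (x ++ (h + 1) :: k :: (l + 1) :: y))) *
      (((l : ℂ) + 1) • (youngSymm s 0 (x ++ (h + 1) :: k :: (l + 1) :: y) *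
        youngSymm s 0 (x ++ (h + 1) :: (k + 1) :: l :: y))) =
    (((l : ℂ) + 1) • (youngSymm s 0 (x ++ h :: (k + 1) :: (l + 1) :: y) *
        c (x.sum + h + (k + 1)) * youngSymm s 0 (x ++ h :: (k + 2) :: l :: y))) *
      ((((k + 1 : ℕ) : ℂ) + 1) • (youngSymm s 0 (x ++ h :: (k + 2) :: l :: y) *
        youngSymm s 0 (x ++ (h + 1) :: (k + 1) :: l :: y))) -
    (((k : ℂ) + 1) • (youngSymm s 0 (x ++ h :: (k + 1) :: (l + 1) :: y) *
        youngSymm s 0 (x ++ (h + 1) :: k :: (l + 1) :: y))) *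
      (((l : ℂ) + 1) • (youngSymm s 0 (x ++ (h + 1) :: k :: (l + 1) :: y) *
        c (x.sum + h + (k + 1)) * youngSymm s 0 (x ++ (h + 1) :: (k + 1) :: l :: y))) := by
  have hs := hr
  simp only [List.sum_append, List.sum_cons] at hs
  have hk : ((k : ℂ) + 1) = ((k + 1 : ℕ) : ℂ) := by push_cast; rfl
  rw [hk]
  exact double_rung_dot (H.youngSymm_idem (by simp; omega)) (H.youngSymm_idem (by simp; omega))
    (H.rungs_right_mid hr) (H.rungs_right_erase hr) (H.c_mul_cycle_left (by omega))

end Ladders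

/-! ### The representation of webs by block symmetrizers -/

theorem isObj_erase {r : ℕ} {a : List ℕ} : IsObj r (erase a) ↔ a.sum = r := by
  have h : (erase a).sum = a.sum := by
    induction a with
    | nil => rfl
    | cons k a ih =>
      rcases Nat.eq_zero_or_pos k with rfl | hk
      · simpa [erase] using ih
      · simp only [erase] at ih
        simp [erase, hk, ih]
  rw [IsObj, h]
  simp [erase]

theorem erase_append (a b : List ℕ) : erase (a ++ b) = erase a ++ erase b := List.filter_append ..

theorem erase_eq_self {r : ℕ} {a : List ℕ} (h : IsObj r a) : erase a = a :=
  List.filter_eq_self.2 fun k hk => by simpa using h.1 k hk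

section Representation

variable {A : Type} [Ring A] [Algebra ℂ A]

/-- The operator on `A`-valued functions of sequences which is the matrix unit of `b` and `a` with
coefficient `h`. -/
def matUnit (b a : List ℕ) : A →ₗ[ℂ] Module.End ℂ (List ℕ → A) where
  toFun h := LinearMap.single ℂ (fun _ => A) b ∘ₗ LinearMap.mulLeft ℂ h ∘ₗ LinearMap.proj a
  map_add' h h' := by
    ext f c
    simp [add_mul, Pi.single_add]
  map_smul' z h := by
    ext f c
    simp [Pi.single_smul]

theorem matUnit_apply (b a : List ℕ) (h : A) (f : List ℕ → A) :
    matUnit b a h f = Pi.single b (h * f a) := rfl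

theorem matUnit_mul (b a c : List ℕ) (h h' : A) :
    matUnit b a h * matUnit a c h' = matUnit b c (h * h') := by
  refine LinearMap.ext fun f => ?_
  simp [matUnit_apply, mul_assoc]

theorem matUnit_mul_of_ne {b a a' c : List ℕ} (hne : a ≠ a') (h h' : A) :
    matUnit b a h * matUnit a' c h' = 0 := by
  refine LinearMap.ext fun f => ?_
  simp [matUnit_apply, hne]

open Classical in
/-- The projection on the functions whose value at `a` is fixed by the block symmetrizer of `a`. -/
def youngProj (r : ℕ) (s : ℕ → A) : Module.End ℂ (List ℕ → A) :=
  LinearMap.pi fun a =>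
    if IsObj r a then LinearMap.mulLeft ℂ (youngSymm s 0 a) ∘ₗ LinearMap.proj a else 0

open Classical in
theorem youngProj_apply (r : ℕ) (s : ℕ → A) (f : List ℕ → A) (a : List ℕ) :
    youngProj r s f a = if IsObj r a then youngSymm s 0 a * f a else 0 := by
  rw [youngProj, LinearMap.pi_apply]
  split_ifs <;> rfl

theorem youngProj_mul {r : ℕ} {s : ℕ → A} {b : List ℕ} (hb : IsObj r b) (a : List ℕ) (h : A) :
    youngProj r s * matUnit b a h = matUnit b a (youngSymm s 0 b * h) := by
  refine LinearMap.ext fun f => funext fun d => ?_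
  rw [Module.End.mul_apply, youngProj_apply, matUnit_apply, matUnit_apply]
  by_cases hd : d = b
  · subst hd
    simp [hb, mul_assoc]
  · simp [hd]

theorem mul_youngProj {r : ℕ} {s : ℕ → A} {a : List ℕ} (ha : IsObj r a) (b : List ℕ) (h : A) :
    matUnit b a h * youngProj r s = matUnit b a (h * youngSymm s 0 a) := by
  refine LinearMap.ext fun f => ?_
  rw [Module.End.mul_apply, matUnit_apply, matUnit_apply, youngProj_apply, if_pos ha, mul_assoc]

/-- The coefficient of an elementary web starting at position `p`. -/
def Piece.coeff (c : ℕ → A) (p : ℕ) : Piece → A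
  | .merge k l => ((k + l).choose l : ℂ) • 1
  | .split _ _ => 1
  | .dot k => dotSum c p k

/-- The coefficient of a generating web. -/
def WebGen.coeff {r : ℕ} (c : ℕ → A) : WebGen r → A
  | .ident _ _ => 1
  | .layer x p _ _ _ => p.coeff c x.sum

variable {r : ℕ} {s c : ℕ → A}

/-- The entry of the matrix of a generating web. -/
def WebGen.entry (s c : ℕ → A) (g : WebGen r) : A :=
  youngSymm s 0 g.top * g.coeff c * youngSymm s 0 g.bot

variable (H : SergeevFamily r s c)

include H

/-- The unit of W is the sum of the identity webs, which acts as this projection and not as the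
identity operator. Hence the representation takes values in a corner of the endomorphism algebra. -/
theorem SergeevFamily.youngProj_idem : IsIdempotentElem (youngProj r s) := by
  refine LinearMap.ext fun f => funext fun a => ?_
  rw [Module.End.mul_apply, youngProj_apply, youngProj_apply]
  split_ifs with h
  · rw [← mul_assoc, H.youngSymm_idem h.2.le]
  · rfl

theorem SergeevFamily.top_mul_entry (g : WebGen r) :
    youngSymm s 0 g.top * g.entry s c = g.entry s c := by
  rw [WebGen.entry, ← mul_assoc, ← mul_assoc, H.youngSymm_idem g.top_isObj.2.le]

theorem SergeevFamily.entry_mul_bot (g : WebGen r) :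
    g.entry s c * youngSymm s 0 g.bot = g.entry s c := by
  rw [WebGen.entry, mul_assoc, H.youngSymm_idem g.bot_isObj.2.le]

/-- The operator of a generating web. -/
def SergeevFamily.genOp (g : WebGen r) : H.youngProj_idem.Corner :=
  ⟨matUnit g.top g.bot (g.entry s c), (Subsemigroup.mem_corner_iff H.youngProj_idem).2
    ⟨by rw [youngProj_mul g.top_isObj, H.top_mul_entry],
      by rw [mul_youngProj g.bot_isObj, H.entry_mul_bot]⟩⟩

/-- The operator of a formal combination of webs. -/
def SergeevFamily.freeOp : FreeWeb r →ₐ[ℂ] H.youngProj_idem.Corner :=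
  FreeAlgebra.lift ℂ H.genOp

/-- The operator of a formal combination of webs, as an endomorphism. -/
def SergeevFamily.rep (w : FreeWeb r) : Module.End ℂ (List ℕ → A) := (H.freeOp w).1

theorem SergeevFamily.rep_mul (v w : FreeWeb r) : H.rep (v * w) = H.rep v * H.rep w :=
  congrArg Subtype.val (map_mul H.freeOp v w)

theorem SergeevFamily.rep_add (v w : FreeWeb r) : H.rep (v + w) = H.rep v + H.rep w :=
  congrArg Subtype.val (map_add H.freeOp v w)

theorem SergeevFamily.rep_sub (v w : FreeWeb r) : H.rep (v - w) = H.rep v - H.rep w :=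
  congrArg Subtype.val (map_sub H.freeOp v w)

theorem SergeevFamily.rep_smul (z : ℂ) (w : FreeWeb r) : H.rep (z • w) = z • H.rep w :=
  congrArg Subtype.val (map_smul H.freeOp z w)

theorem SergeevFamily.rep_zero : H.rep 0 = 0 :=
  congrArg Subtype.val (map_zero H.freeOp)

theorem SergeevFamily.rep_one : H.rep 1 = youngProj r s :=
  congrArg Subtype.val (map_one H.freeOp)

theorem SergeevFamily.rep_sum {ι : Type} (t : Finset ι) (w : ι → FreeWeb r) :
    H.rep (∑ i ∈ t, w i) = ∑ i ∈ t, H.rep (w i) := by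
  classical
  induction t using Finset.induction_on with
  | empty => simpa using H.rep_zero
  | insert i t hi ih => rw [Finset.sum_insert hi, Finset.sum_insert hi, H.rep_add, ih]

theorem SergeevFamily.rep_ι (g : WebGen r) :
    H.rep (FreeAlgebra.ι ℂ g) = matUnit g.top g.bot (g.entry s c) := by
  rw [SergeevFamily.rep, SergeevFamily.freeOp, FreeAlgebra.lift_ι_apply]
  rfl

omit H in
/-- The matrix unit of sequences with `0` entries erased; zero unless the total thickness is
`r`. -/
def webUnit (r : ℕ) (b a : List ℕ) (h : A) : Module.End ℂ (List ℕ → A) :=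
  if a.sum = r then matUnit (erase b) (erase a) h else 0

omit H in
-- The hypothesis on sums makes all three sequences have total `r` or none of them, so both sides
-- vanish simultaneously.
theorem webUnit_mul {b a a' d : List ℕ} (h h' : A) (ha : a = a') (hd : a.sum = d.sum) :
    webUnit r b a h * webUnit r a' d h' = webUnit r b d (h * h') := by
  subst ha
  unfold webUnit
  by_cases hr : a.sum = r
  · rw [if_pos hr, if_pos (hd ▸ hr), if_pos (hd ▸ hr), matUnit_mul]
  · have hd' : d.sum ≠ r := hd ▸ hr
    rw [if_neg hr, if_neg hd', if_neg hd', zero_mul]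

omit H in
theorem webUnit_add (b a : List ℕ) (h h' : A) :
    webUnit r b a (h + h') = webUnit r b a h + webUnit r b a h' := by
  unfold webUnit
  split_ifs <;> simp

omit H in
theorem webUnit_sub (b a : List ℕ) (h h' : A) :
    webUnit r b a (h - h') = webUnit r b a h - webUnit r b a h' := by
  unfold webUnit
  split_ifs <;> simp

omit H in
theorem webUnit_smul (z : ℂ) (b a : List ℕ) (h : A) :
    webUnit r b a (z • h) = z • webUnit r b a h := by
  unfold webUnit
  split_ifs <;> simp

omit H in
theorem webUnit_congr {b a : List ℕ} {h h' : A} (hh : a.sum = r → h = h') :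
    webUnit r b a h = webUnit r b a h' := by
  unfold webUnit
  split_ifs with hr
  · rw [hh hr]
  · rfl

theorem SergeevFamily.rep_ident (a : List ℕ) :
    H.rep (ident r a) = webUnit r a a (youngSymm s 0 a) := by
  unfold ident webUnit
  split_ifs with h1 h2 h2
  · rw [H.rep_ι]
    simp only [WebGen.top, WebGen.bot, WebGen.entry, WebGen.coeff, mul_one, youngSymm_erase]
    rw [H.youngSymm_idem h2.le]
  · exact (h2 (isObj_erase.1 h1)).elim
  · exact (h1 (isObj_erase.2 h2)).elim
  · exact H.rep_zero

/-- The labels of an elementary web are positive. -/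
def Piece.Pos (p : Piece) : Prop := ∀ k ∈ p.bot ++ p.top, 0 < k

omit H in
theorem Piece.sum_top (p : Piece) : p.top.sum = p.bot.sum := by
  cases p <;> simp [Piece.top, Piece.bot]

omit H in
theorem layer_isObj_iff {x y : List ℕ} {p : Piece} :
    (IsObj r (erase x ++ p.bot ++ erase y) ∧ IsObj r (erase x ++ p.top ++ erase y)) ↔
      p.Pos ∧ (x ++ p.bot ++ y).sum = r := by
  have h0 : ∀ a : List ℕ, (∀ k ∈ erase a, 0 < k) ∧ (erase a).sum = a.sum :=
    fun a => isObj_erase.2 rfl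
  have h3 := p.sum_top
  simp only [IsObj, List.sum_append, (h0 x).2, (h0 y).2, Piece.Pos, h3]
  constructor
  · rintro ⟨⟨h1, h2⟩, h4, -⟩
    refine ⟨fun k hk => ?_, h2⟩
    rcases List.mem_append.1 hk with hk | hk
    · exact h1 k (by simp [hk])
    · exact h4 k (by simp [hk])
  · rintro ⟨h1, h2⟩
    refine ⟨⟨fun k hk => ?_, h2⟩, fun k hk => ?_, h2⟩ <;>
    · rcases List.mem_append.1 hk with hk | hk
      · rcases List.mem_append.1 hk with hk | hk
        · exact (h0 x).1 k hk
        · exact h1 k (by simp [hk])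
      · exact (h0 y).1 k hk

omit H in
theorem Piece.Pos.erase_bot {p : Piece} (hp : p.Pos) : erase p.bot = p.bot :=
  erase_eq_self (r := p.bot.sum) ⟨fun k hk => hp k (by simp [hk]), rfl⟩

omit H in
theorem Piece.Pos.erase_top {p : Piece} (hp : p.Pos) : erase p.top = p.top :=
  erase_eq_self (r := p.top.sum) ⟨fun k hk => hp k (by simp [hk]), rfl⟩

theorem SergeevFamily.rep_layer {p : Piece} (hp : p.Pos) (x y : List ℕ) :
    H.rep (layer r x p y) = webUnit r (x ++ p.top ++ y) (x ++ p.bot ++ y)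
      (youngSymm s 0 (x ++ p.top ++ y) * p.coeff c x.sum * youngSymm s 0 (x ++ p.bot ++ y)) := by
  unfold layer webUnit
  have h0 : (erase x).sum = x.sum := (isObj_erase.2 rfl).2
  have hb : erase x ++ p.bot ++ erase y = erase (x ++ p.bot ++ y) := by
    rw [erase_append, erase_append, hp.erase_bot]
  have ht : erase x ++ p.top ++ erase y = erase (x ++ p.top ++ y) := by
    rw [erase_append, erase_append, hp.erase_top]
  split_ifs with h1 h2 h2
  · rw [H.rep_ι]
    simp only [WebGen.top, WebGen.bot, WebGen.entry, WebGen.coeff, hb, ht, youngSymm_erase, h0]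
  · exact (h2 (layer_isObj_iff.1 h1).2).elim
  · exact (h1 (layer_isObj_iff.2 ⟨hp, h2⟩)).elim
  · exact H.rep_zero

omit H in
theorem layer_of_not_pos {p : Piece} (hp : ¬ p.Pos) (x y : List ℕ) : layer r x p y = 0 :=
  dif_neg fun h => hp (layer_isObj_iff.1 h).1

/-- The bottom symmetrizer belongs to a smaller Young subgroup and is absorbed. With a label `0` the
merge is an identity and the binomial coefficient is `1`, so no case distinction survives in the
statement. -/
theorem SergeevFamily.rep_merge (x : List ℕ) (k l : ℕ) (y : List ℕ) :
    H.rep (merge r x k l y) = webUnit r (x ++ (k + l) :: y) (x ++ k :: l :: y)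
      (((k + l).choose l : ℂ) • youngSymm s 0 (x ++ (k + l) :: y)) := by
  unfold merge
  split_ifs with h0
  · rw [H.rep_ident]
    have hch : (k + l).choose l = 1 := by rcases h0 with rfl | rfl <;> simp
    have he : erase (x ++ k :: l :: y) = erase (x ++ (k + l) :: y) := by
      rcases h0 with rfl | rfl <;> simp [erase, List.filter_cons]
    rw [hch, Nat.cast_one, one_smul]
    unfold webUnit
    rw [he]
    simp [add_assoc]
  · rw [H.rep_layer (by simp [Piece.Pos, Piece.bot, Piece.top]; omega)]
    simp only [Piece.top, Piece.bot, Piece.coeff, List.append_assoc, List.cons_append,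
      List.nil_append]
    refine webUnit_congr fun hr => ?_
    simp only [List.sum_append, List.sum_cons] at hr
    rw [mul_smul_comm, mul_one, smul_mul_assoc, H.youngSymm_mul_youngSymm' (by simp; omega)
      (by simp; omega)]
    intro i hi
    grind [mem_youngIdx_append, mem_youngIdx_cons, mem_youngIdx_nil]

theorem SergeevFamily.rep_split (x : List ℕ) (k l : ℕ) (y : List ℕ) :
    H.rep (split r x k l y) = webUnit r (x ++ k :: l :: y) (x ++ (k + l) :: y)
      (youngSymm s 0 (x ++ (k + l) :: y)) := by
  unfold split
  split_ifs with h0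
  · rw [H.rep_ident]
    have he : erase (x ++ k :: l :: y) = erase (x ++ (k + l) :: y) := by
      rcases h0 with rfl | rfl <;> simp [erase, List.filter_cons]
    unfold webUnit
    rw [he]
  · rw [H.rep_layer (by simp [Piece.Pos, Piece.bot, Piece.top]; omega)]
    simp only [Piece.top, Piece.bot, Piece.coeff, List.append_assoc, List.cons_append,
      List.nil_append]
    refine webUnit_congr fun hr => ?_
    simp only [List.sum_append, List.sum_cons] at hr
    rw [mul_one, H.youngSymm_mul_youngSymm (by simp; omega) (by simp; omega)]
    intro i hi
    grind [mem_youngIdx_append, mem_youngIdx_cons, mem_youngIdx_nil]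

theorem SergeevFamily.rep_dot (x : List ℕ) (k : ℕ) (y : List ℕ) :
    H.rep (dot r x k y) = webUnit r (x ++ k :: y) (x ++ k :: y)
      (dotSum c x.sum k * youngSymm s 0 (x ++ k :: y)) := by
  unfold dot
  rcases Nat.eq_zero_or_pos k with rfl | hk
  · rw [layer_of_not_pos (by simp [Piece.Pos, Piece.bot, Piece.top]), H.rep_zero]
    simp [webUnit]
  · rw [H.rep_layer (by simp [Piece.Pos, Piece.bot, Piece.top]; omega)]
    simp only [Piece.top, Piece.bot, Piece.coeff, List.append_assoc, List.cons_append,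
      List.nil_append]
    refine webUnit_congr fun hr => ?_
    rw [← (H.commute_dotSum hr.le rfl rfl).eq, mul_assoc, H.youngSymm_idem hr.le]

theorem SergeevFamily.rep_rungL (x : List ℕ) (k l : ℕ) (y : List ℕ) :
    H.rep (rungL r x k (l + 1) y) = webUnit r (x ++ (k + 1) :: l :: y) (x ++ k :: (l + 1) :: y)
      (((k : ℂ) + 1) • (youngSymm s 0 (x ++ (k + 1) :: l :: y) *
        youngSymm s 0 (x ++ k :: (l + 1) :: y))) := by
  rw [rungL, H.rep_mul, H.rep_merge, H.rep_split, webUnit_mul _ _ (by simp) (by simp; omega)]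
  simp [add_comm 1 l]

theorem SergeevFamily.rep_rungR (x : List ℕ) (k l : ℕ) (y : List ℕ) :
    H.rep (rungR r x (k + 1) l y) = webUnit r (x ++ k :: (l + 1) :: y) (x ++ (k + 1) :: l :: y)
      (((l : ℂ) + 1) • (youngSymm s 0 (x ++ k :: (l + 1) :: y) *
        youngSymm s 0 (x ++ (k + 1) :: l :: y))) := by
  rw [rungR, H.rep_mul, H.rep_merge, H.rep_split, webUnit_mul _ _ (by simp) (by simp; omega),
    add_comm 1 l, Nat.choose_succ_self_right]
  simp

theorem SergeevFamily.rep_rungLDot (x : List ℕ) (k l : ℕ) (y : List ℕ) :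
    H.rep (rungLDot r x k (l + 1) y) =
      webUnit r (x ++ (k + 1) :: l :: y) (x ++ k :: (l + 1) :: y)
      (((k : ℂ) + 1) • (youngSymm s 0 (x ++ (k + 1) :: l :: y) * c (x.sum + k) *
        youngSymm s 0 (x ++ k :: (l + 1) :: y))) := by
  rw [rungLDot, H.rep_mul, H.rep_mul, H.rep_merge, H.rep_split, H.rep_dot,
    webUnit_mul _ _ (by simp) (by simp), webUnit_mul _ _ (by simp) (by simp; omega)]
  simp only [Nat.add_sub_cancel, add_comm 1 l, List.append_assoc, List.cons_append,
    List.nil_append, List.sum_append, List.sum_cons, List.sum_nil, add_zero, dotSum_one]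
  refine webUnit_congr fun hr => ?_
  simp only [List.sum_append, List.sum_cons] at hr
  rw [smul_mul_assoc, smul_mul_assoc, ← mul_assoc, mul_assoc _ (youngSymm s 0 _),
    H.youngSymm_mul_youngSymm (by simp; omega) (by simp; omega)]
  · simp
  · intro i hi
    grind [mem_youngIdx_append, mem_youngIdx_cons, mem_youngIdx_nil]

theorem SergeevFamily.rep_rungRDot (x : List ℕ) (k l : ℕ) (y : List ℕ) :
    H.rep (rungRDot r x (k + 1) l y) =
      webUnit r (x ++ k :: (l + 1) :: y) (x ++ (k + 1) :: l :: y)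
      (((l : ℂ) + 1) • (youngSymm s 0 (x ++ k :: (l + 1) :: y) * c (x.sum + k) *
        youngSymm s 0 (x ++ (k + 1) :: l :: y))) := by
  rw [rungRDot, H.rep_mul, H.rep_mul, H.rep_merge, H.rep_split, H.rep_dot,
    webUnit_mul _ _ (by simp) (by simp), webUnit_mul _ _ (by simp) (by simp; omega)]
  simp only [Nat.add_sub_cancel, add_comm 1 l, List.append_assoc, List.cons_append,
    List.nil_append, List.sum_append, List.sum_cons, List.sum_nil, add_zero, dotSum_one]
  refine webUnit_congr fun hr => ?_
  simp only [List.sum_append, List.sum_cons] at hr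
  rw [smul_mul_assoc, smul_mul_assoc, ← mul_assoc, mul_assoc _ (youngSymm s 0 _),
    H.youngSymm_mul_youngSymm (by simp; omega) (by simp; omega)]
  · simp
  · intro i hi
    grind [mem_youngIdx_append, mem_youngIdx_cons, mem_youngIdx_nil]

end Representation

/-! ### The web relations hold in the representation -/

section Relations

variable {A : Type} [Ring A] [Algebra ℂ A] {r : ℕ} {s c : ℕ → A} (H : SergeevFamily r s c)

include H

theorem SergeevFamily.commute_coeff {p : Piece} {a x y : List ℕ} {n : ℕ} (ha : a.sum ≤ r)
    (hn : n = x.sum) (h : a = x ++ p.top ++ y ∨ a = x ++ p.bot ++ y) :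
    Commute (p.coeff c n) (youngSymm s 0 a) := by
  cases p with
  | merge k l => exact (Commute.one_left _).smul_left _
  | split k l => exact Commute.one_left _
  | dot k =>
    refine H.commute_dotSum (x := x) (y := y) ha hn ?_
    rcases h with h | h <;> simpa [Piece.top, Piece.bot] using h

theorem SergeevFamily.coeff_interchange {p q : Piece} {m n : ℕ} (hm : m + p.bot.sum ≤ n)
    (hn : n + q.bot.sum ≤ r) :
    p.coeff c m * q.coeff c n = (-1 : ℂ) ^ (p.dots * q.dots) • (q.coeff c n * p.coeff c m) := by
  cases p with
  | merge k l => simp [Piece.dots, Piece.coeff]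
  | split k l => simp [Piece.dots, Piece.coeff]
  | dot k =>
    cases q with
    | merge k l => simp [Piece.dots, Piece.coeff]
    | split k l => simp [Piece.dots, Piece.coeff]
    | dot l =>
      simp only [Piece.bot, List.sum_cons, List.sum_nil, add_zero] at hm hn
      simp [Piece.dots, Piece.coeff, H.dotSum_anti hm hn]

/-- Coefficients commute with the symmetrizers at the top and bottom of their piece, whatever the
other piece does. Both intermediate symmetrizers `U` and `V` are absorbed by `T` and `W`, since each
of their blocks occurs in one of these. Only the sign between the two coefficients remains. -/
theorem SergeevFamily.rep_interchange (x y z : List ℕ) (p q : Piece) :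
    H.rep (layer r x p (y ++ q.top ++ z) * layer r (x ++ p.bot ++ y) q z) =
      H.rep ((-1 : ℂ) ^ (p.dots * q.dots) •
        (layer r (x ++ p.top ++ y) q z * layer r x p (y ++ q.bot ++ z))) := by
  by_cases hp : p.Pos
  swap
  · rw [layer_of_not_pos hp, layer_of_not_pos hp, zero_mul, mul_zero, smul_zero]
  by_cases hq : q.Pos
  swap
  · rw [layer_of_not_pos hq, layer_of_not_pos hq, zero_mul, mul_zero, smul_zero]
  have sp := p.sum_top
  have sq := q.sum_top
  rw [H.rep_smul, H.rep_mul, H.rep_mul, H.rep_layer hp, H.rep_layer hq, H.rep_layer hp,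
    H.rep_layer hq, webUnit_mul _ _ (by simp) (by simp [sq]),
    webUnit_mul _ _ (by simp) (by simp [sp]), ← webUnit_smul]
  simp only [List.append_assoc]
  refine webUnit_congr fun hr => ?_
  set cp := p.coeff c x.sum
  set T := youngSymm s 0 (x ++ (p.top ++ (y ++ (q.top ++ z)))) with hT
  set U := youngSymm s 0 (x ++ (p.bot ++ (y ++ (q.top ++ z)))) with hU
  set V := youngSymm s 0 (x ++ (p.top ++ (y ++ (q.bot ++ z)))) with hV
  set W := youngSymm s 0 (x ++ (p.bot ++ (y ++ (q.bot ++ z)))) with hW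
  simp only [List.sum_append] at hr
  have hn : (x ++ (p.top ++ y)).sum = (x ++ (p.bot ++ y)).sum := by simp [sp]
  rw [hn]
  set cq := q.coeff c (x ++ (p.bot ++ y)).sum with hcq
  have rT : (x ++ (p.top ++ (y ++ (q.top ++ z)))).sum ≤ r := by simp; omega
  have rU : (x ++ (p.bot ++ (y ++ (q.top ++ z)))).sum ≤ r := by simp; omega
  have rV : (x ++ (p.top ++ (y ++ (q.bot ++ z)))).sum ≤ r := by simp; omega
  have rW : (x ++ (p.bot ++ (y ++ (q.bot ++ z)))).sum ≤ r := by simp; omega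
  have e1 : T * cp = cp * T := ((H.commute_coeff (p := p) (x := x) (y := y ++ (q.top ++ z)) rT rfl
    (Or.inl (by simp))).eq).symm
  have e2 : U * cq = cq * U := ((H.commute_coeff (p := q) (x := x ++ (p.bot ++ y)) (y := z) rU rfl
    (Or.inl (by simp))).eq).symm
  have e3 : T * cq = cq * T := ((H.commute_coeff (p := q) (x := x ++ (p.top ++ y)) (y := z) rT
    hn.symm (Or.inl (by simp))).eq).symm
  have e4 : V * cp = cp * V := ((H.commute_coeff (p := p) (x := x) (y := y ++ (q.bot ++ z)) rV rfl
    (Or.inl (by simp))).eq).symm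
  have e5 : U * U = U := H.youngSymm_idem rU
  have e6 : V * V = V := H.youngSymm_idem rV
  have e7 : cp * cq = (-1 : ℂ) ^ (p.dots * q.dots) • (cq * cp) :=
    H.coeff_interchange (by simp) (by simp; omega)
  have iT := H.isSymmetrizer (p := 0) (a := x ++ (p.top ++ (y ++ (q.top ++ z)))) (by omega)
  have iW := H.isSymmetrizer (p := 0) (a := x ++ (p.bot ++ (y ++ (q.bot ++ z)))) (by omega)
  have e8 : T * U * W = T * W := by
    have h := H.mul_youngSymm_append_mul' (u := x ++ (p.bot ++ y)) (v := q.top ++ z)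
      (z := T) (w := W) (by simp; omega)
      (fun i hi => iT.right i (by
        have h0 : x.sum + (p.bot.sum + y.sum) = x.sum + p.bot.sum + y.sum := by omega
        simp only [List.sum_append, h0] at hi
        simp [hi, sp]))
      (fun i hi => iW.left i (by
        simp only [mem_youngIdx_append] at hi ⊢
        tauto))
    simpa only [List.append_assoc] using h
  have e9 : T * V * W = T * W := by
    have h := H.mul_youngSymm_append_mul (u := x ++ (p.top ++ y)) (v := q.bot ++ z)
      (z := T) (w := W) (by simp; omega)
      (fun i hi => iT.right i (by
        simp only [mem_youngIdx_append] at hi ⊢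
        tauto))
      (fun i hi => iW.left i (by
        have h0 : x.sum + (p.top.sum + y.sum) = x.sum + p.bot.sum + y.sum := by omega
        simp only [List.sum_append, h0] at hi
        simp [hi]))
    simpa only [List.append_assoc] using h
  calc T * cp * U * (U * cq * W) = T * cp * (U * U) * cq * W := by simp only [mul_assoc]
    _ = cp * T * (U * cq) * W := by rw [e5, e1, mul_assoc (cp * T)]
    _ = cp * (T * cq) * U * W := by rw [e2]; simp only [mul_assoc]
    _ = cp * cq * (T * U * W) := by rw [e3]; simp only [mul_assoc]
    _ = (-1 : ℂ) ^ (p.dots * q.dots) • (cq * cp * (T * V * W)) := by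
      rw [e7, e8, e9, smul_mul_assoc]
    _ = (-1 : ℂ) ^ (p.dots * q.dots) • (cq * (T * cp) * V * W) := by
      rw [e1]; simp only [mul_assoc]
    _ = (-1 : ℂ) ^ (p.dots * q.dots) • (cq * T * (V * cp) * W) := by
      rw [e4]; simp only [mul_assoc]
    _ = (-1 : ℂ) ^ (p.dots * q.dots) • (T * cq * (V * V) * cp * W) := by
      rw [e6, e3]; simp only [mul_assoc]
    _ = _ := by simp only [mul_assoc]

theorem SergeevFamily.rep_sum_ident :
    H.rep (∑ a : Composition r, ident r a.blocks) = youngProj r s := by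
  classical
  rw [H.rep_sum]
  refine LinearMap.ext fun f => funext fun b => ?_
  rw [LinearMap.sum_apply, Finset.sum_apply, youngProj_apply]
  have h0 : ∀ a : Composition r, H.rep (ident r a.blocks) f b =
      if a.blocks = b then youngSymm s 0 b * f b else 0 := fun a => by
    have ha : IsObj r a.blocks := ⟨fun k hk => a.blocks_pos hk, a.blocks_sum⟩
    rw [H.rep_ident, webUnit, if_pos ha.2, erase_eq_self ha, matUnit_apply]
    split_ifs with h
    · subst h
      simp
    · rw [Pi.single_eq_of_ne (Ne.symm h)]
  simp only [h0]
  split_ifs with hb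
  · rw [Finset.sum_eq_single (⟨b, fun hk => hb.1 _ hk, hb.2⟩ : Composition r)]
    · simp
    · intro a _ ha
      exact if_neg fun h => ha (Composition.ext h)
    · simp
  · refine Finset.sum_eq_zero fun a _ => if_neg fun h => hb ?_
    subst h
    exact ⟨fun k hk => a.blocks_pos hk, a.blocks_sum⟩

/-- With D the symmetrizer having the block 2 and u the product of the two odd generators, 2 D = Y +
Y s Y. Since u s u = s and u² = −1, the dotted term is Y s Y − Y, and the difference is 2 Y. -/
theorem SergeevFamily.rep_dumbbell (x y : List ℕ) :
    H.rep (split r x 1 1 y * merge r x 1 1 y -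
        twoDots r x y * split r x 1 1 y * merge r x 1 1 y * twoDots r x y) =
      H.rep ((2 : ℂ) • ident r (x ++ 1 :: 1 :: y)) := by
  rw [H.rep_sub, H.rep_smul, H.rep_mul, H.rep_mul, H.rep_mul, H.rep_mul, twoDots, H.rep_mul,
    H.rep_merge, H.rep_split, H.rep_ident, H.rep_dot, H.rep_dot,
    webUnit_mul _ _ (by simp) (by simp; try omega), webUnit_mul _ _ (by simp) (by simp; try omega),
    webUnit_mul _ _ (by simp) (by simp; try omega), webUnit_mul _ _ (by simp) (by simp; try omega),
    webUnit_mul _ _ (by simp) (by simp), ← webUnit_smul]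
  simp only [List.append_assoc, List.cons_append, List.nil_append, ← webUnit_sub]
  refine webUnit_congr fun hr => ?_
  simp only [List.sum_append, List.sum_cons] at hr
  have rA : (x ++ 1 :: 1 :: y).sum ≤ r := by simp; omega
  have rD : (x ++ 2 :: y).sum ≤ r := by simp; omega
  set Y := youngSymm s 0 (x ++ 1 :: 1 :: y) with hY
  -- The smallest case of the double coset formula, two blocks of size 1, expresses 2 D through `Y`
  -- and the transposition.
  have h1 := H.smul_mid_right (x := x) (y := y) (k := 0) (z := Y) (w := Y) (by simp; omega)
    (H.rightFixed rA subset_rfl) (H.leftFixed rA subset_rfl)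
  have hYY : Y * Y = Y := H.youngSymm_idem rA
  have hYD : Y * youngSymm s 0 (x ++ 2 :: y) = youngSymm s 0 (x ++ 2 :: y) :=
    H.youngSymm_mul_youngSymm rA rD fun i hi => by
      grind [mem_youngIdx_append, mem_youngIdx_cons, mem_youngIdx_nil]
  have hDY : youngSymm s 0 (x ++ 2 :: y) * Y = youngSymm s 0 (x ++ 2 :: y) :=
    H.youngSymm_mul_youngSymm' rA rD fun i hi => by
      grind [mem_youngIdx_append, mem_youngIdx_cons, mem_youngIdx_nil]
  have hDD := H.youngSymm_idem rD
  have c1 : c x.sum * Y = Y * c x.sum := by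
    simpa using (H.commute_dotSum (x := x) (k := 1) (y := 1 :: y) rA rfl rfl).eq
  have c2 : c (x.sum + 1) * Y = Y * c (x.sum + 1) := by
    simpa using (H.commute_dotSum (p := x.sum + 1) (x := x ++ [1]) (k := 1) (y := y) rA
      (by simp) (by simp)).eq
  simp only [Nat.cast_zero, zero_add, one_smul, add_zero, hYY, hYD, hDY] at h1
  have hs : c x.sum * c (x.sum + 1) * (s x.sum * (c x.sum * c (x.sum + 1))) = s x.sum := by
    rw [← mul_assoc (s x.sum), ← H.c_succ_s _ (by omega), mul_assoc (c (x.sum + 1)),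
      ← H.c_s _ (by omega), mul_assoc (c x.sum), ← mul_assoc (c (x.sum + 1)),
      H.c_sq _ (by omega), one_mul, ← mul_assoc, H.c_sq _ (by omega), one_mul]
  have hc : c x.sum * c (x.sum + 1) * (c x.sum * c (x.sum + 1)) = -1 := by
    rw [H.c_anti (x.sum) (by omega) (x.sum + 1) (by omega) (by omega), neg_mul_neg, mul_assoc,
      ← mul_assoc (c x.sum), H.c_anti (x.sum) (by omega) (x.sum + 1) (by omega) (by omega), neg_mul,
      mul_neg, mul_assoc (c (x.sum + 1)) (c x.sum), H.c_sq _ (by omega), mul_one,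
      H.c_sq _ (by omega)]
  have hcc : c x.sum * Y * (c (x.sum + 1) * Y) = c x.sum * c (x.sum + 1) * Y := by
    rw [c2, ← mul_assoc, mul_assoc (c x.sum), hYY, mul_assoc (c x.sum), ← c2, ← mul_assoc]
  have hcc' : c x.sum * c (x.sum + 1) * Y = Y * (c x.sum * c (x.sum + 1)) := by
    rw [mul_assoc, c2, ← mul_assoc, c1, mul_assoc]
  simp only [List.sum_append, List.sum_cons, List.sum_nil, add_zero, dotSum_one, Nat.reduceAdd,
    Nat.choose_one_right, Nat.cast_ofNat, hcc, mul_smul_comm, smul_mul_assoc]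
  rw [hDD, mul_assoc _ Y (youngSymm s 0 (x ++ 2 :: y)), hYD]
  set D := youngSymm s 0 (x ++ 2 :: y)
  set u := c x.sum * c (x.sum + 1)
  have hYu : Y * (u * Y) = u * Y := by rw [hcc', ← mul_assoc, hYY]
  have key : (2 : ℂ) • (u * D * (D * (u * Y))) = Y * s x.sum * Y - Y := by
    calc (2 : ℂ) • (u * D * (D * (u * Y))) = u * ((2 : ℂ) • D) * (u * Y) := by
          rw [mul_smul_comm, smul_mul_assoc, mul_assoc u D, ← mul_assoc D D, hDD, mul_assoc u D]
      _ = u * (Y * (u * Y)) + u * Y * s x.sum * (Y * (u * Y)) := by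
          rw [h1]
          simp only [mul_add, add_mul, mul_assoc]
      _ = u * u * Y + Y * (u * (s x.sum * u)) * Y := by
          rw [hYu, hcc']
          simp only [mul_assoc]
          rw [← hcc', ← mul_assoc Y]
      _ = Y * s x.sum * Y - Y := by
          rw [hc, hs]
          noncomm_ring
  simp only [mul_assoc] at key ⊢
  rw [key, h1]
  simp only [mul_assoc]
  module

/-- The sum of odd generators is additive under concatenation of strands. In the representation no
leg has to be thin. -/
theorem SergeevFamily.rep_dot_merge (x : List ℕ) (k l : ℕ) (y : List ℕ) :
    H.rep (dot r x (k + l) y * merge r x k l y) =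
      H.rep (merge r x k l y * dot r x k (l :: y) + merge r x k l y * dot r (x ++ [k]) l y) := by
  rw [H.rep_add, H.rep_mul, H.rep_mul, H.rep_mul, H.rep_merge, H.rep_dot, H.rep_dot, H.rep_dot,
    webUnit_mul _ _ rfl (by simp; omega), webUnit_mul _ _ rfl rfl,
    webUnit_mul _ _ (by simp) (by simp)]
  simp only [List.append_assoc, List.cons_append, List.nil_append, ← webUnit_add]
  refine webUnit_congr fun hr => ?_
  simp only [List.sum_append, List.sum_cons] at hr
  have hb : (x ++ k :: l :: y).sum ≤ r := by simp; omega
  have ht : (x ++ (k + l) :: y).sum ≤ r := by simp; omega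
  have h1 : youngSymm s 0 (x ++ (k + l) :: y) * youngSymm s 0 (x ++ k :: l :: y) =
      youngSymm s 0 (x ++ (k + l) :: y) := H.youngSymm_mul_youngSymm' hb ht fun i hi => by
    grind [mem_youngIdx_append, mem_youngIdx_cons, mem_youngIdx_nil]
  have h2 := (H.commute_dotSum (x := x) (k := k + l) ht rfl rfl).eq
  have h3 := (H.commute_dotSum (x := x) (k := k) hb rfl rfl).eq
  have h4 := (H.commute_dotSum (p := x.sum + k) (x := x ++ [k]) (k := l) (y := y) hb (by simp)
    (by simp)).eq
  simp only [List.sum_append, List.sum_cons, List.sum_nil, add_zero]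
  rw [h3, h4, smul_mul_assoc, smul_mul_assoc, ← mul_assoc, ← mul_assoc, h1, mul_smul_comm, h2,
    mul_assoc, h2, ← mul_assoc, H.youngSymm_idem ht, dotSum_add, mul_add, smul_add]

theorem SergeevFamily.rep_split_dot (x : List ℕ) (k l : ℕ) (y : List ℕ) :
    H.rep (split r x k l y * dot r x (k + l) y) =
      H.rep (dot r x k (l :: y) * split r x k l y + dot r (x ++ [k]) l y * split r x k l y) := by
  rw [H.rep_add, H.rep_mul, H.rep_mul, H.rep_mul, H.rep_split, H.rep_dot, H.rep_dot, H.rep_dot,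
    webUnit_mul _ _ rfl rfl, webUnit_mul _ _ rfl (by simp; omega),
    webUnit_mul _ _ (by simp) (by simp; omega)]
  simp only [List.append_assoc, List.cons_append, List.nil_append, ← webUnit_add]
  refine webUnit_congr fun hr => ?_
  simp only [List.sum_append, List.sum_cons] at hr
  have hb : (x ++ k :: l :: y).sum ≤ r := by simp; omega
  have ht : (x ++ (k + l) :: y).sum ≤ r := by simp; omega
  have h1 : youngSymm s 0 (x ++ k :: l :: y) * youngSymm s 0 (x ++ (k + l) :: y) =
      youngSymm s 0 (x ++ (k + l) :: y) := H.youngSymm_mul_youngSymm hb ht fun i hi => by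
    grind [mem_youngIdx_append, mem_youngIdx_cons, mem_youngIdx_nil]
  have h2 := (H.commute_dotSum (x := x) (k := k + l) ht rfl rfl).eq
  simp only [List.sum_append, List.sum_cons, List.sum_nil, add_zero]
  rw [mul_assoc, h1, mul_assoc, h1, h2, ← mul_assoc, H.youngSymm_idem ht, ← h2, dotSum_add,
    add_mul]

theorem SergeevFamily.entry_ident {a : List ℕ} (ha : IsObj r a) :
    (WebGen.ident a ha).entry s c = youngSymm s 0 a := by
  rw [WebGen.entry, WebGen.coeff, mul_one]
  exact H.youngSymm_idem ha.2.le

theorem SergeevFamily.rep_rel {v w : FreeWeb r} (h : WebRel r v w) : H.rep v = H.rep w := by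
  cases h with
  | compat g₁ g₂ h =>
    rw [H.rep_mul, H.rep_ι, H.rep_ι, matUnit_mul_of_ne h, H.rep_zero]
  | ident_mul g =>
    rw [H.rep_mul, H.rep_ι, H.rep_ι]
    refine (matUnit_mul _ _ _ _ _).trans ?_
    rw [H.entry_ident]
    exact congrArg _ (H.top_mul_entry g)
  | mul_ident g =>
    rw [H.rep_mul, H.rep_ι, H.rep_ι]
    refine (matUnit_mul _ _ _ _ _).trans ?_
    rw [H.entry_ident]
    exact congrArg _ (H.entry_mul_bot g)
  | sum_ident => rw [H.rep_sum_ident, H.rep_one]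
  | interchange x y z p q => exact H.rep_interchange x y z p q
  | merge_assoc x y h k l =>
    rw [H.rep_mul, H.rep_mul]
    simp only [H.rep_merge]
    rw [webUnit_mul _ _ rfl (by simp; omega), webUnit_mul _ _ (by simp) (by simp; omega)]
    simp only [List.append_assoc, List.cons_append, List.nil_append, ← add_assoc]
    refine webUnit_congr fun hr => ?_
    simp only [List.sum_append, List.sum_cons] at hr
    rw [smul_mul_smul_comm, smul_mul_smul_comm,
      H.youngSymm_mul_youngSymm' (by simp; omega) (by simp; omega) fun i hi => by
        grind [mem_youngIdx_append, mem_youngIdx_cons, mem_youngIdx_nil],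
      H.youngSymm_mul_youngSymm' (by simp; omega) (by simp; omega) fun i hi => by
        grind [mem_youngIdx_append, mem_youngIdx_cons, mem_youngIdx_nil]]
    congr 1
    -- Both iterated merges have the same trinomial coefficient.
    have h1 := Nat.choose_mul (n := h + k + l) (k := k + l) (s := l)
    rw [show h + k + l - l = h + k by omega, show k + l - l = k by omega] at h1
    exact_mod_cast (h1 (by omega)).symm
  | split_assoc x y h k l =>
    rw [H.rep_mul, H.rep_mul]
    simp only [H.rep_split]
    rw [webUnit_mul _ _ (by simp) (by simp; omega), webUnit_mul _ _ (by simp) (by simp; omega)]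
    simp only [List.append_assoc, List.cons_append, List.nil_append, ← add_assoc]
    refine webUnit_congr fun hr => ?_
    simp only [List.sum_append, List.sum_cons] at hr
    rw [H.youngSymm_mul_youngSymm (by simp; omega) (by simp; omega) fun i hi => by
        grind [mem_youngIdx_append, mem_youngIdx_cons, mem_youngIdx_nil],
      H.youngSymm_mul_youngSymm (by simp; omega) (by simp; omega) fun i hi => by
        grind [mem_youngIdx_append, mem_youngIdx_cons, mem_youngIdx_nil]]
  | digon x y k l =>
    rw [H.rep_mul, H.rep_merge, H.rep_split, webUnit_mul _ _ rfl (by simp; omega), H.rep_smul,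
      H.rep_ident, ← webUnit_smul]
    refine webUnit_congr fun hr => ?_
    rw [smul_mul_assoc, H.youngSymm_idem hr.le]
  | dot_dot x y k =>
    rw [H.rep_mul, H.rep_dot, webUnit_mul _ _ rfl rfl, H.rep_smul, H.rep_ident, ← webUnit_smul]
    refine webUnit_congr fun hr => ?_
    rw [mul_assoc, ← mul_assoc (youngSymm _ _ _), ← (H.commute_dotSum hr.le rfl rfl).eq,
      mul_assoc (dotSum _ _ _) (youngSymm _ _ _), H.youngSymm_idem hr.le, ← mul_assoc,
      H.dotSum_sq (by simp at hr; omega), smul_mul_assoc, one_mul]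
  | dot_merge_left x y k => exact H.rep_dot_merge x 1 k y
  | split_dot_left x y k => exact H.rep_split_dot x 1 k y
  | dot_merge_right x y k =>
    rw [add_comm (merge r x k 1 y * _)]
    exact H.rep_dot_merge x k 1 y
  | split_dot_right x y k =>
    rw [add_comm (dot r (x ++ [k]) 1 y * _)]
    exact H.rep_split_dot x k 1 y
  | dumbbell x y => exact H.rep_dumbbell x y
  | square x y k l hk hl =>
    -- Positive labels are written as successors so that the truncated subtractions in the ladders
    -- disappear; the reduced labels may still be `0`.
    obtain ⟨k, rfl⟩ : ∃ n, k = n + 1 := ⟨k - 1, by omega⟩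
    obtain ⟨l, rfl⟩ : ∃ n, l = n + 1 := ⟨l - 1, by omega⟩
    rw [H.rep_sub, H.rep_mul, H.rep_mul, H.rep_smul, H.rep_ident]
    simp only [Nat.add_sub_cancel, H.rep_rungL, H.rep_rungR]
    rw [webUnit_mul _ _ rfl (by simp; omega), webUnit_mul _ _ rfl (by simp; omega),
      ← webUnit_sub, ← webUnit_smul]
    exact webUnit_congr fun hr => H.square_value hr.le
  | square_dot x y k l hk hl =>
    obtain ⟨k, rfl⟩ : ∃ n, k = n + 1 := ⟨k - 1, by omega⟩
    obtain ⟨l, rfl⟩ : ∃ n, l = n + 1 := ⟨l - 1, by omega⟩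
    rw [H.rep_sub, H.rep_mul, H.rep_mul, H.rep_sub, H.rep_dot, H.rep_dot]
    simp only [Nat.add_sub_cancel, H.rep_rungLDot, H.rep_rungR]
    rw [webUnit_mul _ _ rfl (by simp; omega), webUnit_mul _ _ rfl (by simp; omega),
      ← webUnit_sub]
    simp only [List.append_assoc, List.cons_append, List.nil_append, List.sum_append, List.sum_cons,
      List.sum_nil, add_zero, ← webUnit_sub]
    exact webUnit_congr fun hr => H.square_dot_value hr.le
  | square_dot' x y k l hk hl =>
    obtain ⟨k, rfl⟩ : ∃ n, k = n + 1 := ⟨k - 1, by omega⟩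
    obtain ⟨l, rfl⟩ : ∃ n, l = n + 1 := ⟨l - 1, by omega⟩
    rw [H.rep_sub, H.rep_mul, H.rep_mul, H.rep_sub, H.rep_dot, H.rep_dot]
    simp only [Nat.add_sub_cancel, H.rep_rungL, H.rep_rungRDot]
    rw [webUnit_mul _ _ rfl (by simp; omega), webUnit_mul _ _ rfl (by simp; omega),
      ← webUnit_sub]
    simp only [List.append_assoc, List.cons_append, List.nil_append, List.sum_append, List.sum_cons,
      List.sum_nil, add_zero, ← webUnit_sub]
    exact webUnit_congr fun hr => H.square_dot_value' hr.le
  | rungs_left x y h k l hh hk hl =>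
    obtain ⟨k, rfl⟩ : ∃ n, k = n + 1 := ⟨k - 1, by omega⟩
    obtain ⟨l, rfl⟩ : ∃ n, l = n + 1 := ⟨l - 1, by omega⟩
    rw [H.rep_sub, H.rep_add]
    simp only [H.rep_mul, Nat.add_sub_cancel, H.rep_rungL, H.rep_rungLDot]
    simp only [List.append_assoc, List.cons_append, List.nil_append, List.sum_append, List.sum_cons,
      List.sum_nil, add_zero]
    rw [webUnit_mul _ _ rfl (by simp; omega), webUnit_mul _ _ rfl (by simp; omega),
      webUnit_mul _ _ rfl (by simp; omega), webUnit_mul _ _ rfl (by simp; omega),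
      ← webUnit_sub, ← webUnit_add]
    refine webUnit_congr fun hr => ?_
    have h1 := H.rungs_left_value hr.le
    simpa only [add_assoc, add_comm 1 k] using h1
  | rungs_left_dot x y h k l hh hk hl =>
    obtain ⟨k, rfl⟩ : ∃ n, k = n + 1 := ⟨k - 1, by omega⟩
    obtain ⟨l, rfl⟩ : ∃ n, l = n + 1 := ⟨l - 1, by omega⟩
    rw [H.rep_sub, H.rep_sub]
    simp only [H.rep_mul, Nat.add_sub_cancel, H.rep_rungL, H.rep_rungLDot]
    simp only [List.append_assoc, List.cons_append, List.nil_append, List.sum_append, List.sum_cons,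
      List.sum_nil, add_zero]
    rw [webUnit_mul _ _ rfl (by simp; omega), webUnit_mul _ _ rfl (by simp; omega),
      webUnit_mul _ _ rfl (by simp; omega), webUnit_mul _ _ rfl (by simp; omega),
      ← webUnit_sub, ← webUnit_sub]
    refine webUnit_congr fun hr => ?_
    have h1 := H.rungs_left_dot_value hr.le
    simpa only [add_assoc, add_comm 1 k] using h1
  | rungs_right x y h k l hh hk hl =>
    obtain ⟨h, rfl⟩ : ∃ n, h = n + 1 := ⟨h - 1, by omega⟩
    obtain ⟨k, rfl⟩ : ∃ n, k = n + 1 := ⟨k - 1, by omega⟩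
    rw [H.rep_sub, H.rep_add]
    simp only [H.rep_mul, Nat.add_sub_cancel, H.rep_rungR, H.rep_rungRDot]
    simp only [List.append_assoc, List.cons_append, List.nil_append, List.sum_append, List.sum_cons,
      List.sum_nil, add_zero]
    rw [webUnit_mul _ _ rfl (by simp; omega), webUnit_mul _ _ rfl (by simp; omega),
      webUnit_mul _ _ rfl (by simp; omega), webUnit_mul _ _ rfl (by simp; omega),
      ← webUnit_sub, ← webUnit_add]
    refine webUnit_congr fun hr => ?_
    have h1 := H.rungs_right_value hr.le
    simpa only [add_assoc, add_comm 1 k] using h1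
  | rungs_right_dot x y h k l hh hk hl =>
    obtain ⟨h, rfl⟩ : ∃ n, h = n + 1 := ⟨h - 1, by omega⟩
    obtain ⟨k, rfl⟩ : ∃ n, k = n + 1 := ⟨k - 1, by omega⟩
    rw [H.rep_sub, H.rep_sub]
    simp only [H.rep_mul, Nat.add_sub_cancel, H.rep_rungR, H.rep_rungRDot]
    simp only [List.append_assoc, List.cons_append, List.nil_append, List.sum_append, List.sum_cons,
      List.sum_nil, add_zero]
    rw [webUnit_mul _ _ rfl (by simp; omega), webUnit_mul _ _ rfl (by simp; omega),
      webUnit_mul _ _ rfl (by simp; omega), webUnit_mul _ _ rfl (by simp; omega),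
      ← webUnit_sub, ← webUnit_sub]
    refine webUnit_congr fun hr => ?_
    have h1 := H.rungs_right_dot_value hr.le
    simpa only [add_assoc, add_comm 1 k] using h1

end Relations

/-! ### Calculus of webs -/

section Calculus

variable {r : ℕ}

/-- The class of an identity web. -/
def webIdent (r : ℕ) (a : List ℕ) : Web r := Web.mk r (ident r a)

/-- The class of an elementary web. -/
def webLayer (r : ℕ) (x : List ℕ) (p : Piece) (y : List ℕ) : Web r := Web.mk r (layer r x p y)

/-- The class of a merge. -/
def webMerge (r : ℕ) (x : List ℕ) (k l : ℕ) (y : List ℕ) : Web r := Web.mk r (merge r x k l y)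

/-- The class of a split. -/
def webSplit (r : ℕ) (x : List ℕ) (k l : ℕ) (y : List ℕ) : Web r := Web.mk r (split r x k l y)

/-- The class of a dot. -/
def webDot (r : ℕ) (x : List ℕ) (k : ℕ) (y : List ℕ) : Web r := Web.mk r (dot r x k y)

/-- The split of two 1-strands after their merge. -/
def webDumbbell (r : ℕ) (x y : List ℕ) : Web r := webSplit r x 1 1 y * webMerge r x 1 1 y

theorem Web.mk_eq_of_rel {v w : FreeWeb r} (h : WebRel r v w) : Web.mk r v = Web.mk r w :=
  RingQuot.mkAlgHom_rel ℂ h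

theorem erase_cons_zero (a : List ℕ) : erase (0 :: a) = erase a := by simp [erase]

theorem ident_eq {a b : List ℕ} (hb : IsObj r b) (h : erase a = b) :
    ident r a = FreeAlgebra.ι ℂ (WebGen.ident b hb) := by
  subst h
  exact dif_pos hb

theorem layer_eq {x x' y y' : List ℕ} {p : Piece} (hx : erase x = x') (hy : erase y = y')
    (hb : IsObj r (x' ++ p.bot ++ y')) (ht : IsObj r (x' ++ p.top ++ y')) :
    layer r x p y = FreeAlgebra.ι ℂ (WebGen.layer x' p y' hb ht) := by
  subst hx hy
  exact dif_pos ⟨hb, ht⟩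

theorem webLayer_congr {x x' y y' : List ℕ} (p : Piece) (hx : erase x = erase x')
    (hy : erase y = erase y') : webLayer r x p y = webLayer r x' p y' := by
  by_cases h : IsObj r (erase x' ++ p.bot ++ erase y') ∧ IsObj r (erase x' ++ p.top ++ erase y')
  · rw [webLayer, webLayer, layer_eq hx hy h.1 h.2, layer_eq rfl rfl h.1 h.2]
  · rw [webLayer, webLayer, layer, layer, dif_neg h, dif_neg (by rwa [hx, hy])]

theorem webIdent_mul_gen {a : List ℕ} (g : WebGen r) (h : erase a = g.top) :
    webIdent r a * Web.mk r (FreeAlgebra.ι ℂ g) = Web.mk r (FreeAlgebra.ι ℂ g) := by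
  rw [webIdent, ident_eq g.top_isObj h, ← map_mul]
  exact Web.mk_eq_of_rel (WebRel.ident_mul g)

theorem gen_mul_webIdent {a : List ℕ} (g : WebGen r) (h : erase a = g.bot) :
    Web.mk r (FreeAlgebra.ι ℂ g) * webIdent r a = Web.mk r (FreeAlgebra.ι ℂ g) := by
  rw [webIdent, ident_eq g.bot_isObj h, ← map_mul]
  exact Web.mk_eq_of_rel (WebRel.mul_ident g)

theorem gen_mul_webIdent_of_ne {a : List ℕ} (g : WebGen r) (ha : IsObj r (erase a))
    (h : g.bot ≠ erase a) : Web.mk r (FreeAlgebra.ι ℂ g) * webIdent r a = 0 := by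
  rw [webIdent, ident_eq ha rfl, ← map_mul, ← map_zero (Web.mk r)]
  exact Web.mk_eq_of_rel (WebRel.compat _ _ h)

theorem webIdent_mul_webIdent (a : List ℕ) :
    webIdent r a * webIdent r a = webIdent r a := by
  by_cases h : IsObj r (erase a)
  · nth_rw 2 [webIdent]
    nth_rw 2 [webIdent]
    rw [ident_eq h rfl]
    exact webIdent_mul_gen _ rfl
  · rw [webIdent, ident, dif_neg h, map_zero, mul_zero]

theorem layer_eq_zero {x y : List ℕ} {p : Piece}
    (h : ¬ (p.Pos ∧ (x ++ p.bot ++ y).sum = r)) : layer r x p y = 0 :=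
  dif_neg fun h' => h (layer_isObj_iff.1 h')

theorem webIdent_mul_webLayer (x : List ℕ) (p : Piece) (y : List ℕ) :
    webIdent r (x ++ p.top ++ y) * webLayer r x p y = webLayer r x p y := by
  by_cases h : p.Pos ∧ (x ++ p.bot ++ y).sum = r
  · have h' := layer_isObj_iff.2 h
    rw [webLayer, layer, dif_pos h']
    exact webIdent_mul_gen _ (by rw [erase_append, erase_append, h.1.erase_top]; rfl)
  · rw [webLayer, layer_eq_zero h, map_zero, mul_zero]

theorem webLayer_mul_webIdent (x : List ℕ) (p : Piece) (y : List ℕ) :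
    webLayer r x p y * webIdent r (x ++ p.bot ++ y) = webLayer r x p y := by
  by_cases h : p.Pos ∧ (x ++ p.bot ++ y).sum = r
  · have h' := layer_isObj_iff.2 h
    rw [webLayer, layer, dif_pos h']
    exact gen_mul_webIdent _ (by rw [erase_append, erase_append, h.1.erase_bot]; rfl)
  · rw [webLayer, layer_eq_zero h, map_zero, zero_mul]

theorem webMerge_of_eq_zero (x : List ℕ) (k l : ℕ) (y : List ℕ) (h : k = 0 ∨ l = 0) :
    webMerge r x k l y = webIdent r (x ++ (k + l) :: y) := by
  rw [webMerge, merge, if_pos h]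
  rfl

theorem webSplit_of_eq_zero (x : List ℕ) (k l : ℕ) (y : List ℕ) (h : k = 0 ∨ l = 0) :
    webSplit r x k l y = webIdent r (x ++ (k + l) :: y) := by
  rw [webSplit, split, if_pos h]
  rfl

theorem webMerge_eq_webLayer (x : List ℕ) {k l : ℕ} (y : List ℕ) (hk : 0 < k) (hl : 0 < l) :
    webMerge r x k l y = webLayer r x (.merge k l) y := by
  rw [webMerge, merge, if_neg (by omega)]
  rfl

theorem webSplit_eq_webLayer (x : List ℕ) {k l : ℕ} (y : List ℕ) (hk : 0 < k) (hl : 0 < l) :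
    webSplit r x k l y = webLayer r x (.split k l) y := by
  rw [webSplit, split, if_neg (by omega)]
  rfl

theorem webDot_eq_webLayer (x : List ℕ) (k : ℕ) (y : List ℕ) :
    webDot r x k y = webLayer r x (.dot k) y := rfl

theorem webIdent_mul_webMerge (x : List ℕ) {k l : ℕ} (y : List ℕ) (hk : 0 < k) (hl : 0 < l) :
    webIdent r (x ++ (k + l) :: y) * webMerge r x k l y = webMerge r x k l y := by
  rw [webMerge_eq_webLayer x y hk hl]
  simpa [Piece.top] using webIdent_mul_webLayer (r := r) x (.merge k l) y

theorem webMerge_mul_webIdent (x : List ℕ) {k l : ℕ} (y : List ℕ) (hk : 0 < k) (hl : 0 < l) :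
    webMerge r x k l y * webIdent r (x ++ k :: l :: y) = webMerge r x k l y := by
  rw [webMerge_eq_webLayer x y hk hl]
  simpa [Piece.bot] using webLayer_mul_webIdent (r := r) x (.merge k l) y

theorem webIdent_mul_webSplit (x : List ℕ) {k l : ℕ} (y : List ℕ) (hk : 0 < k) (hl : 0 < l) :
    webIdent r (x ++ k :: l :: y) * webSplit r x k l y = webSplit r x k l y := by
  rw [webSplit_eq_webLayer x y hk hl]
  simpa [Piece.top] using webIdent_mul_webLayer (r := r) x (.split k l) y

theorem webIdent_mul_webDot (x : List ℕ) (k : ℕ) (y : List ℕ) :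
    webIdent r (x ++ k :: y) * webDot r x k y = webDot r x k y := by
  rw [webDot_eq_webLayer]
  simpa [Piece.top] using webIdent_mul_webLayer (r := r) x (.dot k) y

theorem webDot_mul_webIdent (x : List ℕ) (k : ℕ) (y : List ℕ) :
    webDot r x k y * webIdent r (x ++ k :: y) = webDot r x k y := by
  rw [webDot_eq_webLayer]
  simpa [Piece.bot] using webLayer_mul_webIdent (r := r) x (.dot k) y

theorem webIdent_mul_webDumbbell (x y : List ℕ) :
    webIdent r (x ++ 1 :: 1 :: y) * webDumbbell r x y = webDumbbell r x y := by
  rw [webDumbbell, ← mul_assoc, webIdent_mul_webSplit x y one_pos one_pos]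

theorem webDumbbell_mul_webIdent (x y : List ℕ) :
    webDumbbell r x y * webIdent r (x ++ 1 :: 1 :: y) = webDumbbell r x y := by
  rw [webDumbbell, mul_assoc, webMerge_mul_webIdent x y one_pos one_pos]

/-! ### Local relations -/

theorem webLayer_interchange (x y z : List ℕ) (p q : Piece) :
    webLayer r x p (y ++ q.top ++ z) * webLayer r (x ++ p.bot ++ y) q z =
      (-1 : ℂ) ^ (p.dots * q.dots) •
        (webLayer r (x ++ p.top ++ y) q z * webLayer r x p (y ++ q.bot ++ z)) := by
  have h := Web.mk_eq_of_rel (WebRel.interchange (r := r) x y z p q)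
  rwa [map_mul, map_smul, map_mul] at h

theorem webMerge_assoc (x y : List ℕ) {h k l : ℕ} (hh : 0 < h) (hk : 0 < k) (hl : 0 < l) :
    webMerge r x (h + k) l y * webMerge r x h k (l :: y) =
      webMerge r x h (k + l) y * webMerge r (x ++ [h]) k l y := by
  have h := Web.mk_eq_of_rel (WebRel.merge_assoc (r := r) x y h k l hh hk hl)
  rwa [map_mul, map_mul] at h

theorem webSplit_assoc (x y : List ℕ) {h k l : ℕ} (hh : 0 < h) (hk : 0 < k) (hl : 0 < l) :
    webSplit r (x ++ [h]) k l y * webSplit r x h (k + l) y =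
      webSplit r x h k (l :: y) * webSplit r x (h + k) l y := by
  have h := Web.mk_eq_of_rel (WebRel.split_assoc (r := r) x y h k l hh hk hl)
  rwa [map_mul, map_mul] at h

theorem webMerge_mul_webSplit (x y : List ℕ) {k l : ℕ} (hk : 0 < k) (hl : 0 < l) :
    webMerge r x k l y * webSplit r x k l y =
      ((k + l).choose l : ℂ) • webIdent r (x ++ (k + l) :: y) := by
  have h := Web.mk_eq_of_rel (WebRel.digon (r := r) x y k l hk hl)
  rwa [map_mul, map_smul] at h

theorem webDot_mul_webDot (x y : List ℕ) {k : ℕ} (hk : 0 < k) :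
    webDot r x k y * webDot r x k y = (k : ℂ) • webIdent r (x ++ k :: y) := by
  have h := Web.mk_eq_of_rel (WebRel.dot_dot (r := r) x y k hk)
  rwa [map_mul, map_smul] at h

theorem webDot_mul_webMerge (x y : List ℕ) {k : ℕ} (hk : 0 < k) :
    webDot r x (k + 1) y * webMerge r x k 1 y =
      webMerge r x k 1 y * webDot r (x ++ [k]) 1 y + webMerge r x k 1 y * webDot r x k (1 :: y) := by
  have h := Web.mk_eq_of_rel (WebRel.dot_merge_right (r := r) x y k hk)
  rwa [map_mul, map_add, map_mul, map_mul] at h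

theorem webSplit_mul_webDot (x y : List ℕ) {k : ℕ} (hk : 0 < k) :
    webSplit r x k 1 y * webDot r x (k + 1) y =
      webDot r (x ++ [k]) 1 y * webSplit r x k 1 y + webDot r x k (1 :: y) * webSplit r x k 1 y := by
  have h := Web.mk_eq_of_rel (WebRel.split_dot_right (r := r) x y k hk)
  rwa [map_mul, map_add, map_mul, map_mul] at h

theorem webDumbbell_sub (x y : List ℕ) :
    webDumbbell r x y - webDot r x 1 (1 :: y) * webDot r (x ++ [1]) 1 y * webDumbbell r x y *
      (webDot r x 1 (1 :: y) * webDot r (x ++ [1]) 1 y) =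
      (2 : ℂ) • webIdent r (x ++ 1 :: 1 :: y) := by
  have h := Web.mk_eq_of_rel (WebRel.dumbbell (r := r) x y)
  simp only [map_sub, map_mul, map_smul, twoDots] at h
  rw [mul_assoc (_ * _) (Web.mk r (split r x 1 1 y))] at h
  exact h

theorem webMerge_cons_zero (x : List ℕ) {k l : ℕ} (y : List ℕ) (hk : 0 < k) (hl : 0 < l) :
    webMerge r x k l (0 :: y) = webMerge r x k l y := by
  rw [webMerge_eq_webLayer x _ hk hl, webMerge_eq_webLayer x _ hk hl]
  exact webLayer_congr _ rfl (erase_cons_zero y)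

theorem webSplit_cons_zero (x : List ℕ) {k l : ℕ} (y : List ℕ) (hk : 0 < k) (hl : 0 < l) :
    webSplit r x k l (0 :: y) = webSplit r x k l y := by
  rw [webSplit_eq_webLayer x _ hk hl, webSplit_eq_webLayer x _ hk hl]
  exact webLayer_congr _ rfl (erase_cons_zero y)

theorem erase_append_zero (x : List ℕ) : erase (x ++ [0]) = erase x := by simp [erase]

theorem webMerge_append_zero (x : List ℕ) {k l : ℕ} (y : List ℕ) (hk : 0 < k) (hl : 0 < l) :
    webMerge r (x ++ [0]) k l y = webMerge r x k l y := by
  rw [webMerge_eq_webLayer _ y hk hl, webMerge_eq_webLayer x _ hk hl]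
  exact webLayer_congr _ (erase_append_zero x) rfl

theorem webSplit_append_zero (x : List ℕ) {k l : ℕ} (y : List ℕ) (hk : 0 < k) (hl : 0 < l) :
    webSplit r (x ++ [0]) k l y = webSplit r x k l y := by
  rw [webSplit_eq_webLayer _ y hk hl, webSplit_eq_webLayer x _ hk hl]
  exact webLayer_congr _ (erase_append_zero x) rfl

/-- The square switch relation with right label `1`. -/
theorem webSplit_mul_webMerge_one (x y : List ℕ) {k : ℕ} (hk : 0 < k) :
    webSplit r x (k + 1) 1 y * webMerge r x (k + 1) 1 y =
      webMerge r x k 1 (1 :: y) * webDumbbell r (x ++ [k]) y * webSplit r x k 1 (1 :: y) -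
        (k : ℂ) • webIdent r (x ++ (k + 1) :: 1 :: y) := by
  have h := Web.mk_eq_of_rel (WebRel.square (r := r) x y (k + 1) 1 (by omega) one_pos)
  simp only [map_sub, map_mul, map_smul, rungL, rungR, Nat.add_sub_cancel, Nat.sub_self] at h
  change webMerge r x k 1 (1 :: y) * webSplit r (x ++ [k]) 1 1 y *
    (webMerge r (x ++ [k]) 1 1 y * webSplit r x k 1 (1 :: y)) -
    webMerge r (x ++ [k + 1]) 1 0 y * webSplit r x (k + 1) 1 (0 :: y) *
      (webMerge r x (k + 1) 1 (0 :: y) * webSplit r (x ++ [k + 1]) 1 0 y) =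
    _ • webIdent r (x ++ (k + 1) :: 1 :: y) at h
  -- A rung taken from a strand labeled `1` leaves a `0`-strand. The inner merge and split at that
  -- strand become identities, and the ladder degenerates to a split after a merge.
  rw [webMerge_of_eq_zero _ _ _ _ (Or.inr rfl), webSplit_of_eq_zero _ _ _ _ (Or.inr rfl),
    webMerge_cons_zero _ _ (by omega) one_pos, webSplit_cons_zero _ _ (by omega) one_pos,
    List.append_assoc, List.singleton_append, add_zero,
    webIdent_mul_webSplit _ _ (by omega) one_pos,
    webMerge_mul_webIdent _ _ (by omega) one_pos] at h
  rw [show ((k + 1 : ℕ) : ℂ) - ((1 : ℕ) : ℂ) = k by push_cast; ring] at h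
  rw [← h, webDumbbell]
  simp only [mul_assoc]
  abel

/-- The square switch relation with left label `1`. -/
theorem webSplit_mul_webMerge_two (x y : List ℕ) :
    webSplit r x 1 2 y * webMerge r x 1 2 y =
      webMerge r (x ++ [1]) 1 1 y * webDumbbell r x (1 :: y) * webSplit r (x ++ [1]) 1 1 y -
        webIdent r (x ++ 1 :: 2 :: y) := by
  have h := Web.mk_eq_of_rel (WebRel.square (r := r) x y 1 2 one_pos two_pos)
  simp only [map_sub, map_mul, map_smul, rungL, rungR, Nat.add_sub_cancel, Nat.sub_self] at h
  change webMerge r x 0 1 (2 :: y) * webSplit r (x ++ [0]) 1 2 y *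
    (webMerge r (x ++ [0]) 1 2 y * webSplit r x 0 1 (2 :: y)) -
    webMerge r (x ++ [1]) 1 1 y * webSplit r x 1 1 (1 :: y) *
      (webMerge r x 1 1 (1 :: y) * webSplit r (x ++ [1]) 1 1 y) =
    _ • webIdent r (x ++ 1 :: 2 :: y) at h
  -- Now the left strand is the one used up by the rung.
  rw [webMerge_of_eq_zero _ _ _ _ (Or.inl rfl), webSplit_of_eq_zero _ _ _ _ (Or.inl rfl),
    webMerge_append_zero _ _ one_pos two_pos, webSplit_append_zero _ _ one_pos two_pos,
    zero_add, webIdent_mul_webSplit _ _ one_pos two_pos,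
    webMerge_mul_webIdent _ _ one_pos two_pos] at h
  rw [show ((1 : ℕ) : ℂ) - ((2 : ℕ) : ℂ) = -1 by push_cast; ring] at h
  have h' := h.trans (neg_one_smul ℂ (webIdent r (x ++ 1 :: 2 :: y)))
  rw [← neg_eq_iff_eq_neg] at h'
  rw [← h', webDumbbell]
  simp only [mul_assoc]
  abel

end Calculus

/-! ### Crossings and dots -/

section Crossing

/-- In a ring with an idempotent `e`, the crossing `X - e` permutes the dots `a`, `b`. -/
theorem crossing_mul_of_dumbbell {B : Type} [Ring B] [Algebra ℂ B] {e X a b : B}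
    (h1 : X * a + X * b = a * X + b * X) (h2 : X - a * b * X * (a * b) = (2 : ℂ) • e)
    (haa : a * a = e) (hbb : b * b = e) (hab : a * b = -(b * a)) (heX : e * X = X)
    (hXe : X * e = X) (hea : e * a = a) (hae : a * e = a) (heb : e * b = b) (hbe : b * e = b) :
    (X - e) * b = a * (X - e) ∧ (X - e) * a = b * (X - e) := by
  have hba : b * a = -(a * b) := by rw [hab, neg_neg]
  have hee : e * e = e := by
    calc e * e = a * a * e := by rw [haa]
      _ = e := by rw [mul_assoc, hae, haa]
  set S := X - e with hS
  obtain ⟨u, hu⟩ : ∃ u, u = a * b := ⟨_, rfl⟩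
  rw [← hu] at h2
  have huu : u * u = -e := by
    rw [hu, mul_assoc, ← mul_assoc b a, hba, neg_mul, mul_neg, mul_assoc a b b, hbb, hae, haa]
  -- Substituting X = S + e in the dumbbell relation: u e u = −e turns the right-hand side 2 e into
  -- exactly the correction terms.
  have hSu : S = u * S * u := by
    have hueu : u * e * u = -e := by rw [hu, mul_assoc a b e, hbe, ← hu, huu]
    rw [hS, mul_sub, sub_mul, hueu, sub_neg_eq_add, sub_eq_iff_eq_add, ← sub_eq_iff_eq_add']
    have h3 : X - u * X * u = e + e := by rw [h2, two_smul]
    rw [← sub_eq_zero] at h3 ⊢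
    rw [← h3]
    abel
  have heS : e * S = S := by rw [hS, mul_sub, heX, hee]
  have hSe : S * e = S := by rw [hS, sub_mul, hXe, hee]
  have h4 : S * u = -(u * S) := by
    nth_rw 1 [hSu]
    rw [mul_assoc, huu, mul_neg, mul_assoc, hSe]
  have h5 : S * (a + b) = (a + b) * S := by
    rw [hS, sub_mul, mul_sub, mul_add, add_mul, h1, mul_add, add_mul, hea, hae, heb, hbe]
  -- S commutes with `a + b` and anticommutes with `u`, so it anticommutes with their product `b -
  -- a`. Adding and subtracting the two rules determines S a and S b after division by 2.
  have h6 : (a + b) * u = b - a := by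
    rw [add_mul, hu, ← mul_assoc, haa, heb, ← mul_assoc, hba, neg_mul, mul_assoc, hbb, hae,
      sub_eq_add_neg]
  have h7 : S * (b - a) = -((b - a) * S) := by
    rw [← h6, ← mul_assoc, h5, mul_assoc, h4, mul_neg, ← mul_assoc]
  have h8 : S * a + S * b = a * S + b * S := by rw [← mul_add, h5, add_mul]
  have h9 : S * b - S * a = a * S - b * S := by rw [← mul_sub, h7, sub_mul, neg_sub]
  have two : ∀ p q : B, p + p = q + q → p = q := fun p q h => by
    rw [← two_smul ℂ, ← two_smul ℂ] at h
    exact smul_right_injective B (two_ne_zero (α := ℂ)) h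
  constructor
  · apply two
    calc S * b + S * b = (S * a + S * b) + (S * b - S * a) := by abel
      _ = a * S + a * S := by rw [h8, h9]; abel
  · apply two
    calc S * a + S * a = (S * a + S * b) - (S * b - S * a) := by abel
      _ = b * S + b * S := by rw [h8, h9]; abel

variable {r : ℕ}

theorem webDot_anti (x y z : List ℕ) :
    webDot r x 1 (y ++ 1 :: z) * webDot r (x ++ 1 :: y) 1 z =
      -(webDot r (x ++ 1 :: y) 1 z * webDot r x 1 (y ++ 1 :: z)) := by
  have h := webLayer_interchange (r := r) x y z (.dot 1) (.dot 1)
  simp only [Piece.dots, Piece.top, Piece.bot, List.append_assoc, List.singleton_append, mul_one,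
    pow_one] at h
  exact h.trans (neg_one_smul ℂ (webDot r (x ++ 1 :: y) 1 z * webDot r x 1 (y ++ 1 :: z)))

theorem webDot_sq (x y : List ℕ) :
    webDot r x 1 y * webDot r x 1 y = webIdent r (x ++ 1 :: y) := by
  rw [webDot_mul_webDot x y one_pos, Nat.cast_one]
  exact one_smul ℂ _

theorem webDumbbell_sq (x y : List ℕ) :
    webDumbbell r x y * webDumbbell r x y = webDumbbell r x y + webDumbbell r x y := by
  rw [webDumbbell, mul_assoc, ← mul_assoc (webMerge r x 1 1 y),
    webMerge_mul_webSplit x y one_pos one_pos, smul_mul_assoc,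
    webIdent_mul_webMerge x y one_pos one_pos, mul_smul_comm]
  exact two_smul ℂ _

theorem webCrossing_mul_webDot (x y : List ℕ) :
    (webDumbbell r x y - webIdent r (x ++ 1 :: 1 :: y)) * webDot r (x ++ [1]) 1 y =
        webDot r x 1 (1 :: y) * (webDumbbell r x y - webIdent r (x ++ 1 :: 1 :: y)) ∧
      (webDumbbell r x y - webIdent r (x ++ 1 :: 1 :: y)) * webDot r x 1 (1 :: y) =
        webDot r (x ++ [1]) 1 y * (webDumbbell r x y - webIdent r (x ++ 1 :: 1 :: y)) := by
  have hl : x ++ 1 :: 1 :: y = (x ++ [1]) ++ 1 :: y := by simp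
  refine crossing_mul_of_dumbbell ?_ (webDumbbell_sub x y) (webDot_sq _ _)
    (by rw [webDot_sq, hl]) (webDot_anti x [] y) (webIdent_mul_webDumbbell x y)
    (webDumbbell_mul_webIdent x y) (webIdent_mul_webDot _ _ _) (webDot_mul_webIdent _ _ _)
    (by rw [hl, webIdent_mul_webDot]) (by rw [hl, webDot_mul_webIdent])
  -- The sum of the two dots passes through the dumbbell, as a single dot on the 2-strand in the
  -- middle.
  have h1 := webDot_mul_webMerge (r := r) x y one_pos
  have h2 := webSplit_mul_webDot (r := r) x y one_pos
  rw [webDumbbell, add_comm, mul_assoc, mul_assoc, ← mul_add, ← h1, ← mul_assoc, h2, add_mul,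
    add_comm, mul_assoc, mul_assoc]

/-- Both sides are the triple merge followed by the triple split. The square switch replaces the
inner dumbbell between a split and a merge, and (co)associativity identifies the two results. -/
theorem webDumbbell_braid (x y : List ℕ) :
    webDumbbell r x (1 :: y) * webDumbbell r (x ++ [1]) y * webDumbbell r x (1 :: y) -
        webDumbbell r x (1 :: y) =
      webDumbbell r (x ++ [1]) y * webDumbbell r x (1 :: y) * webDumbbell r (x ++ [1]) y -
        webDumbbell r (x ++ [1]) y := by
  have h1 := webSplit_mul_webMerge_one (r := r) x y one_pos
  have h2 := webSplit_mul_webMerge_two (r := r) x y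
  rw [Nat.cast_one] at h1
  replace h1 := h1.trans (congrArg _ (one_smul ℂ _))
  have i1 : webIdent r (x ++ 2 :: 1 :: y) * webMerge r x 1 1 (1 :: y) = webMerge r x 1 1 (1 :: y) :=
    webIdent_mul_webMerge x (1 :: y) one_pos one_pos
  have i2 : webIdent r (x ++ 1 :: 2 :: y) * webMerge r (x ++ [1]) 1 1 y =
      webMerge r (x ++ [1]) 1 1 y := by
    have := webIdent_mul_webMerge (r := r) (x ++ [1]) y one_pos one_pos
    rwa [List.append_assoc, List.singleton_append] at this
  have a1 : webMerge r x 2 1 y * webMerge r x 1 1 (1 :: y) =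
      webMerge r x 1 2 y * webMerge r (x ++ [1]) 1 1 y :=
    webMerge_assoc x y one_pos one_pos one_pos
  have a2 : webSplit r (x ++ [1]) 1 1 y * webSplit r x 1 2 y =
      webSplit r x 1 1 (1 :: y) * webSplit r x 2 1 y :=
    webSplit_assoc x y one_pos one_pos one_pos
  have e1 : webDumbbell r x (1 :: y) * webDumbbell r (x ++ [1]) y * webDumbbell r x (1 :: y) -
      webDumbbell r x (1 :: y) = webSplit r x 1 1 (1 :: y) *
        (webSplit r x 2 1 y * webMerge r x 2 1 y) * webMerge r x 1 1 (1 :: y) := by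
    rw [h1, mul_sub, sub_mul, mul_assoc _ (webIdent _ _), i1]
    simp only [webDumbbell, mul_assoc]
  have e2 : webDumbbell r (x ++ [1]) y * webDumbbell r x (1 :: y) * webDumbbell r (x ++ [1]) y -
      webDumbbell r (x ++ [1]) y = webSplit r (x ++ [1]) 1 1 y *
        (webSplit r x 1 2 y * webMerge r x 1 2 y) * webMerge r (x ++ [1]) 1 1 y := by
    rw [h2, mul_sub, sub_mul, mul_assoc _ (webIdent _ _), i2]
    simp only [webDumbbell, mul_assoc]
  rw [e1, e2, ← mul_assoc, mul_assoc, a1, ← mul_assoc (webSplit r (x ++ [1]) 1 1 y), a2]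
  simp only [mul_assoc]

/-- The even webs `T x z`, with identity strands `x` and `z` at both sides, have bottom `b` and
top `t` in between, and they exchange heights with elementary webs. -/
structure IsLocal (b t : List ℕ) (T : List ℕ → List ℕ → Web r) : Prop where
  left : ∀ p x y z, webLayer r x p (y ++ t ++ z) * T (x ++ p.bot ++ y) z =
    T (x ++ p.top ++ y) z * webLayer r x p (y ++ b ++ z)
  right : ∀ p x y z, webLayer r (x ++ t ++ y) p z * T x (y ++ p.bot ++ z) =
    T x (y ++ p.top ++ z) * webLayer r (x ++ b ++ y) p z

theorem isLocal_webLayer {q : Piece} (hq : q.dots = 0) :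
    IsLocal q.bot q.top (fun x z => webLayer r x q z) where
  left p x y z := by
    have h := webLayer_interchange (r := r) x y z p q
    rw [hq, mul_zero, pow_zero] at h
    exact h.trans (one_smul ℂ _)
  right p x y z := by
    have h := webLayer_interchange (r := r) x y z q p
    rw [hq, zero_mul, pow_zero] at h
    exact (h.trans (one_smul ℂ _)).symm

theorem isLocal_webIdent (a : List ℕ) : IsLocal a a (fun x z => webIdent r (x ++ a ++ z)) where
  left p x y z := by
    have h1 := webIdent_mul_webLayer (r := r) x p (y ++ a ++ z)
    have h2 := webLayer_mul_webIdent (r := r) x p (y ++ a ++ z)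
    simp only [List.append_assoc] at h1 h2 ⊢
    rw [h1, h2]
  right p x y z := by
    have h1 := webIdent_mul_webLayer (r := r) (x ++ a ++ y) p z
    have h2 := webLayer_mul_webIdent (r := r) (x ++ a ++ y) p z
    simp only [List.append_assoc] at h1 h2 ⊢
    rw [h1, h2]

theorem IsLocal.mul {b t u : List ℕ} {T T' : List ℕ → List ℕ → Web r} (h : IsLocal t u T)
    (h' : IsLocal b t T') : IsLocal b u (fun x z => T x z * T' x z) where
  left p x y z := by rw [← mul_assoc, h.left, mul_assoc, h'.left, mul_assoc]
  right p x y z := by rw [← mul_assoc, h.right, mul_assoc, h'.right, mul_assoc]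

/-- Additional identity strands on either side may be counted as part of the local web. -/
theorem IsLocal.extend {b t : List ℕ} {T : List ℕ → List ℕ → Web r} (h : IsLocal b t T)
    (u v : List ℕ) : IsLocal (u ++ b ++ v) (u ++ t ++ v) (fun x z => T (x ++ u) (v ++ z)) where
  left p x y z := by
    have h1 := h.left p x (y ++ u) (v ++ z)
    simp only [List.append_assoc] at h1 ⊢
    exact h1
  right p x y z := by
    have h1 := h.right p (x ++ u) (v ++ y) z
    simp only [List.append_assoc] at h1 ⊢
    exact h1

theorem isLocal_webMerge {k l : ℕ} (hk : 0 < k) (hl : 0 < l) :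
    IsLocal [k, l] [k + l] (fun x z => webMerge r x k l z) := by
  simp only [webMerge_eq_webLayer _ _ hk hl]
  exact isLocal_webLayer (q := .merge k l) rfl

theorem isLocal_webDumbbell : IsLocal [1, 1] [1, 1] (fun x z => webDumbbell r x z) := by
  simp only [webDumbbell, webSplit_eq_webLayer _ _ one_pos one_pos,
    webMerge_eq_webLayer _ _ one_pos one_pos]
  exact (isLocal_webLayer (q := .split 1 1) rfl).mul (isLocal_webLayer (q := .merge 1 1) rfl)

theorem IsLocal.webDumbbell_left {b t : List ℕ} {T : List ℕ → List ℕ → Web r} (h : IsLocal b t T)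
    (x y z : List ℕ) : webDumbbell r x (y ++ t ++ z) * T (x ++ [1, 1] ++ y) z =
      T (x ++ [1, 1] ++ y) z * webDumbbell r x (y ++ b ++ z) := by
  have h1 := h.left (.merge 1 1) x y z
  have h2 := h.left (.split 1 1) x y z
  simp only [webDumbbell, webSplit_eq_webLayer _ _ one_pos one_pos,
    webMerge_eq_webLayer _ _ one_pos one_pos]
  simp only [Piece.bot, Piece.top] at h1 h2
  rw [mul_assoc, h1, ← mul_assoc, h2, mul_assoc]

theorem IsLocal.webDumbbell_right {b t : List ℕ} {T : List ℕ → List ℕ → Web r} (h : IsLocal b t T)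
    (x y z : List ℕ) : webDumbbell r (x ++ t ++ y) z * T x (y ++ [1, 1] ++ z) =
      T x (y ++ [1, 1] ++ z) * webDumbbell r (x ++ b ++ y) z := by
  have h1 := h.right (.merge 1 1) x y z
  have h2 := h.right (.split 1 1) x y z
  simp only [webDumbbell, webSplit_eq_webLayer _ _ one_pos one_pos,
    webMerge_eq_webLayer _ _ one_pos one_pos]
  simp only [Piece.bot, Piece.top] at h1 h2
  rw [mul_assoc, h1, ← mul_assoc, h2, mul_assoc]

/-! ### The corner -/

theorem omega_eq_webIdent (r : ℕ) : omega r = webIdent r (ones r) := by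
  rw [webIdent, ident_eq (ones_isObj r) (erase_eq_self (ones_isObj r))]
  rfl

theorem ones_append (a b : ℕ) : ones a ++ ones b = ones (a + b) :=
  (List.replicate_add a b 1).symm

theorem ones_append_cons (a b : ℕ) : ones a ++ 1 :: ones b = ones (a + (b + 1)) :=
  ones_append a (b + 1)

theorem crossing_eq (r i : ℕ) :
    crossing r i = webDumbbell r (ones i) (ones (r - (i + 2))) - webIdent r (ones r) := by
  rw [crossing, omega_eq_webIdent, map_mul]
  rfl

theorem strandDot_eq (r j : ℕ) : strandDot r j = webDot r (ones j) 1 (ones (r - (j + 1))) := rfl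

theorem omega_mul_crossing {i : ℕ} (hi : i + 1 < r) : omega r * crossing r i = crossing r i := by
  have h := webIdent_mul_webDumbbell (r := r) (ones i) (ones (r - (i + 2)))
  rw [show ones i ++ 1 :: 1 :: ones (r - (i + 2)) = ones r from
    (ones_append i (r - (i + 2) + 2)).trans (congrArg ones (by omega))] at h
  rw [omega_eq_webIdent, crossing_eq, mul_sub, h, webIdent_mul_webIdent]

theorem crossing_mul_omega {i : ℕ} (hi : i + 1 < r) : crossing r i * omega r = crossing r i := by
  have h := webDumbbell_mul_webIdent (r := r) (ones i) (ones (r - (i + 2)))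
  rw [show ones i ++ 1 :: 1 :: ones (r - (i + 2)) = ones r from
    (ones_append i (r - (i + 2) + 2)).trans (congrArg ones (by omega))] at h
  rw [omega_eq_webIdent, crossing_eq, sub_mul, h, webIdent_mul_webIdent]

theorem omega_mul_strandDot {j : ℕ} (hj : j < r) : omega r * strandDot r j = strandDot r j := by
  have h := webIdent_mul_webDot (r := r) (ones j) 1 (ones (r - (j + 1)))
  rw [show ones j ++ 1 :: ones (r - (j + 1)) = ones r from
    (ones_append j (r - (j + 1) + 1)).trans (congrArg ones (by omega))] at h
  rw [omega_eq_webIdent, strandDot_eq, h]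

theorem strandDot_mul_omega {j : ℕ} (hj : j < r) : strandDot r j * omega r = strandDot r j := by
  have h := webDot_mul_webIdent (r := r) (ones j) 1 (ones (r - (j + 1)))
  rw [show ones j ++ 1 :: ones (r - (j + 1)) = ones r from
    (ones_append j (r - (j + 1) + 1)).trans (congrArg ones (by omega))] at h
  rw [omega_eq_webIdent, strandDot_eq, h]

theorem omega_mul_omega (r : ℕ) : omega r * omega r = omega r := omega_idem r

theorem strandDot_sq {j : ℕ} (hj : j < r) : strandDot r j * strandDot r j = omega r := by
  rw [strandDot_eq, webDot_sq, omega_eq_webIdent, ones_append_cons]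
  congr 2
  omega

theorem strandDot_anti_of_lt {i j : ℕ} (hij : i < j) (hj : j < r) :
    strandDot r i * strandDot r j = -(strandDot r j * strandDot r i) := by
  have h := webDot_anti (r := r) (ones i) (ones (j - (i + 1))) (ones (r - (j + 1)))
  rw [ones_append_cons, ones_append_cons, show j - (i + 1) + (r - (j + 1) + 1) = r - (i + 1) by omega,
    show i + (j - (i + 1) + 1) = j by omega] at h
  exact h

theorem strandDot_anti {i j : ℕ} (hi : i < r) (hj : j < r) (hij : i ≠ j) :
    strandDot r i * strandDot r j = -(strandDot r j * strandDot r i) := by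
  rcases lt_or_gt_of_ne hij with h | h
  · exact strandDot_anti_of_lt h hj
  · rw [strandDot_anti_of_lt h hi, neg_neg]

/-- From X² = 2X with X = S + ω. -/
theorem crossing_sq {i : ℕ} (hi : i + 1 < r) : crossing r i * crossing r i = omega r := by
  have h1 := omega_mul_crossing hi
  have h2 := webDumbbell_sq (r := r) (ones i) (ones (r - (i + 2)))
  have h3 : webDumbbell r (ones i) (ones (r - (i + 2))) = crossing r i + omega r := by
    rw [crossing_eq, omega_eq_webIdent, sub_add_cancel]
  rw [h3, add_mul, mul_add, mul_add, h1, crossing_mul_omega hi, omega_mul_omega] at h2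
  have h4 : crossing r i * crossing r i + (crossing r i + (crossing r i + omega r)) =
      omega r + (crossing r i + (crossing r i + omega r)) := by
    rw [← add_assoc, h2]
    abel
  exact add_right_cancel h4

theorem crossing_mul_strandDot {i : ℕ} (hi : i + 1 < r) :
    crossing r i * strandDot r (i + 1) = strandDot r i * crossing r i ∧
      crossing r i * strandDot r i = strandDot r (i + 1) * crossing r i := by
  have h := webCrossing_mul_webDot (r := r) (ones i) (ones (r - (i + 2)))
  rw [show ones i ++ 1 :: 1 :: ones (r - (i + 2)) = ones r from
    (ones_append i (r - (i + 2) + 2)).trans (congrArg ones (by omega)),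
    show ones i ++ [1] = ones (i + 1) from ones_append i 1,
    show 1 :: ones (r - (i + 2)) = ones (r - (i + 1)) from congrArg ones
      (show r - (i + 2) + 1 = r - (i + 1) by omega), ← crossing_eq] at h
  exact h

/-- Substituting X = S + ω in the dumbbell identity, the lower terms on either side are S₁S₂ + S₂S₁
+ S₁ + S₂ + ω, symmetric in the two crossings. -/
theorem crossing_braid {i : ℕ} (hi : i + 1 + 1 < r) :
    crossing r i * crossing r (i + 1) * crossing r i =
      crossing r (i + 1) * crossing r i * crossing r (i + 1) := by
  have h := webDumbbell_braid (r := r) (ones i) (ones (r - (i + 1 + 2)))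
  have h3 : ∀ j, webDumbbell r (ones j) (ones (r - (j + 2))) = crossing r j + omega r := fun j => by
    rw [crossing_eq, omega_eq_webIdent, sub_add_cancel]
  have hs1 := crossing_sq (r := r) (i := i) (by omega)
  have hs2 := crossing_sq (r := r) (i := i + 1) (by omega)
  have ho := omega_mul_omega r
  have h11 := omega_mul_crossing (r := r) (i := i) (by omega)
  have h12 := omega_mul_crossing (r := r) (i := i + 1) (by omega)
  have h21 := crossing_mul_omega (r := r) (i := i) (by omega)
  have h22 := crossing_mul_omega (r := r) (i := i + 1) (by omega)
  rw [show ones i ++ [1] = ones (i + 1) from ones_append i 1,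
    show 1 :: ones (r - (i + 1 + 2)) = ones (r - (i + 2)) from congrArg ones
      (show r - (i + 1 + 2) + 1 = r - (i + 2) by omega), h3, h3] at h
  simp only [mul_add, add_mul, mul_assoc, h11, h12, h21, h22, ho, hs1, hs2] at h ⊢
  rw [← sub_eq_zero] at h ⊢
  rw [← h]
  abel

theorem crossing_comm_of_lt {i j : ℕ} (hij : i + 1 < j) (hj : j + 1 < r) :
    crossing r i * crossing r j = crossing r j * crossing r i := by
  have h := isLocal_webDumbbell.webDumbbell_left (r := r) (ones i) (ones (j - (i + 2)))
    (ones (r - (j + 2)))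
  rw [show ones i ++ [1, 1] ++ ones (j - (i + 2)) = ones j from
    (congrArg (· ++ _) (ones_append i 2)).trans ((ones_append _ _).trans (congrArg ones (by omega))),
    show ones (j - (i + 2)) ++ [1, 1] ++ ones (r - (j + 2)) = ones (r - (i + 2)) from
    (congrArg (· ++ _) (ones_append _ 2)).trans
      ((ones_append _ _).trans (congrArg ones (by omega)))] at h
  have h3 : ∀ j, webDumbbell r (ones j) (ones (r - (j + 2))) = crossing r j + omega r := fun j => by
    rw [crossing_eq, omega_eq_webIdent, sub_add_cancel]
  rw [h3, h3, add_mul, mul_add, mul_add, add_mul, mul_add, mul_add,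
    omega_mul_crossing (i := i) (by omega), omega_mul_crossing (i := j) (by omega),
    crossing_mul_omega (i := i) (by omega), crossing_mul_omega (i := j) (by omega)] at h
  rw [← sub_eq_zero] at h ⊢
  rw [← h]
  abel

theorem strandDot_comm_crossing {i j : ℕ} (hi : i + 1 < r) (hj : j < r) (h₁ : j ≠ i)
    (h₂ : j ≠ i + 1) : strandDot r j * crossing r i = crossing r i * strandDot r j := by
  suffices h : webDot r (ones j) 1 (ones (r - (j + 1))) *
      webDumbbell r (ones i) (ones (r - (i + 2))) =
      webDumbbell r (ones i) (ones (r - (i + 2))) * webDot r (ones j) 1 (ones (r - (j + 1))) by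
    rw [crossing_eq, mul_sub, sub_mul, ← omega_eq_webIdent, omega_mul_strandDot hj,
      strandDot_mul_omega hj, strandDot_eq, h]
  rcases lt_or_gt_of_ne h₁ with h | h
  · have h := isLocal_webDumbbell.left (r := r) (.dot 1) (ones j) (ones (i - (j + 1)))
      (ones (r - (i + 2)))
    rw [show ones j ++ (Piece.dot 1).bot ++ ones (i - (j + 1)) = ones i from
      (congrArg (· ++ _) (ones_append _ 1)).trans
        ((ones_append _ _).trans (congrArg ones (by omega))),
      show ones j ++ (Piece.dot 1).top ++ ones (i - (j + 1)) = ones i from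
      (congrArg (· ++ _) (ones_append _ 1)).trans
        ((ones_append _ _).trans (congrArg ones (by omega))),
      show ones (i - (j + 1)) ++ [1, 1] ++ ones (r - (i + 2)) = ones (r - (j + 1)) from
      (congrArg (· ++ _) (ones_append _ 2)).trans
        ((ones_append _ _).trans (congrArg ones (by omega)))] at h
    exact h
  · have h := isLocal_webDumbbell.right (r := r) (.dot 1) (ones i) (ones (j - (i + 2)))
      (ones (r - (j + 1)))
    rw [show ones (j - (i + 2)) ++ (Piece.dot 1).bot ++ ones (r - (j + 1)) = ones (r - (i + 2)) from
      (congrArg (· ++ _) (ones_append _ 1)).trans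
        ((ones_append _ _).trans (congrArg ones (by omega))),
      show ones (j - (i + 2)) ++ (Piece.dot 1).top ++ ones (r - (j + 1)) = ones (r - (i + 2)) from
      (congrArg (· ++ _) (ones_append _ 1)).trans
        ((ones_append _ _).trans (congrArg ones (by omega))),
      show ones i ++ [1, 1] ++ ones (j - (i + 2)) = ones j from
      (congrArg (· ++ _) (ones_append _ 2)).trans
        ((ones_append _ _).trans (congrArg ones (by omega)))] at h
    exact h

end Crossing

/-! ### Multiplicativity of the parity decomposition -/

section Parity

variable {X : Type} {par : X → ZMod 2} {rel : FreeAlgebra ℂ X → FreeAlgebra ℂ X → Prop}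

theorem one_mem_parityPart : (1 : RingQuot rel) ∈ parityPart par rel 0 :=
  Submodule.subset_span ⟨[], by simp, by simp⟩

theorem mkAlgHom_ι_mem_parityPart (g : X) :
    RingQuot.mkAlgHom ℂ rel (FreeAlgebra.ι ℂ g) ∈ parityPart par rel (par g) :=
  Submodule.subset_span ⟨[g], by simp, by simp⟩

theorem mul_mem_parityPart {p q : ZMod 2} {u v : RingQuot rel} (hu : u ∈ parityPart par rel p)
    (hv : v ∈ parityPart par rel q) : u * v ∈ parityPart par rel (p + q) := by
  have h := Submodule.mul_mem_mul hu hv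
  rw [parityPart, parityPart, Submodule.span_mul_span] at h
  refine Submodule.span_mono ?_ h
  rintro _ ⟨_, ⟨l, hl, rfl⟩, _, ⟨l', hl', rfl⟩, rfl⟩
  exact ⟨l ++ l', by simp [hl, hl'], by simp⟩

theorem adjoin_le_parityPart {S : Set (RingQuot rel)} (hS : ∀ u ∈ S, u ∈ parityPart par rel 0)
    {u : RingQuot rel} (hu : u ∈ Algebra.adjoin ℂ S) : u ∈ parityPart par rel 0 := by
  induction hu using Algebra.adjoin_induction with
  | mem u hu => exact hS u hu
  | algebraMap z =>
    rw [Algebra.algebraMap_eq_smul_one]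
    exact Submodule.smul_mem _ _ one_mem_parityPart
  | add u v _ _ hu hv => exact Submodule.add_mem _ hu hv
  | mul u v _ _ hu hv => simpa using mul_mem_parityPart hu hv

end Parity

/-! ### The homomorphism from the Sergeev superalgebra -/

section Hom

variable (r : ℕ)

/-- The element `s` of the Sergeev superalgebra, zero out of range. -/
def sergeevS (i : ℕ) : Sergeev r := if h : i + 1 < r then Sergeev.s i h else 0

/-- The element `c` of the Sergeev superalgebra, zero out of range. -/
def sergeevC (j : ℕ) : Sergeev r := if h : j < r then Sergeev.c j h else 0

variable {r}

theorem sergeevS_eq {i : ℕ} (h : i + 1 < r) : sergeevS r i = Sergeev.s i h := dif_pos h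

theorem sergeevC_eq {j : ℕ} (h : j < r) : sergeevC r j = Sergeev.c j h := dif_pos h

variable (r) in
theorem sergeevFamily : SergeevFamily r (sergeevS r) (sergeevC r) where
  c_sq i hi := by
    have h := RingQuot.mkAlgHom_rel ℂ (SergeevRel.c_sq i hi)
    rw [map_mul, map_one] at h
    rw [sergeevC_eq hi]
    exact h
  c_anti i hi j hj hij := by
    have h := RingQuot.mkAlgHom_rel ℂ (SergeevRel.c_anti i j hi hj hij)
    rw [map_neg, map_mul, map_mul] at h
    rw [sergeevC_eq hi, sergeevC_eq hj]
    exact h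
  s_sq i hi := by
    have h := RingQuot.mkAlgHom_rel ℂ (SergeevRel.s_sq i hi)
    rw [map_mul, map_one] at h
    rw [sergeevS_eq hi]
    exact h
  braid i hi := by
    have h := RingQuot.mkAlgHom_rel ℂ (SergeevRel.braid i (by omega) hi)
    simp only [map_mul] at h
    rw [sergeevS_eq hi, sergeevS_eq (i := i) (by omega)]
    exact h
  s_comm i j hi hj h₁ h₂ := by
    have h := RingQuot.mkAlgHom_rel ℂ (SergeevRel.s_comm i j hi hj h₁ h₂)
    simp only [map_mul] at h
    rw [sergeevS_eq hi, sergeevS_eq hj]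
    exact h
  c_s i hi := by
    have h := RingQuot.mkAlgHom_rel ℂ (SergeevRel.c_s i hi (by omega))
    simp only [map_mul] at h
    rw [sergeevS_eq hi, sergeevC_eq hi, sergeevC_eq (j := i) (by omega)]
    exact h
  c_succ_s i hi := by
    have h := RingQuot.mkAlgHom_rel ℂ (SergeevRel.c_succ_s i hi (by omega))
    simp only [map_mul] at h
    rw [sergeevS_eq hi, sergeevC_eq hi, sergeevC_eq (j := i) (by omega)]
    exact h
  c_s_far i j hi hj h₁ h₂ := by
    have h := RingQuot.mkAlgHom_rel ℂ (SergeevRel.c_s_far i j hi hj h₁ h₂)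
    simp only [map_mul] at h
    rw [sergeevS_eq hi, sergeevC_eq hj]
    exact h

/-- The webs of the generators of the Sergeev superalgebra. -/
def SergeevGen.web : SergeevGen r → OmegaWeb r
  | .s i hi => ⟨crossing r i, (Subsemigroup.mem_corner_iff (omega_idem r)).2
      ⟨omega_mul_crossing hi, crossing_mul_omega hi⟩⟩
  | .c j hj => ⟨strandDot r j, (Subsemigroup.mem_corner_iff (omega_idem r)).2
      ⟨omega_mul_strandDot hj, strandDot_mul_omega hj⟩⟩

theorem lift_web_rel {u v : FreeAlgebra ℂ (SergeevGen r)} (h : SergeevRel r u v) :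
    FreeAlgebra.lift ℂ (SergeevGen.web (r := r)) u =
      FreeAlgebra.lift ℂ (SergeevGen.web (r := r)) v := by
  cases h with
  | c_sq i hi =>
    simp only [map_mul, map_one, fc, FreeAlgebra.lift_ι_apply]
    exact Subtype.ext (strandDot_sq hi)
  | c_anti i j hi hj hij =>
    simp only [map_mul, map_neg, fc, FreeAlgebra.lift_ι_apply]
    exact Subtype.ext (strandDot_anti hi hj hij)
  | s_sq i hi =>
    simp only [map_mul, map_one, fs, FreeAlgebra.lift_ι_apply]
    exact Subtype.ext (crossing_sq hi)
  | braid i hi hi' =>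
    simp only [map_mul, fs, FreeAlgebra.lift_ι_apply]
    exact Subtype.ext (crossing_braid hi')
  | s_comm i j hi hj h₁ h₂ =>
    simp only [map_mul, fs, FreeAlgebra.lift_ι_apply]
    refine Subtype.ext ?_
    change crossing r i * crossing r j = crossing r j * crossing r i
    -- The Coxeter commutation relation is also imposed for equal indices, where it is trivial.
    rcases lt_trichotomy i j with h | rfl | h
    · exact crossing_comm_of_lt (by omega) hj
    · rfl
    · exact (crossing_comm_of_lt (by omega) hi).symm
  | c_s i hi hi' =>
    simp only [map_mul, fs, fc, FreeAlgebra.lift_ι_apply]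
    exact Subtype.ext (crossing_mul_strandDot hi).1.symm
  | c_succ_s i hi hi' =>
    simp only [map_mul, fs, fc, FreeAlgebra.lift_ι_apply]
    exact Subtype.ext (crossing_mul_strandDot hi).2.symm
  | c_s_far i j hi hj h₁ h₂ =>
    simp only [map_mul, fs, fc, FreeAlgebra.lift_ι_apply]
    exact Subtype.ext (strandDot_comm_crossing hi hj h₁ h₂)

variable (r) in
/-- The homomorphism from the Sergeev superalgebra to the webs on `r` 1-strands. -/
def sergeevHom : Sergeev r →ₐ[ℂ] OmegaWeb r :=
  RingQuot.liftAlgHom ℂ ⟨FreeAlgebra.lift ℂ SergeevGen.web, fun _ _ h => lift_web_rel h⟩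

theorem sergeevHom_ι (g : SergeevGen r) :
    sergeevHom r (RingQuot.mkAlgHom ℂ (SergeevRel r) (FreeAlgebra.ι ℂ g)) = g.web := by
  rw [sergeevHom, RingQuot.liftAlgHom_mkAlgHom_apply, FreeAlgebra.lift_ι_apply]

theorem sergeevHom_s {i : ℕ} (hi : i + 1 < r) :
    (sergeevHom r (Sergeev.s i hi)).1 = crossing r i :=
  congrArg Subtype.val (sergeevHom_ι (.s i hi))

theorem sergeevHom_c {j : ℕ} (hj : j < r) : (sergeevHom r (Sergeev.c j hj)).1 = strandDot r j :=
  congrArg Subtype.val (sergeevHom_ι (.c j hj))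

theorem Sergeev.induction {P : Sergeev r → Prop} (scalar : ∀ z : ℂ, P (algebraMap ℂ _ z))
    (s : ∀ i hi, P (Sergeev.s i hi)) (c : ∀ j hj, P (Sergeev.c j hj))
    (mul : ∀ u v, P u → P v → P (u * v)) (add : ∀ u v, P u → P v → P (u + v)) (u : Sergeev r) :
    P u := by
  obtain ⟨u, rfl⟩ := RingQuot.mkAlgHom_surjective ℂ (SergeevRel r) u
  induction u using FreeAlgebra.induction with
  | grade0 z => rw [AlgHom.commutes]; exact scalar z
  | grade1 g => cases g with
    | s i hi => exact s i hi
    | c j hj => exact c j hj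
  | mul u v hu hv => rw [map_mul]; exact mul _ _ hu hv
  | add u v hu hv => rw [map_add]; exact add _ _ hu hv

end Hom

/-! ### The inverse homomorphism -/

section Inverse

section General

variable {A : Type} [Ring A] [Algebra ℂ A] {r : ℕ} {s c : ℕ → A} (H : SergeevFamily r s c)

/-- The representation of the web superalgebra. -/
def SergeevFamily.webHom : Web r →ₐ[ℂ] H.youngProj_idem.Corner :=
  RingQuot.liftAlgHom ℂ ⟨H.freeOp, fun _ _ h => Subtype.ext (H.rep_rel h)⟩

/-- The operator of an element of the web superalgebra. -/
def SergeevFamily.webRep (w : Web r) : Module.End ℂ (List ℕ → A) := (H.webHom w).1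

theorem SergeevFamily.webRep_mk (w : FreeWeb r) : H.webRep (Web.mk r w) = H.rep w := by
  have h : H.webHom (RingQuot.mkAlgHom ℂ (WebRel r) w) = H.freeOp w :=
    RingQuot.liftAlgHom_mkAlgHom_apply ..
  exact congrArg Subtype.val h

theorem SergeevFamily.webRep_mul (v w : Web r) : H.webRep (v * w) = H.webRep v * H.webRep w :=
  congrArg Subtype.val (map_mul H.webHom v w)

theorem SergeevFamily.webRep_add (v w : Web r) : H.webRep (v + w) = H.webRep v + H.webRep w :=
  congrArg Subtype.val (map_add H.webHom v w)

theorem SergeevFamily.webRep_sub (v w : Web r) : H.webRep (v - w) = H.webRep v - H.webRep w :=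
  congrArg Subtype.val (map_sub H.webHom v w)

theorem SergeevFamily.webRep_smul (z : ℂ) (w : Web r) : H.webRep (z • w) = z • H.webRep w :=
  congrArg Subtype.val (map_smul H.webHom z w)

theorem SergeevFamily.webRep_zero : H.webRep 0 = 0 :=
  congrArg Subtype.val (map_zero H.webHom)

theorem webUnit_ones (u : A) : webUnit r (ones r) (ones r) u = matUnit (ones r) (ones r) u := by
  rw [webUnit, if_pos (ones_isObj r).2, erase_eq_self (ones_isObj r)]

theorem SergeevFamily.webRep_omega : H.webRep (omega r) = matUnit (ones r) (ones r) 1 := by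
  rw [omega_eq_webIdent, webIdent, H.webRep_mk, H.rep_ident, youngSymm_ones, webUnit_ones]

theorem SergeevFamily.webRep_strandDot {j : ℕ} (hj : j < r) :
    H.webRep (strandDot r j) = matUnit (ones r) (ones r) (c j) := by
  have h1 : ones j ++ 1 :: ones (r - (j + 1)) = ones r :=
    (ones_append j (r - (j + 1) + 1)).trans (congrArg ones (by omega))
  rw [strandDot_eq, webDot, H.webRep_mk, H.rep_dot, h1, youngSymm_ones, mul_one, webUnit_ones,
    (ones_isObj j).2, dotSum_one]

/-- Split after merge has entry twice the symmetrizer of two strands, which is 1 + s_i; subtracting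
the identity leaves s_i. -/
theorem SergeevFamily.webRep_crossing {i : ℕ} (hi : i + 1 < r) :
    H.webRep (crossing r i) = matUnit (ones r) (ones r) (s i) := by
  have h1 : ones i ++ 1 :: 1 :: ones (r - (i + 2)) = ones r :=
    (ones_append i (r - (i + 2) + 2)).trans (congrArg ones (by omega))
  have hsum : (ones i ++ (0 + 2) :: ones (r - (i + 2))).sum = r := by
    rw [List.sum_append, List.sum_cons, (ones_isObj _).2, (ones_isObj _).2]
    omega
  have hone := H.isSymmetrizer (p := 0) (a := ones r) (by simp [(ones_isObj r).2])
  have h2 := H.smul_mid_right (x := ones i) (y := ones (r - (i + 2))) (k := 0) (z := 1) (w := 1)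
    hsum.le (fun j hj => by
      rw [zero_add, h1] at hj
      rw [← youngSymm_ones s 0 r]
      exact hone.right j hj) (fun j hj => by
      rw [zero_add, h1] at hj
      rw [← youngSymm_ones s 0 r]
      exact hone.left j hj)
  have h3 : ones i ++ (1 + 1) :: ones (r - (i + 2)) = ones i ++ (0 + 2) :: ones (r - (i + 2)) := rfl
  rw [crossing, H.webRep_sub, H.webRep_omega, H.webRep_mk, H.rep_mul, H.rep_split,
    H.rep_merge, h1, h3, webUnit_mul _ _ rfl (hsum.trans (ones_isObj r).2.symm), webUnit_ones,
    ← map_sub, mul_smul_comm, H.youngSymm_idem hsum.le]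
  congr 1
  simp only [mul_one, one_mul, (ones_isObj i).2] at h2
  norm_num at h2 ⊢
  rw [h2]
  abel

end General

variable {r : ℕ}

theorem webRep_sergeevHom (u : Sergeev r) :
    (sergeevFamily r).webRep (sergeevHom r u).1 = matUnit (ones r) (ones r) u := by
  induction u using Sergeev.induction with
  | scalar z =>
    have h : (sergeevHom r (algebraMap ℂ _ z)).1 = z • omega r :=
      congrArg Subtype.val ((sergeevHom r).commutes z)
    rw [h, SergeevFamily.webRep_smul, SergeevFamily.webRep_omega, Algebra.algebraMap_eq_smul_one,
      LinearMap.map_smul]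
  | s i hi => rw [sergeevHom_s, SergeevFamily.webRep_crossing _ hi, sergeevS_eq hi]
  | c j hj => rw [sergeevHom_c, SergeevFamily.webRep_strandDot _ hj, sergeevC_eq hj]
  | mul u v hu hv =>
    have h : (sergeevHom r (u * v)).1 = (sergeevHom r u).1 * (sergeevHom r v).1 :=
      congrArg Subtype.val (map_mul (sergeevHom r) u v)
    rw [h, SergeevFamily.webRep_mul, hu, hv, matUnit_mul]
  | add u v hu hv =>
    have h : (sergeevHom r (u + v)).1 = (sergeevHom r u).1 + (sergeevHom r v).1 :=
      congrArg Subtype.val (map_add (sergeevHom r) u v)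
    rw [h, SergeevFamily.webRep_add, hu, hv, LinearMap.map_add]

/-- A left inverse: the operator is evaluated at the indicator function of (1,…,1), and the value at
(1,…,1) is read off. -/
theorem webRep_sergeevHom_apply (u : Sergeev r) :
    (sergeevFamily r).webRep (sergeevHom r u).1 (Pi.single (ones r) 1) (ones r) = u := by
  rw [webRep_sergeevHom, matUnit_apply, Pi.single_eq_same, Pi.single_eq_same, mul_one]

theorem sergeevHom_injective : Function.Injective (sergeevHom r) := fun u v h => by
  rw [← webRep_sergeevHom_apply u, h, webRep_sergeevHom_apply]

/-! ### Compatibility of the isomorphism with parity -/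

theorem youngSymm_mem_part {a : List ℕ} (ha : a.sum = r) :
    youngSymm (sergeevS r) 0 a ∈ Sergeev.part r 0 := by
  refine adjoin_le_parityPart ?_
    ((sergeevFamily r).isSymmetrizer (p := 0) (a := a) (by omega)).mem
  rintro _ ⟨i, -, rfl⟩
  rw [sergeevS]
  split_ifs with h
  · exact mkAlgHom_ι_mem_parityPart (par := SergeevGen.parity) (SergeevGen.s i h)
  · exact Submodule.zero_mem _

theorem dotSum_mem_part (p k : ℕ) : dotSum (sergeevC r) p k ∈ Sergeev.part r 1 := by
  refine Submodule.sum_mem _ fun j _ => ?_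
  rw [sergeevC]
  split_ifs with h
  · exact mkAlgHom_ι_mem_parityPart (par := SergeevGen.parity) (SergeevGen.c (p + j) h)
  · exact Submodule.zero_mem _

theorem entry_mem_part (g : WebGen r) :
    g.entry (sergeevS r) (sergeevC r) ∈ Sergeev.part r g.parity := by
  have h : g.coeff (sergeevC r) ∈ Sergeev.part r g.parity := by
    cases g with
    | ident a ha => exact one_mem_parityPart
    | layer x p y hb ht =>
      cases p with
      | merge k l =>
        rw [WebGen.parity, Piece.dots, Nat.cast_zero]
        exact Submodule.smul_mem _ _ one_mem_parityPart
      | split k l =>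
        rw [WebGen.parity, Piece.dots, Nat.cast_zero]
        exact one_mem_parityPart
      | dot k =>
        rw [WebGen.parity, Piece.dots, Nat.cast_one]
        exact dotSum_mem_part _ k
  have h1 := mul_mem_parityPart (mul_mem_parityPart (youngSymm_mem_part g.top_isObj.2) h)
    (youngSymm_mem_part g.bot_isObj.2)
  rwa [zero_add, add_zero] at h1

/-- Symmetrizers are even and each dot contributes an odd coefficient, so a word in the generating
webs shifts the parity of values by its own parity. -/
theorem webRep_apply_mem_part {p q : ZMod 2} {w : Web r} (hw : w ∈ Web.part r p)
    {f : List ℕ → Sergeev r} (hf : ∀ a, f a ∈ Sergeev.part r q) (a : List ℕ) :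
    (sergeevFamily r).webRep w f a ∈ Sergeev.part r (p + q) := by
  induction hw using Submodule.span_induction with
  | mem w hw =>
    obtain ⟨l, rfl, rfl⟩ := hw
    change (sergeevFamily r).webRep (Web.mk r _) f a ∈ _
    rw [SergeevFamily.webRep_mk]
    induction l generalizing a with
    | nil =>
      rw [List.map_nil, List.map_nil, List.sum_nil, List.prod_nil, SergeevFamily.rep_one, youngProj_apply]
      split_ifs with ha
      · exact mul_mem_parityPart (youngSymm_mem_part ha.2) (hf a)
      · exact Submodule.zero_mem _
    | cons g l ih =>
      rw [List.map_cons, List.map_cons, List.prod_cons, List.sum_cons, SergeevFamily.rep_mul,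
        SergeevFamily.rep_ι, Module.End.mul_apply, matUnit_apply, Pi.single_apply]
      split_ifs with ha
      · rw [add_assoc]
        exact mul_mem_parityPart (entry_mem_part g) (ih _)
      · exact Submodule.zero_mem _
  | zero =>
    rw [SergeevFamily.webRep_zero]
    exact Submodule.zero_mem _
  | add v w _ _ hv hw =>
    rw [SergeevFamily.webRep_add]
    exact Submodule.add_mem _ hv hw
  | smul z w _ hw =>
    rw [SergeevFamily.webRep_smul]
    exact Submodule.smul_mem _ _ hw

theorem mk_ι_mem_part (g : WebGen r) : Web.mk r (FreeAlgebra.ι ℂ g) ∈ Web.part r g.parity :=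
  mkAlgHom_ι_mem_parityPart g

theorem mul_mem_part {p q : ZMod 2} {v w : Web r} (hv : v ∈ Web.part r p)
    (hw : w ∈ Web.part r q) : v * w ∈ Web.part r (p + q) :=
  mul_mem_parityPart hv hw

theorem omega_mem_part : omega r ∈ Web.part r 0 := mk_ι_mem_part (.ident (ones r) (ones_isObj r))

theorem layer_mem_part (x : List ℕ) (p : Piece) (y : List ℕ) :
    webLayer r x p y ∈ Web.part r p.dots := by
  rw [webLayer, layer]
  split_ifs with h
  · exact mk_ι_mem_part (.layer (erase x) p (erase y) h.1 h.2)
  · rw [map_zero]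
    exact Submodule.zero_mem _

theorem crossing_mem_part (i : ℕ) : crossing r i ∈ Web.part r 0 := by
  rw [crossing_eq, ← omega_eq_webIdent, webDumbbell, webSplit_eq_webLayer _ _ one_pos one_pos,
    webMerge_eq_webLayer _ _ one_pos one_pos]
  refine Submodule.sub_mem _ ?_ omega_mem_part
  have h := mul_mem_part
    (layer_mem_part (r := r) (ones i) (.split 1 1) (ones (r - (i + 2))))
    (layer_mem_part (r := r) (ones i) (.merge 1 1) (ones (r - (i + 2))))
  rw [Piece.dots, Piece.dots, Nat.cast_zero, add_zero] at h
  exact h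

theorem strandDot_mem_part (j : ℕ) : strandDot r j ∈ Web.part r 1 := by
  have h := layer_mem_part (r := r) (ones j) (.dot 1) (ones (r - (j + 1)))
  rw [Piece.dots, Nat.cast_one] at h
  exact h

theorem SergeevGen.web_mem_part (g : SergeevGen r) : g.web.1 ∈ Web.part r g.parity := by
  cases g with
  | s i hi => exact crossing_mem_part i
  | c j hj => exact strandDot_mem_part j

theorem sergeevHom_mem_part {p : ZMod 2} {u : Sergeev r} (hu : u ∈ Sergeev.part r p) :
    (sergeevHom r u).1 ∈ Web.part r p := by
  induction hu using Submodule.span_induction with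
  | mem u hu =>
    obtain ⟨l, rfl, rfl⟩ := hu
    induction l with
    | nil =>
      have h : (sergeevHom r 1).1 = omega r := congrArg Subtype.val (map_one (sergeevHom r))
      rw [List.map_nil, List.map_nil, List.prod_nil, map_one, h, List.sum_nil]
      exact omega_mem_part
    | cons g l ih =>
      rw [List.map_cons, List.map_cons, List.prod_cons, List.sum_cons, map_mul, map_mul,
        sergeevHom_ι]
      exact mul_mem_part g.web_mem_part ih
  | zero =>
    rw [map_zero]
    exact Submodule.zero_mem _
  | add v w _ _ hv hw =>
    rw [map_add]
    exact Submodule.add_mem _ hv hw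
  | smul z w _ hw =>
    rw [map_smul]
    exact Submodule.smul_mem _ _ hw

theorem sergeevHom_mem_part_iff (p : ZMod 2) (u : Sergeev r) :
    (sergeevHom r u).1 ∈ Web.part r p ↔ u ∈ Sergeev.part r p := by
  refine ⟨fun h => ?_, sergeevHom_mem_part⟩
  -- The test function of the left inverse has even values, so the parity of the recovered element
  -- is that of its web.
  have h1 := webRep_apply_mem_part (q := 0) h (f := Pi.single (ones r) 1) (fun a => by
    rw [Pi.single_apply]
    split_ifs
    · exact one_mem_parityPart
    · exact Submodule.zero_mem _) (ones r)
  rwa [webRep_sergeevHom_apply, add_zero] at h1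

end Inverse

/-! ### Explosion of strands -/

section Explode

variable {r : ℕ}

theorem ones_succ_append (n : ℕ) (v : List ℕ) : ones (n + 1) ++ v = ones n ++ 1 :: v := by
  rw [ones, ones, List.replicate_succ', List.append_assoc, List.singleton_append]

/-- The web merging `k + 1` 1-strands one after the other. -/
def explode (r : ℕ) (x : List ℕ) : ℕ → List ℕ → Web r
  | 0, z => webIdent r (x ++ 1 :: z)
  | k + 1, z => webMerge r x (k + 1) 1 z * explode r x k (1 :: z)

theorem webIdent_mul_explode (x : List ℕ) (k : ℕ) (z : List ℕ) :
    webIdent r (x ++ (k + 1) :: z) * explode r x k z = explode r x k z := by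
  cases k with
  | zero => exact webIdent_mul_webIdent _
  | succ k => rw [explode, ← mul_assoc, webIdent_mul_webMerge x z k.succ_pos one_pos]

theorem explode_mul_webIdent (x : List ℕ) (k : ℕ) (z : List ℕ) :
    explode r x k z * webIdent r (x ++ ones (k + 1) ++ z) = explode r x k z := by
  induction k generalizing z with
  | zero =>
    rw [List.append_assoc]
    exact webIdent_mul_webIdent _
  | succ k ih => rw [explode, mul_assoc, List.append_assoc, ones_succ_append, ← List.append_assoc, ih]

theorem isLocal_explode (k : ℕ) : IsLocal (ones (k + 1)) [k + 1] (fun x z => explode r x k z) := by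
  induction k with
  | zero =>
    have h := isLocal_webIdent (r := r) [1]
    simp only [List.append_assoc] at h
    exact h
  | succ k ih =>
    have h := (isLocal_webMerge (r := r) k.succ_pos one_pos).mul (ih.extend [] [1])
    simp only [List.append_nil, List.nil_append, List.singleton_append] at h
    rwa [show ones (k + 1) ++ [1] = ones (k + 1 + 1) from ones_append (k + 1) 1] at h

/-- An explosion is a tower of merges, each of which exchanges heights with a local web. At the
bottom of the tower is an identity web, whence the hypotheses that `T` absorbs identities. -/
theorem IsLocal.explode_right {b t : List ℕ} {T : List ℕ → List ℕ → Web r} (h : IsLocal b t T)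
    (hl : ∀ x z, webIdent r (x ++ t ++ z) * T x z = T x z)
    (hr : ∀ x z, T x z * webIdent r (x ++ b ++ z) = T x z) (x y : List ℕ) (k : ℕ) (z : List ℕ) :
    explode r (x ++ t ++ y) k z * T x (y ++ ones (k + 1) ++ z) =
      T x (y ++ (k + 1) :: z) * explode r (x ++ b ++ y) k z := by
  induction k generalizing z with
  | zero =>
    have h1 := hl x (y ++ 1 :: z)
    have h2 := hr x (y ++ 1 :: z)
    simp only [explode, List.append_assoc] at h1 h2 ⊢
    rw [h2]
    exact h1
  | succ k ih =>
    have h1 := h.right (.merge (k + 1) 1) x y z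
    simp only [Piece.bot, Piece.top, ← webMerge_eq_webLayer _ _ k.succ_pos one_pos,
      List.append_assoc, List.cons_append, List.nil_append] at h1
    have h2 := ih (1 :: z)
    simp only [explode, List.append_assoc, ones_succ_append (k + 1)] at h1 h2 ⊢
    rw [mul_assoc, h2, ← mul_assoc, h1, mul_assoc]

/-- Associativity moves the 1-strands of the right leg one at a time onto the left leg. -/
theorem webMerge_mul_explode (u : List ℕ) (k l : ℕ) (v : List ℕ) :
    webMerge r u (k + 1) (l + 1) v * (explode r (u ++ [k + 1]) l v *
      explode r u k (ones (l + 1) ++ v)) = explode r u (k + l + 1) v := by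
  induction l generalizing v with
  | zero =>
    have h := webIdent_mul_explode (r := r) u k (1 :: v)
    rw [explode, List.append_assoc, List.singleton_append]
    exact congrArg (webMerge r u (k + 1) 1 v * ·) h
  | succ l ih =>
    have h := webMerge_assoc (r := r) u v k.succ_pos l.succ_pos one_pos
    rw [explode, mul_assoc, ← mul_assoc, ← h, mul_assoc, ones_succ_append, ih (1 :: v),
      show k.succ + l.succ = k + l + 1 + 1 by omega]
    rfl

/-- The webs merging 1-strands into strands labeled `a`. -/
def explodeAll (r : ℕ) (x : List ℕ) : List ℕ → List ℕ → Web r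
  | [], z => webIdent r (x ++ z)
  | k :: a, z => explodeAll r (x ++ [k]) a z * explode r x (k - 1) (ones a.sum ++ z)

theorem webIdent_mul_explodeAll (x a z : List ℕ) (ha : ∀ k ∈ a, 0 < k) :
    webIdent r (x ++ a ++ z) * explodeAll r x a z = explodeAll r x a z := by
  induction a generalizing x with
  | nil =>
    rw [List.append_nil]
    exact webIdent_mul_webIdent _
  | cons k a ih =>
    have h := ih (x ++ [k]) fun l hl => ha l (List.mem_cons_of_mem _ hl)
    simp only [List.append_assoc, List.cons_append, List.nil_append] at h
    rw [explodeAll, List.append_assoc, List.cons_append, ← mul_assoc, h]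

theorem explodeAll_mul_webIdent (x a z : List ℕ) (ha : ∀ k ∈ a, 0 < k) :
    explodeAll r x a z * webIdent r (x ++ ones a.sum ++ z) = explodeAll r x a z := by
  cases a with
  | nil => simpa [explodeAll, ones] using webIdent_mul_webIdent _
  | cons k a =>
    obtain ⟨k, rfl⟩ : ∃ n, k = n + 1 := ⟨k - 1, by have := ha k (by simp); omega⟩
    have h := explode_mul_webIdent (r := r) x k (ones a.sum ++ z)
    rw [List.append_assoc, ← List.append_assoc (ones _), ones_append, ← List.append_assoc] at h
    rw [explodeAll, mul_assoc, Nat.add_sub_cancel, List.sum_cons, h]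

theorem isLocal_explodeAll (a : List ℕ) (ha : ∀ k ∈ a, 0 < k) :
    IsLocal (ones a.sum) a (fun x z => explodeAll r x a z) := by
  induction a with
  | nil =>
    have h := isLocal_webIdent (r := r) []
    simp only [List.append_nil] at h
    exact h
  | cons k a ih =>
    obtain ⟨k, rfl⟩ : ∃ n, k = n + 1 := ⟨k - 1, by have := ha k (by simp); omega⟩
    have h1 := (ih fun l hl => ha l (List.mem_cons_of_mem _ hl)).extend [k + 1] []
    have h2 := (isLocal_explode (r := r) k).extend [] (ones a.sum)
    simp only [List.append_nil, List.nil_append, List.singleton_append, ones_append] at h1 h2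
    exact h1.mul h2

theorem IsLocal.explodeAll_right {b t : List ℕ} {T : List ℕ → List ℕ → Web r} (h : IsLocal b t T)
    (hl : ∀ x z, webIdent r (x ++ t ++ z) * T x z = T x z)
    (hr : ∀ x z, T x z * webIdent r (x ++ b ++ z) = T x z) (x y a z : List ℕ)
    (ha : ∀ k ∈ a, 0 < k) :
    explodeAll r (x ++ t ++ y) a z * T x (y ++ ones a.sum ++ z) =
      T x (y ++ a ++ z) * explodeAll r (x ++ b ++ y) a z := by
  induction a generalizing y with
  | nil =>
    have h1 := hl x (y ++ z)
    have h2 := hr x (y ++ z)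
    simp only [explodeAll, List.append_assoc, List.sum_nil, ones, List.replicate_zero,
      List.nil_append] at h1 h2 ⊢
    rw [h1, h2]
  | cons k a ih =>
    obtain ⟨k, rfl⟩ : ∃ n, k = n + 1 := ⟨k - 1, by have := ha k (by simp); omega⟩
    have h1 := ih (y ++ [k + 1]) fun l hl => ha l (List.mem_cons_of_mem _ hl)
    have h2 := h.explode_right hl hr x y k (ones a.sum ++ z)
    have h3 : ones (k + 1 + a.sum) = ones (k + 1) ++ ones a.sum := (ones_append _ _).symm
    simp only [explodeAll, List.append_assoc, List.sum_cons, h3, List.cons_append,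
      List.nil_append, Nat.add_sub_cancel] at h1 h2 ⊢
    rw [mul_assoc, h2, ← mul_assoc, h1, mul_assoc]

theorem explodeAll_append (x a b z : List ℕ) (hb : ∀ k ∈ b, 0 < k) :
    explodeAll r x (a ++ b) z =
      explodeAll r (x ++ a) b z * explodeAll r x a (ones b.sum ++ z) := by
  induction a generalizing x with
  | nil =>
    have h := explodeAll_mul_webIdent (r := r) x b z hb
    rw [List.append_assoc] at h
    rw [List.nil_append, List.append_nil, explodeAll, h]
  | cons k a ih =>
    rw [List.cons_append, explodeAll, ih, explodeAll, List.sum_append, ← ones_append,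
      List.append_assoc, List.append_assoc, List.singleton_append, mul_assoc]

theorem explodeAll_ones (x : List ℕ) (n : ℕ) (z : List ℕ) :
    explodeAll r x (ones n) z = webIdent r (x ++ ones n ++ z) := by
  induction n generalizing x with
  | zero => simp [explodeAll, ones]
  | succ n ih =>
    change explodeAll r x (1 :: ones n) z = webIdent r (x ++ 1 :: ones n ++ z)
    rw [explodeAll, ih, (ones_isObj n).2, Nat.sub_self, explode]
    simp only [List.append_assoc, List.cons_append, List.nil_append]
    exact webIdent_mul_webIdent _

theorem explodeAll_single (x : List ℕ) (k : ℕ) (z : List ℕ) :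
    explodeAll r x [k + 1] z = explode r x k z := by
  have h := webIdent_mul_explode (r := r) x k z
  simpa [explodeAll, ones] using h

theorem explodeAll_pair (x : List ℕ) (k l : ℕ) (z : List ℕ) :
    explodeAll r x [k + 1, l + 1] z =
      explode r (x ++ [k + 1]) l z * explode r x k (ones (l + 1) ++ z) := by
  rw [explodeAll, explodeAll_single]
  rfl

/-- The explosion of the middle strands `q` is moved to the bottom by exchanging it with that of
`x`. The factors above it then involve `x` and `y` only. -/
theorem explodeAll_mid (x q y : List ℕ) (hx : ∀ k ∈ x, 0 < k) (hq : ∀ k ∈ q, 0 < k)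
    (hy : ∀ k ∈ y, 0 < k) :
    explodeAll r [] (x ++ q ++ y) [] =
      explodeAll r (x ++ q) y [] * explodeAll r [] x (q ++ ones y.sum) *
        explodeAll r (ones x.sum) q (ones y.sum) := by
  have h := (isLocal_explodeAll x hx).explodeAll_right (r := r)
    (fun u z => webIdent_mul_explodeAll u x z hx) (fun u z => explodeAll_mul_webIdent u x z hx)
    [] [] q (ones y.sum) hq
  simp only [List.append_nil, List.nil_append] at h
  rw [explodeAll_append _ _ _ _ hy, explodeAll_append _ _ _ _ hq, List.nil_append, List.nil_append,
    List.append_nil, h, mul_assoc]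

/-- An elementary web slides below the explosions of its neighbours, so it only has to be studied
with thin strands on both sides. -/
theorem webLayer_mul_explodeAll (x : List ℕ) (p : Piece) (y : List ℕ) (hp : p.Pos)
    (hx : ∀ k ∈ x, 0 < k) (hy : ∀ k ∈ y, 0 < k) :
    webLayer r x p y * explodeAll r [] (x ++ p.bot ++ y) [] =
      explodeAll r (x ++ p.top) y [] * explodeAll r [] x (p.top ++ ones y.sum) *
        (webLayer r (ones x.sum) p (ones y.sum) *
          explodeAll r (ones x.sum) p.bot (ones y.sum)) := by
  have h1 := (isLocal_explodeAll y hy).left (r := r) p x [] []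
  have h2 := (isLocal_explodeAll x hx).right (r := r) p [] [] (ones y.sum)
  simp only [List.append_nil, List.nil_append] at h1 h2
  rw [explodeAll_mid x _ y hx (fun k hk => hp k (by simp [hk])) hy, mul_assoc, ← mul_assoc, h1,
    mul_assoc, ← mul_assoc (webLayer r x p (ones y.sum)), h2]
  simp only [mul_assoc]

end Explode

/-! ### Surjectivity -/

section Surjective

variable {r : ℕ}

variable (r) in
/-- The image of the Sergeev superalgebra in the web superalgebra. -/
def sergeevRange : Submodule ℂ (Web r) where
  carrier := {w | ∃ u, (sergeevHom r u).1 = w}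
  zero_mem' := ⟨0, congrArg Subtype.val (map_zero (sergeevHom r))⟩
  add_mem' := by
    rintro _ _ ⟨u, rfl⟩ ⟨v, rfl⟩
    exact ⟨u + v, congrArg Subtype.val (map_add (sergeevHom r) u v)⟩
  smul_mem' := by
    rintro z _ ⟨u, rfl⟩
    exact ⟨z • u, congrArg Subtype.val (map_smul (sergeevHom r) z u)⟩

theorem mul_mem_sergeevRange {v w : Web r} (hv : v ∈ sergeevRange r) (hw : w ∈ sergeevRange r) :
    v * w ∈ sergeevRange r := by
  obtain ⟨v, rfl⟩ := hv
  obtain ⟨w, rfl⟩ := hw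
  exact ⟨v * w, congrArg Subtype.val (map_mul (sergeevHom r) v w)⟩

theorem omega_mem_sergeevRange : omega r ∈ sergeevRange r :=
  ⟨1, congrArg Subtype.val (map_one (sergeevHom r))⟩

theorem omega_mul_of_mem {w : Web r} (hw : w ∈ sergeevRange r) : omega r * w = w := by
  obtain ⟨u, rfl⟩ := hw
  exact ((Subsemigroup.mem_corner_iff (omega_idem r)).1 (sergeevHom r u).2).1

theorem webIdent_eq_zero {a : List ℕ} (h : a.sum ≠ r) : webIdent r a = 0 := by
  rw [webIdent, ident, dif_neg (fun h1 => h (isObj_erase.1 h1)), map_zero]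

theorem webIdent_ones_mem (n : ℕ) : webIdent r (ones n) ∈ sergeevRange r := by
  by_cases h : n = r
  · rw [h, ← omega_eq_webIdent]
    exact omega_mem_sergeevRange
  · rw [webIdent_eq_zero (by rwa [(ones_isObj n).2])]
    exact Submodule.zero_mem _

theorem webDumbbell_ones_mem (m n : ℕ) :
    webDumbbell r (ones m) (ones n) ∈ sergeevRange r := by
  by_cases h : m + (n + 2) = r
  · have h1 : webDumbbell r (ones m) (ones n) = crossing r m + omega r := by
      rw [crossing_eq, omega_eq_webIdent, sub_add_cancel, show r - (m + 2) = n by omega]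
    rw [h1]
    exact Submodule.add_mem _ ⟨_, sergeevHom_s (i := m) (by omega)⟩ omega_mem_sergeevRange
  · rw [← webIdent_mul_webDumbbell, webIdent_eq_zero, zero_mul]
    · exact Submodule.zero_mem _
    · rw [List.sum_append, List.sum_cons, List.sum_cons, (ones_isObj m).2, (ones_isObj n).2]
      omega

theorem webDot_ones_mem (m n : ℕ) : webDot r (ones m) 1 (ones n) ∈ sergeevRange r := by
  by_cases h : m + (n + 1) = r
  · refine ⟨_, (sergeevHom_c (j := m) (by omega)).trans ?_⟩
    rw [strandDot_eq, show r - (m + 1) = n by omega]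
  · rw [← webIdent_mul_webDot, webIdent_eq_zero, zero_mul]
    · exact Submodule.zero_mem _
    · rw [List.sum_append, List.sum_cons, (ones_isObj m).2, (ones_isObj n).2]
      omega

/-- A dot on a thick strand becomes the sum of the dots on its thin strands, one merge with a
1-strand at a time. -/
theorem webDot_mul_explode (m k n : ℕ) : ∃ w ∈ sergeevRange r,
    webDot r (ones m) (k + 1) (ones n) * explode r (ones m) k (ones n) =
      explode r (ones m) k (ones n) * w := by
  induction k generalizing n with
  | zero =>
    refine ⟨_, webDot_ones_mem m n, ?_⟩
    rw [explode, webIdent_mul_webDot, webDot_mul_webIdent]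
  | succ k ih =>
    obtain ⟨w, hw, h⟩ := ih (n + 1)
    have h1 := (isLocal_explode (r := r) k).right (.dot 1) (ones m) [] (ones n)
    simp only [List.append_nil, ones_append] at h1
    refine ⟨_, Submodule.add_mem _ (webDot_ones_mem (m + (k + 1)) n) hw, ?_⟩
    change webDot r (ones m) (k + 1) (1 :: ones n) * explode r (ones m) k (1 :: ones n) =
      explode r (ones m) k (1 :: ones n) * w at h
    change webDot r (ones m ++ [k + 1]) 1 (ones n) * explode r (ones m) k (1 :: ones n) =
      explode r (ones m) k (1 :: ones n) * webDot r (ones (m + (k + 1))) 1 (ones n) at h1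
    rw [explode, ← mul_assoc, webDot_mul_webMerge _ _ k.succ_pos, add_mul, mul_assoc, mul_assoc, h,
      h1, mul_add, mul_assoc, mul_assoc]

/-- The split meets the last merge of the explosion. The square switch trades this pair for a
thinner split below a dumbbell and a merge, minus a multiple of the identity, and the induction
continues with the thinner split. -/
theorem webSplit_one_mul_explode (m k n : ℕ) : ∃ w ∈ sergeevRange r,
    webSplit r (ones m) (k + 1) 1 (ones n) * explode r (ones m) (k + 1) (ones n) =
      explode r (ones m) k (1 :: ones n) * w := by
  induction k generalizing n with
  | zero =>
    refine ⟨_, webDumbbell_ones_mem m n, ?_⟩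
    rw [explode, explode, webIdent_mul_webDumbbell, ← mul_assoc]
    exact webDumbbell_mul_webIdent _ _
  | succ k ih =>
    obtain ⟨w, hw, h⟩ := ih (n + 1)
    have h1 := (isLocal_explode (r := r) k).webDumbbell_right (ones m) [] (ones n)
    simp only [List.append_nil, ones_append] at h1
    change webDumbbell r (ones m ++ [k + 1]) (ones n) * explode r (ones m) k (1 :: 1 :: ones n) =
      explode r (ones m) k (1 :: 1 :: ones n) * webDumbbell r (ones (m + (k + 1))) (ones n) at h1
    change webSplit r (ones m) (k + 1) 1 (1 :: ones n) * explode r (ones m) (k + 1) (1 :: ones n) =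
      explode r (ones m) k (1 :: 1 :: ones n) * w at h
    have h2 := webIdent_mul_explode (r := r) (ones m) (k + 1) (1 :: ones n)
    have h3 := explode_mul_webIdent (r := r) (ones m) (k + 1) (1 :: ones n)
    rw [ones_append, ones_append_cons] at h3
    -- The new element of the image is the dumbbell on the last two 1-strands times the inductive
    -- one, minus `k + 1` times the identity, as dictated by the square switch.
    refine ⟨_, Submodule.sub_mem _
      (mul_mem_sergeevRange (webDumbbell_ones_mem (m + (k + 1)) n) hw)
      (Submodule.smul_mem _ ((k + 1 : ℕ) : ℂ) (webIdent_ones_mem (m + (k + 1 + 1) + (n + 1)))), ?_⟩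
    rw [explode, ← mul_assoc, webSplit_mul_webMerge_one _ _ k.succ_pos, sub_mul, smul_mul_assoc, h2,
      mul_sub, mul_smul_comm, h3, mul_assoc, h, mul_assoc, ← mul_assoc (webDumbbell r _ _), h1,
      explode]
    simp only [mul_assoc]

/-- Induction on the right leg: a general split is obtained by first splitting off one 1-strand,
then applying a smaller split, and merging the thin strand back. This requires division by the
thickness of the leg. -/
theorem webSplit_mul_explode (m k l n : ℕ) : ∃ w ∈ sergeevRange r,
    webSplit r (ones m) (k + 1) (l + 1) (ones n) * explode r (ones m) (k + l + 1) (ones n) =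
      explodeAll r (ones m) [k + 1, l + 1] (ones n) * w := by
  induction l generalizing n with
  | zero =>
    obtain ⟨w, hw, h⟩ := webSplit_one_mul_explode (r := r) m k n
    refine ⟨w, hw, ?_⟩
    have h2 := webIdent_mul_explode (r := r) (ones m) k (1 :: ones n)
    rw [explodeAll_pair, explode, List.append_assoc, List.singleton_append]
    exact h.trans (congrArg (· * w) h2.symm)
  | succ l ih =>
    obtain ⟨w, hw, h⟩ := webSplit_one_mul_explode (r := r) m (k + l + 1) n
    obtain ⟨w', hw', h'⟩ := ih (n + 1)
    have h1 := webMerge_mul_webSplit (r := r) (ones m ++ [k + 1]) (ones n) l.succ_pos one_pos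
    have h2 := webSplit_assoc (r := r) (ones m) (ones n) k.succ_pos l.succ_pos one_pos
    have h3 := webIdent_mul_webSplit (r := r) (ones m) (ones n) k.succ_pos (l + 1).succ_pos
    refine ⟨_, Submodule.smul_mem _ ((l : ℂ) + 2)⁻¹ (mul_mem_sergeevRange hw' hw), ?_⟩
    have h4 : ((l : ℂ) + 2) • (webSplit r (ones m) (k + 1) (l + 1 + 1) (ones n) *
        explode r (ones m) (k + (l + 1) + 1) (ones n)) =
        explodeAll r (ones m) [k + 1, l + 1 + 1] (ones n) * (w' * w) := by
      -- The factor is the digon coefficient for opening the right leg, of thickness `l + 2`, into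
      -- `l + 1` and `1`; coassociativity then reorders the two splits.
      have h5 : ((l : ℂ) + 2) • webSplit r (ones m) (k + 1) (l + 1 + 1) (ones n) =
          webMerge r (ones m ++ [k + 1]) (l + 1) 1 (ones n) *
            (webSplit r (ones m) (k + 1) (l + 1) (1 :: ones n) *
              webSplit r (ones m) (k + (l + 1) + 1) 1 (ones n)) := by
        rw [show k + (l + 1) + 1 = k.succ + l.succ by omega, ← h2, ← mul_assoc, h1,
          List.append_assoc, List.singleton_append, smul_mul_assoc, Nat.choose_one_right]
        refine Eq.trans ?_ (congrArg (((l.succ + 1 : ℕ) : ℂ) • ·) h3.symm)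
        push_cast
        congr 1
        ring
      rw [← smul_mul_assoc, h5, mul_assoc, mul_assoc, show k + (l + 1) + 1 = k + l + 1 + 1 by omega,
        h]
      change webSplit r (ones m) (k + 1) (l + 1) (1 :: ones n) *
        explode r (ones m) (k + l + 1) (1 :: ones n) = _ at h'
      rw [← mul_assoc (webSplit _ _ _ _ _), h', explodeAll_pair, explodeAll_pair, explode,
        ones_succ_append (l + 1)]
      simp only [mul_assoc]
      rfl
    rw [mul_smul_comm, ← h4, smul_smul, inv_mul_cancel₀ (natCast_add_two_ne_zero l)]
    exact (one_smul ℂ _).symm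

theorem webLayer_ones_mul_explodeAll (m : ℕ) (p : Piece) (hp : p.Pos) (n : ℕ) :
    ∃ w ∈ sergeevRange r, webLayer r (ones m) p (ones n) * explodeAll r (ones m) p.bot (ones n) =
      explodeAll r (ones m) p.top (ones n) * w := by
  cases p with
  | merge k l =>
    obtain ⟨k, rfl⟩ : ∃ n, k = n + 1 := ⟨k - 1, by have := hp k (by simp [Piece.bot]); omega⟩
    obtain ⟨l, rfl⟩ : ∃ n, l = n + 1 := ⟨l - 1, by have := hp l (by simp [Piece.bot]); omega⟩
    refine ⟨_, webIdent_ones_mem (m + (k + l + 1 + 1) + n), ?_⟩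
    have h := explode_mul_webIdent (r := r) (ones m) (k + l + 1) (ones n)
    rw [ones_append, ones_append] at h
    rw [Piece.bot, Piece.top, show k + 1 + (l + 1) = k + l + 1 + 1 by omega, explodeAll_single,
      explodeAll_pair, ← webMerge_eq_webLayer _ _ k.succ_pos l.succ_pos, webMerge_mul_explode, h]
  | split k l =>
    obtain ⟨k, rfl⟩ : ∃ n, k = n + 1 := ⟨k - 1, by have := hp k (by simp [Piece.top]); omega⟩
    obtain ⟨l, rfl⟩ : ∃ n, l = n + 1 := ⟨l - 1, by have := hp l (by simp [Piece.top]); omega⟩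
    rw [Piece.bot, Piece.top, show k + 1 + (l + 1) = k + l + 1 + 1 by omega, explodeAll_single,
      ← webSplit_eq_webLayer _ _ k.succ_pos l.succ_pos]
    exact webSplit_mul_explode m k l n
  | dot k =>
    obtain ⟨k, rfl⟩ : ∃ n, k = n + 1 := ⟨k - 1, by have := hp k (by simp [Piece.bot]); omega⟩
    rw [Piece.bot, Piece.top, explodeAll_single]
    exact webDot_mul_explode m k n

variable (r) in
/-- The span of the products of merges of 1-strands with the image of the Sergeev superalgebra. -/
def explodeSpan : Submodule ℂ (Web r) :=
  Submodule.span ℂ {j | ∃ a, IsObj r a ∧ ∃ w ∈ sergeevRange r, explodeAll r [] a [] * w = j}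

/-- The generator slides down to its own strands, crosses their explosion at the cost of a factor in
the image, and the explosions reassemble into that of its top sequence. -/
theorem gen_mul_mem_explodeSpan (g : WebGen r) {j : Web r} (hj : j ∈ explodeSpan r) :
    Web.mk r (FreeAlgebra.ι ℂ g) * j ∈ explodeSpan r := by
  induction hj using Submodule.span_induction with
  | mem j hj =>
    obtain ⟨a, ha, w, hw, rfl⟩ := hj
    have h0 := webIdent_mul_explodeAll (r := r) [] a [] ha.1
    rw [List.nil_append, List.append_nil] at h0
    by_cases hga : g.bot = a
    · subst hga
      cases g with
      | ident a ha' =>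
        have h1 : webIdent r a = Web.mk r (FreeAlgebra.ι ℂ (WebGen.ident a ha')) := by
          rw [webIdent, ident_eq ha' (erase_eq_self ha')]
        change webIdent r a * explodeAll r [] a [] = explodeAll r [] a [] at h0
        rw [← mul_assoc, ← h1]
        change webIdent r a * explodeAll r [] a [] * w ∈ _
        rw [h0]
        exact Submodule.subset_span ⟨a, ha, w, hw, rfl⟩
      | layer x p y hb ht =>
        have hx : ∀ k ∈ x, 0 < k := fun k hk => hb.1 k (by simp [hk])
        have hy : ∀ k ∈ y, 0 < k := fun k hk => hb.1 k (by simp [hk])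
        have hp : p.Pos := fun k hk => by
          rcases List.mem_append.1 hk with hk | hk
          · exact hb.1 k (by simp [hk])
          · exact ht.1 k (by simp [hk])
        have h1 : webLayer r x p y = Web.mk r (FreeAlgebra.ι ℂ (WebGen.layer x p y hb ht)) := by
          rw [webLayer, layer_eq (List.filter_eq_self.2 fun k hk => by simpa using hx k hk)
            (List.filter_eq_self.2 fun k hk => by simpa using hy k hk) hb ht]
        obtain ⟨w', hw', h2⟩ := webLayer_ones_mul_explodeAll (r := r) x.sum p hp y.sum
        rw [← mul_assoc, ← h1]
        change webLayer r x p y * explodeAll r [] (x ++ p.bot ++ y) [] * w ∈ _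
        rw [webLayer_mul_explodeAll x p y hp hx hy, h2, ← mul_assoc, ← explodeAll_mid x p.top y hx
          (fun k hk => hp k (by simp [hk])) hy, mul_assoc]
        exact Submodule.subset_span ⟨_, ht, _, mul_mem_sergeevRange hw' hw, rfl⟩
    -- The generator does not fit on the explosion: inserting the identity web of the top of the
    -- explosion shows that the product vanishes.
    · rw [← h0, ← mul_assoc, ← mul_assoc,
        gen_mul_webIdent_of_ne g (by rwa [erase_eq_self ha]) (by rwa [erase_eq_self ha]), zero_mul,
        zero_mul]
      exact Submodule.zero_mem _
  | zero =>
    rw [mul_zero]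
    exact Submodule.zero_mem _
  | add v w _ _ hv hw =>
    rw [mul_add]
    exact Submodule.add_mem _ hv hw
  | smul z w _ hw =>
    rw [mul_smul_comm]
    exact Submodule.smul_mem _ _ hw

theorem mul_mem_explodeSpan (v : Web r) {j : Web r} (hj : j ∈ explodeSpan r) :
    v * j ∈ explodeSpan r := by
  obtain ⟨v, rfl⟩ := RingQuot.mkAlgHom_surjective ℂ (WebRel r) v
  induction v using FreeAlgebra.induction generalizing j with
  | grade0 z =>
    rw [AlgHom.commutes, ← Algebra.smul_def]
    exact Submodule.smul_mem _ _ hj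
  | grade1 g => exact gen_mul_mem_explodeSpan g hj
  | mul u v hu hv =>
    rw [map_mul, mul_assoc]
    exact hu (hv hj)
  | add u v hu hv =>
    rw [map_add, add_mul]
    exact Submodule.add_mem _ (hu hj) (hv hj)

theorem omega_mem_explodeSpan : omega r ∈ explodeSpan r :=
  Submodule.subset_span ⟨ones r, ones_isObj r, omega r, omega_mem_sergeevRange, by
    rw [explodeAll_ones, List.nil_append, List.append_nil, ← omega_eq_webIdent, omega_mul_omega]⟩

/-- Orthogonality of the identity webs leaves only the explosion with top (1,…,1), which is ω
itself. -/
theorem omega_mul_mem_sergeevRange {j : Web r} (hj : j ∈ explodeSpan r) :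
    omega r * j ∈ sergeevRange r := by
  induction hj using Submodule.span_induction with
  | mem j hj =>
    obtain ⟨a, ha, w, hw, rfl⟩ := hj
    by_cases h : ones r = a
    · subst h
      rw [explodeAll_ones, List.nil_append, List.append_nil, ← omega_eq_webIdent,
        omega_mul_of_mem hw, omega_mul_of_mem hw]
      exact hw
    · have h0 := webIdent_mul_explodeAll (r := r) [] a [] ha.1
      rw [List.nil_append, List.append_nil] at h0
      rw [← h0, omega, ← mul_assoc, ← mul_assoc,
        gen_mul_webIdent_of_ne _ (by rwa [erase_eq_self ha]) (by rwa [erase_eq_self ha]), zero_mul,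
        zero_mul]
      exact Submodule.zero_mem _
  | zero =>
    rw [mul_zero]
    exact Submodule.zero_mem _
  | add v w _ _ hv hw =>
    rw [mul_add]
    exact Submodule.add_mem _ hv hw
  | smul z w _ hw =>
    rw [mul_smul_comm]
    exact Submodule.smul_mem _ _ hw

/-- For `w` in the corner, `w` = ω w ω. Since ω lies in `explodeSpan`, so does w ω, and left
multiplication by ω lands in the image. -/
theorem sergeevHom_surjective : Function.Surjective (sergeevHom r) := fun w => by
  have h := (Subsemigroup.mem_corner_iff (omega_idem r)).1 w.2
  have h1 := omega_mul_mem_sergeevRange (mul_mem_explodeSpan w.1 (omega_mem_explodeSpan (r := r)))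
  rw [h.2, h.1] at h1
  obtain ⟨u, hu⟩ := h1
  exact ⟨u, Subtype.ext hu⟩

end Surjective

end

end QWeb

/-- There is an isomorphism of superalgebras from the Sergeev superalgebra onto `a_ω W a_ω` which
sends each `s` to a crossing and each `c` to a dot. -/
theorem corollary5p3 (r : ℕ) (hr : 0 < r) :
    ∃ ξ : QWeb.Sergeev r ≃ₐ[ℂ] QWeb.OmegaWeb r,
      (∀ (i : ℕ) (hi : i + 1 < r), (ξ (QWeb.Sergeev.s i hi)).1 = QWeb.crossing r i) ∧
      (∀ (j : ℕ) (hj : j < r), (ξ (QWeb.Sergeev.c j hj)).1 = QWeb.strandDot r j) ∧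
      (∀ (p : ZMod 2) (u : QWeb.Sergeev r),
        (ξ u).1 ∈ QWeb.Web.part r p ↔ u ∈ QWeb.Sergeev.part r p) :=
  ⟨AlgEquiv.ofBijective (QWeb.sergeevHom r)
      ⟨QWeb.sergeevHom_injective, QWeb.sergeevHom_surjective⟩,
    fun _ hi => QWeb.sergeevHom_s hi, fun _ hj => QWeb.sergeevHom_c hj,
    QWeb.sergeevHom_mem_part_iff⟩
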